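/- Let $d\ge 1$ and $0<\beta<\alpha\le 1$. Let $H_0=-\Delta$ with domain $H^2(\mathbb R^d)$ in $L^2(\mathbb R^d)$, and write $\hat v(\xi)=(2\pi)^{-d/2}\int_{\mathbb R^d} e^{-ix\cdot\xi}v(x)\,dx$ for the unitary Fourier transform. Let $u_0\in L^2(\mathbb R^d)$, $u_0\neq 0$, be such that $\hat u_0$ is a $C^1$ function with compact support. Consider the time-fractional Schrödinger problem $-i^\beta\partial_t^\alpha u+H_0u=0$ on $\mathbb R^d\times(0,\infty)$, $u(\cdot,0)=u_0$, where $i^\beta=e^{i\pi\beta/2}$ and $\partial_t^\alpha$ is the Caputo derivative, $\partial_t^\alpha u(t)=\Gamma(1-\alpha)^{-1}\int_0^t (t-s)^{-\alpha}u'(s)\,ds$ for $\alpha<1$ and $\partial_t^1u=u'$. A solution is a function $u\in L^1_{\rm loc}((0,\infty);H^2(\mathbb R^d))$ which belongs to $W^{1,1}(0,T;L^2(\mathbb R^d))$ for every $T>0$ (and is identified with its continuous representative), satisfies the equation almost everywhere, and satisfies $\lim_{t\downarrow0}\|u(\cdot,t)-u_0\|_{L^2}=0$. Then there is a unique solution $u$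 on $[0,\infty)$; for all $t\ge 0$ one has $(1+|x|^2)^{1/2}u(\cdot,t)\in L^2(\mathbb R^d)$, and the mean square displacement $$D_2(u_0,t)=\int_{\mathbb R^d}|x|^2|u(x,t)|^2\,dx=\|\nabla\hat u(\cdot,t)\|_{L^2}^2$$ grows exponentially: there is $a>0$ with $D_2(u_0,t)\ge e^{at}$ for all large $t$. More precisely, there are finite constants $c,C>0$, depending only on $d,\alpha,\beta,u_0$, such that for all real $\Lambda_-\ge 0$ and $\Lambda_+$ with $\operatorname{supp}\hat u_0\subset\{\xi\in\mathbb R^d:\Lambda_-\le|\xi|\le\Lambda_+\}$, as $t\to\infty$, $$e^{2\cos(\frac{\pi\beta}{2\alpha})\Lambda_-^{2/\alpha}t}\bigl(c+O(t^{-1})\bigr)\le D_2(u_0,t)\le e^{2\cos(\frac{\pi\beta}{2\alpha})\Lambda_+^{2/\alpha}t}\bigl(C+O(t^{-1})\bigr).$$ Moreover, with $N:=\bigl\||\xi|^{\frac{2-\alpha}{\alpha}}\hat u_0\bigr\|_{L^2}^2$, for each of the two prefactors $p(t)=\frac{4}{\alpha^2}\,t$ and $p(t)=\frac{4}{\alpha^4}\,t^2$,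 as $t\to\infty$, $$p(t)\,e^{2\cos(\frac{\pi\beta}{2\alpha})\Lambda_-^{2/\alpha}t}\bigl(N+O(t^{-1})\bigr)\le D_2(u_0,t)\le p(t)\,e^{2\cos(\frac{\pi\beta}{2\alpha})\Lambda_+^{2/\alpha}t}\bigl(N+O(t^{-1})\bigr).$$ -/

import Mathlib

open MeasureTheory Filter Topology Asymptotics
open scoped SchwartzMap Laplacian

noncomputable section

/-- The Euclidean space `ℝ^d`. -/
abbrev RSpace (d : ℕ) : Type := EuclideanSpace ℝ (Fin d)

/-- The complex Hilbert space `L²(ℝ^d)`. -/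
abbrev L2Space (d : ℕ) : Type := Lp ℂ 2 (volume : Measure (RSpace d))

/-- The adjoint Fourier transform with the unitary normalization in angular frequency,
`(F* g)(x) = (2π)^{-d/2} ∫ e^{i x·ξ} g(ξ) dξ`, for integrable `g`. -/
def adjointFourier {d : ℕ} (g : RSpace d → ℂ) (x : RSpace d) : ℂ :=
  (((2 * Real.pi) ^ (-(d : ℝ) / 2) : ℝ) : ℂ) *
    ∫ ξ : RSpace d, Complex.exp (Complex.I * ((inner ℝ x ξ : ℝ) : ℂ)) * g ξ

/-- `f` lies in the domain `H²(ℝ^d)` of `H₀ = -Δ`, and `H₀ f = h`. -/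
def IsFreeHamiltonian {d : ℕ} (f h : L2Space d) : Prop :=
  TemperedDistribution.MemSobolev 2 2 (f : 𝓢'(RSpace d, ℂ)) ∧
    -(Δ (f : 𝓢'(RSpace d, ℂ))) = (h : 𝓢'(RSpace d, ℂ))

/-- The Caputo derivative of order `α ∈ (0, 1]` of a function with weak derivative `v`: it is
`Γ(1-α)⁻¹ ∫₀ᵗ (t-s)^{-α} v(s) ds` for `α < 1`, and `v(t)` for `α = 1`. -/
def caputo {d : ℕ} (α : ℝ) (v : ℝ → L2Space d) (t : ℝ) : L2Space d :=
  if α = 1 then v t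
  else (Real.Gamma (1 - α))⁻¹ • ∫ s in (0 : ℝ)..t, ((t - s) ^ (-α) : ℝ) • v s

/-- `v` is integrable on every `(0, T)` and is the weak derivative of `u` there, where `u` stands for
the continuous representative on `[0, ∞)`; that is, `u ∈ W^{1,1}(0, T; L²(ℝ^d))` for every `T`
and `u' = v`. -/
def IsW11WithDeriv {d : ℕ} (u v : ℝ → L2Space d) : Prop :=
  (∀ T : ℝ, 0 < T → IntegrableOn v (Set.Ioc 0 T) volume) ∧
    ∀ t : ℝ, 0 ≤ t → u t = u 0 + ∫ s in (0 : ℝ)..t, v s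

/-- `u` solves `-i^β ∂_t^α u + H₀ u = 0` on `ℝ^d × (0, ∞)` with initial state `u₀`. Here `v` is the
time derivative of `u`, and `h = H₀ u`, so that local integrability of `h` (and continuity of `u`)
says that `u` is locally integrable with values in the domain of `H₀`. -/
def IsTFSESolution {d : ℕ} (α β : ℝ) (u₀ : L2Space d) (u : ℝ → L2Space d) : Prop :=
  ∃ v h : ℝ → L2Space d,
    IsW11WithDeriv u v ∧
    LocallyIntegrableOn h (Set.Ioi 0) volume ∧
    (∀ᵐ t : ℝ ∂(volume.restrict (Set.Ioi 0)), IsFreeHamiltonian (u t) (h t)) ∧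
    (∀ᵐ t : ℝ ∂(volume.restrict (Set.Ioi 0)),
      -((Complex.I ^ (β : ℂ)) • caputo α v t) + h t = 0) ∧
    Tendsto (fun t => ‖u t - u₀‖) (𝓝[>] (0 : ℝ)) (𝓝 0)

/-- Membership in the weighted space of all `φ ∈ L²` with `(1 + |x|²)^{1/2} φ ∈ L²`. -/
def MemWeightedL2 {d : ℕ} (φ : L2Space d) : Prop :=
  Integrable (fun x : RSpace d => (1 + ‖x‖ ^ 2) * ‖φ x‖ ^ 2) volume

/-- The mean square displacement `∫ |x|² |φ(x)|² dx`. -/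
def meanSquareDisplacement {d : ℕ} (φ : L2Space d) : ℝ :=
  ∫ x : RSpace d, ‖x‖ ^ 2 * ‖φ x‖ ^ 2

/-- The squared norm `‖ |ξ|^{(2-α)/α} g ‖²` in `L²(ℝ^d)`. -/
def weightedNormSq {d : ℕ} (α : ℝ) (g : RSpace d → ℂ) : ℝ :=
  ∫ ξ : RSpace d, (‖ξ‖ ^ ((2 - α) / α) * ‖g ξ‖) ^ 2

/-- The exponential `exp(2 cos(πβ/(2α)) Λ^{2/α} t)`. -/
def growthExp (α β L t : ℝ) : ℝ :=
  Real.exp (2 * Real.cos (Real.pi * β / (2 * α)) * L ^ (2 / α) * t)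

end

/-!
Put `κ = cos(πβ/(2α))`. On the Fourier side the solution is
`E_α(i^{-β} |ξ|² t^α) û₀(ξ)`, with `E_α` the Mittag-Leffler function, and its mean square
displacement is the squared `L²` norm of the gradient of this function of `ξ`. Writing
`i^{-β} = s₀^α` with `Re s₀ = κ`, the inversion of the Laplace transform of `t ↦ E_α(s₀^α t^α)`
along a line that is shifted past the pole at `s₀` gives `E_α(s₀^α t^α) = α⁻¹ exp(s₀ t) + O(1)`.
The shift is carried out for the image under `t d/dt`, whose transform decays integrably.

The gradient is thus of size `t exp(κ |ξ|^{2/α} t)` wherever `û₀ ≠ 0`. As `û₀` is continuous it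
carries mass at frequencies strictly above `Λ₋`, which yields the growth of `exp(2κ Λ₋^{2/α} t)`
with any power of `t` to spare. As `û₀` is Lipschitz and vanishes where `|ξ|` is maximal on its
support, the gap between `|ξ|` and `Λ₊` absorbs the factor `t` in the upper bound.

For uniqueness, the part of the difference of two solutions below any fixed frequency solves a
homogeneous Volterra equation with a bounded generator, whose iteration forces it to vanish.
-/

section FractionalIntegral

open Set

/-! ### Fractional integration -/

/-- The kernel `t^(a-1) / Γ(a)` of fractional integration of order `a`. -/
noncomputable def fracKernel (a t : ℝ) : ℝ := t ^ (a - 1) / Real.Gamma a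

theorem fracKernel_one (t : ℝ) : fracKernel 1 t = 1 := by simp [fracKernel]

theorem fracKernel_zero_right {a : ℝ} (ha : a ≠ 1) : fracKernel a 0 = 0 := by
  simp [fracKernel, Real.zero_rpow (sub_ne_zero.2 ha)]

theorem fracKernel_nonneg {a t : ℝ} (ha : 0 < a) (ht : 0 ≤ t) : 0 ≤ fracKernel a t :=
  div_nonneg (Real.rpow_nonneg ht _) (Real.Gamma_pos_of_pos ha).le

theorem fracKernel_pos {a t : ℝ} (ha : 0 < a) (ht : 0 < t) : 0 < fracKernel a t :=
  div_pos (Real.rpow_pos_of_pos ht _) (Real.Gamma_pos_of_pos ha)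

theorem measurable_fracKernel (a : ℝ) : Measurable (fracKernel a) := by
  unfold fracKernel
  fun_prop

theorem integral_rpow_mul_sub_rpow {a b t : ℝ} (ha : 0 < a) (hb : 0 < b) (ht : 0 < t) :
    ∫ s in (0 : ℝ)..t, s ^ (a - 1) * (t - s) ^ (b - 1) =
      t ^ (a + b - 1) * ProbabilityTheory.beta a b := by
  rw [← Complex.ofReal_inj, ← intervalIntegral.integral_ofReal]
  calc ∫ s in (0 : ℝ)..t, ((s ^ (a - 1) * (t - s) ^ (b - 1) : ℝ) : ℂ)
      = ∫ s in (0 : ℝ)..t, (s : ℂ) ^ ((a : ℂ) - 1) * ((t : ℂ) - s) ^ ((b : ℂ) - 1) := by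
        refine intervalIntegral.integral_congr fun s hs => ?_
        rw [uIcc_of_le ht.le] at hs
        simp only [Complex.ofReal_mul, Complex.ofReal_cpow hs.1,
          Complex.ofReal_cpow (sub_nonneg.2 hs.2), Complex.ofReal_sub, Complex.ofReal_one]
    _ = (t : ℂ) ^ ((a : ℂ) + b - 1) * Complex.betaIntegral a b :=
        Complex.betaIntegral_scaled a b ht
    _ = _ := by
        rw [Complex.betaIntegral_eq_Gamma_mul_div _ _ (by simpa) (by simpa),
          ProbabilityTheory.beta]
        push_cast [Complex.ofReal_cpow ht.le, ← Complex.Gamma_ofReal]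
        rfl

theorem integral_fracKernel_mul_fracKernel {a b t : ℝ} (ha : 0 < a) (hb : 0 < b) (ht : 0 < t) :
    ∫ s in (0 : ℝ)..t, fracKernel a (t - s) * fracKernel b s = fracKernel (a + b) t := by
  have hΓa := (Real.Gamma_pos_of_pos ha).ne'
  have hΓb := (Real.Gamma_pos_of_pos hb).ne'
  calc ∫ s in (0 : ℝ)..t, fracKernel a (t - s) * fracKernel b s
      = ∫ s in (0 : ℝ)..t, s ^ (b - 1) * (t - s) ^ (a - 1) / (Real.Gamma a * Real.Gamma b) := by
        refine intervalIntegral.integral_congr fun s _ => ?_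
        simp only [fracKernel]
        ring
    _ = fracKernel (a + b) t := by
        rw [intervalIntegral.integral_div, integral_rpow_mul_sub_rpow hb ha ht,
          ProbabilityTheory.beta, fracKernel, add_comm b a]
        field_simp

theorem intervalIntegrable_fracKernel_mul_fracKernel {a b t : ℝ} (ha : 0 < a) (hb : 0 < b)
    (ht : 0 < t) :
    IntervalIntegrable (fun s => fracKernel a (t - s) * fracKernel b s) volume 0 t :=
  intervalIntegral.intervalIntegrable_of_integral_ne_zero <| by
    rw [integral_fracKernel_mul_fracKernel ha hb ht]
    exact (fracKernel_pos (add_pos ha hb) ht).ne'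

theorem intervalIntegrable_fracKernel_sub_mul_fracKernel_sub {a b s t : ℝ} (ha : 0 < a)
    (hb : 0 < b) (hst : s < t) :
    IntervalIntegrable (fun τ => fracKernel a (t - τ) * fracKernel b (τ - s)) volume s t := by
  simpa using
    (intervalIntegrable_fracKernel_mul_fracKernel ha hb (sub_pos.2 hst)).comp_sub_right s

theorem integral_fracKernel_sub_mul_fracKernel_sub {a b s t : ℝ} (ha : 0 < a) (hb : 0 < b)
    (hst : s < t) :
    ∫ τ in s..t, fracKernel a (t - τ) * fracKernel b (τ - s) = fracKernel (a + b) (t - s) := by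
  rw [← integral_fracKernel_mul_fracKernel ha hb (sub_pos.2 hst)]
  simpa using (intervalIntegral.integral_comp_sub_right
    (fun σ => fracKernel a (t - s - σ) * fracKernel b σ) s (a := s) (b := t))

variable {X : Type*} [NormedAddCommGroup X] [NormedSpace ℝ X]

/-- The Riemann–Liouville fractional integral of order `a` with base point `0`. -/
noncomputable def fracIntegral (a : ℝ) (f : ℝ → X) (t : ℝ) : X :=
  ∫ s in (0 : ℝ)..t, fracKernel a (t - s) • f s

theorem fracIntegral_one (f : ℝ → X) (t : ℝ) : fracIntegral 1 f t = ∫ s in (0 : ℝ)..t, f s := by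
  simp [fracIntegral, fracKernel_one]

/-- The kernel of the iterated fractional integral `I^a I^b` at time `t`, as a function of the outer
and inner variables `(τ, s)`; vanishing for `τ ≤ s`, it can be integrated over the whole square. -/
noncomputable def iteratedFracKernel (a b t : ℝ) (p : ℝ × ℝ) : ℝ :=
  {p : ℝ × ℝ | p.2 < p.1}.indicator
    (fun p => fracKernel a (t - p.1) * fracKernel b (p.1 - p.2)) p

theorem measurable_iteratedFracKernel (a b t : ℝ) : Measurable (iteratedFracKernel a b t) :=
  (((measurable_fracKernel a).comp (by fun_prop)).mul
    ((measurable_fracKernel b).comp (by fun_prop))).indicator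
      (measurableSet_lt measurable_snd measurable_fst)

theorem iteratedFracKernel_nonneg {a b t : ℝ} (ha : 0 < a) (hb : 0 < b) {p : ℝ × ℝ}
    (hp : p.1 ≤ t) : 0 ≤ iteratedFracKernel a b t p :=
  indicator_apply_nonneg fun h => mul_nonneg (fracKernel_nonneg ha (sub_nonneg.2 hp))
    (fracKernel_nonneg hb (sub_nonneg.2 (le_of_lt h)))

theorem iteratedFracKernel_left (a b t s : ℝ) :
    (fun τ => iteratedFracKernel a b t (τ, s)) =
      (Ioi s).indicator fun τ => fracKernel a (t - τ) * fracKernel b (τ - s) :=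
  rfl

theorem iteratedFracKernel_right (a b t τ : ℝ) :
    (fun s => iteratedFracKernel a b t (τ, s)) =
      (Iio τ).indicator fun s => fracKernel a (t - τ) * fracKernel b (τ - s) :=
  rfl

theorem integrableOn_iteratedFracKernel_left {a b s t : ℝ} (ha : 0 < a) (hb : 0 < b)
    (hs : 0 ≤ s) (hst : s < t) :
    IntegrableOn (fun τ => iteratedFracKernel a b t (τ, s)) (Ioc 0 t) := by
  rw [iteratedFracKernel_left, IntegrableOn, integrable_indicator_iff measurableSet_Ioi,
    IntegrableOn, Measure.restrict_restrict measurableSet_Ioi, inter_comm, Ioc_inter_Ioi,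
    sup_of_le_right hs, ← IntegrableOn, ← intervalIntegrable_iff_integrableOn_Ioc_of_le hst.le]
  exact intervalIntegrable_fracKernel_sub_mul_fracKernel_sub ha hb hst

theorem integral_iteratedFracKernel_left {a b s t : ℝ} (ha : 0 < a) (hb : 0 < b)
    (hs : 0 ≤ s) (hst : s < t) :
    ∫ τ in Ioc 0 t, iteratedFracKernel a b t (τ, s) = fracKernel (a + b) (t - s) := by
  rw [iteratedFracKernel_left, setIntegral_indicator measurableSet_Ioi, Ioc_inter_Ioi,
    sup_of_le_right hs, ← intervalIntegral.integral_of_le hst.le,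
    integral_fracKernel_sub_mul_fracKernel_sub ha hb hst]

theorem integral_iteratedFracKernel_smul_right (a b : ℝ) (f : ℝ → X) {t τ : ℝ}
    (hτ : τ ∈ Ioc 0 t) :
    ∫ s in Ioc 0 t, iteratedFracKernel a b t (τ, s) • f s =
      fracKernel a (t - τ) • fracIntegral b f τ := by
  have hind : (fun s => iteratedFracKernel a b t (τ, s) • f s) =
      (Iio τ).indicator fun s => fracKernel a (t - τ) • fracKernel b (τ - s) • f s := by
    funext s
    rw [congrFun (iteratedFracKernel_right a b t τ) s, ← indicator_smul_apply_left]
    simp only [smul_smul]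
  have hinter : Ioc 0 t ∩ Iio τ = Ioo 0 τ := by
    ext s
    exact ⟨fun h => ⟨h.1.1, h.2⟩, fun h => ⟨⟨h.1, h.2.le.trans hτ.2⟩, h.2⟩⟩
  rw [hind, setIntegral_indicator measurableSet_Iio, hinter, ← integral_Ioc_eq_integral_Ioo,
    integral_smul, fracIntegral, intervalIntegral.integral_of_le hτ.1.le]

theorem ae_mem_Ioo_of_restrict_Ioc (a b : ℝ) :
    ∀ᵐ s ∂(volume.restrict (Ioc a b)), s ∈ Ioo a b := by
  rw [← restrict_Ioo_eq_restrict_Ioc]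
  exact ae_restrict_mem measurableSet_Ioo

theorem aestronglyMeasurable_of_fracKernel_smul {a t : ℝ} (ha : 0 < a) {f : ℝ → X}
    (hf : AEStronglyMeasurable (fun s => fracKernel a (t - s) • f s)
      (volume.restrict (Ioc 0 t))) :
    AEStronglyMeasurable f (volume.restrict (Ioc 0 t)) := by
  have hinv : Measurable fun s => (fracKernel a (t - s))⁻¹ :=
    ((measurable_fracKernel a).comp (by fun_prop)).inv
  refine (hinv.aestronglyMeasurable.smul hf).congr ?_
  filter_upwards [ae_mem_Ioo_of_restrict_Ioc 0 t] with s hs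
  exact inv_smul_smul₀ (fracKernel_pos ha (sub_pos.2 hs.2)).ne' _

theorem integrable_iteratedFracKernel_smul {a b t : ℝ} (ha : 0 < a) (hb : 0 < b) {f : ℝ → X}
    (hf : IntegrableOn (fun s => fracKernel (a + b) (t - s) • f s) (Ioc 0 t)) :
    Integrable (fun p : ℝ × ℝ => iteratedFracKernel a b t p • f p.2)
      ((volume.restrict (Ioc 0 t)).prod (volume.restrict (Ioc 0 t))) := by
  have hmeas : AEStronglyMeasurable (fun p : ℝ × ℝ => iteratedFracKernel a b t p • f p.2)
      ((volume.restrict (Ioc 0 t)).prod (volume.restrict (Ioc 0 t))) :=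
    (measurable_iteratedFracKernel a b t).aestronglyMeasurable.smul
      (aestronglyMeasurable_of_fracKernel_smul (add_pos ha hb) hf.1).comp_snd
  refine (integrable_prod_iff' hmeas).2 ⟨?_, hf.norm.congr ?_⟩
  · filter_upwards [ae_mem_Ioo_of_restrict_Ioc 0 t] with s hs
    exact (integrableOn_iteratedFracKernel_left ha hb hs.1.le hs.2).smul_const (f s)
  · filter_upwards [ae_mem_Ioo_of_restrict_Ioc 0 t] with s hs
    calc ‖fracKernel (a + b) (t - s) • f s‖
        = (∫ τ in Ioc 0 t, iteratedFracKernel a b t (τ, s)) * ‖f s‖ := by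
          rw [integral_iteratedFracKernel_left ha hb hs.1.le hs.2, norm_smul,
            Real.norm_of_nonneg (fracKernel_nonneg (add_pos ha hb) (sub_pos.2 hs.2).le)]
      _ = ∫ τ in Ioc 0 t, ‖iteratedFracKernel a b t (τ, s) • f s‖ := by
          rw [← integral_mul_const]
          refine setIntegral_congr_fun measurableSet_Ioc fun τ hτ => ?_
          rw [norm_smul, Real.norm_of_nonneg (iteratedFracKernel_nonneg ha hb hτ.2)]

theorem integrableOn_fracKernel_smul_fracIntegral [CompleteSpace X] {a b t : ℝ} (ha : 0 < a)
    (hb : 0 < b) {f : ℝ → X}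
    (hf : IntegrableOn (fun s => fracKernel (a + b) (t - s) • f s) (Ioc 0 t)) :
    IntegrableOn (fun τ => fracKernel a (t - τ) • fracIntegral b f τ) (Ioc 0 t) :=
  IntegrableOn.congr_fun (integrable_iteratedFracKernel_smul ha hb hf).integral_prod_left
    (fun _ hτ => integral_iteratedFracKernel_smul_right a b f hτ) measurableSet_Ioc

theorem fracIntegral_fracIntegral [CompleteSpace X] {a b t : ℝ} (ha : 0 < a) (hb : 0 < b)
    (ht : 0 ≤ t) {f : ℝ → X}
    (hf : IntegrableOn (fun s => fracKernel (a + b) (t - s) • f s) (Ioc 0 t)) :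
    fracIntegral a (fracIntegral b f) t = fracIntegral (a + b) f t := by
  rw [fracIntegral, fracIntegral, intervalIntegral.integral_of_le ht,
    intervalIntegral.integral_of_le ht]
  calc ∫ τ in Ioc 0 t, fracKernel a (t - τ) • fracIntegral b f τ
      = ∫ τ in Ioc 0 t, ∫ s in Ioc 0 t, iteratedFracKernel a b t (τ, s) • f s :=
        setIntegral_congr_fun measurableSet_Ioc fun τ hτ =>
          (integral_iteratedFracKernel_smul_right a b f hτ).symm
    _ = ∫ s in Ioc 0 t, ∫ τ in Ioc 0 t, iteratedFracKernel a b t (τ, s) • f s :=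
        integral_integral_swap (integrable_iteratedFracKernel_smul ha hb hf)
    _ = ∫ s in Ioc 0 t, fracKernel (a + b) (t - s) • f s := by
        refine integral_congr_ae ?_
        filter_upwards [ae_mem_Ioo_of_restrict_Ioc 0 t] with s hs
        rw [integral_smul_const, integral_iteratedFracKernel_left ha hb hs.1.le hs.2]

end FractionalIntegral

section FractionalSeries

open Set

theorem rpow_mul_exp_neg_le_Gamma_add_one {M a : ℝ} (hM : 0 < M) (ha : 0 ≤ a) :
    M ^ a * Real.exp (-M) ≤ Real.Gamma (a + 1) := by
  have hint := Real.GammaIntegral_convergent (s := a + 1) (by linarith)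
  calc M ^ a * Real.exp (-M) = ∫ x in Ioi M, M ^ a * Real.exp (-x) := by
        rw [integral_const_mul, integral_exp_neg_Ioi]
    _ ≤ ∫ x in Ioi M, Real.exp (-x) * x ^ (a + 1 - 1) := by
        refine setIntegral_mono_on ((integrableOn_exp_neg_Ioi M).const_mul _)
          (hint.mono_set (Ioi_subset_Ioi hM.le)) measurableSet_Ioi fun x hx => ?_
        rw [add_sub_cancel_right, mul_comm]
        exact mul_le_mul_of_nonneg_left (Real.rpow_le_rpow hM.le (le_of_lt hx) ha)
          (Real.exp_pos _).le
    _ ≤ ∫ x in Ioi 0, Real.exp (-x) * x ^ (a + 1 - 1) := by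
        refine setIntegral_mono_set hint ?_ (Ioi_subset_Ioi hM.le).eventuallyLE
        filter_upwards [ae_restrict_mem measurableSet_Ioi] with x hx
        exact mul_nonneg (Real.exp_pos _).le (Real.rpow_nonneg (le_of_lt hx) _)
    _ = Real.Gamma (a + 1) := (Real.Gamma_eq_integral (by linarith)).symm

theorem summable_pow_div_Gamma {α b : ℝ} (hα : 0 < α) (hb : 0 < b) (r : ℝ) :
    Summable fun k : ℕ => r ^ k / Real.Gamma (α * k + b) := by
  obtain ⟨M, hM, hMα⟩ : ∃ M : ℝ, 0 < M ∧ M ^ α = 2 * (|r| + 1) :=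
    ⟨(2 * (|r| + 1)) ^ α⁻¹, by positivity, Real.rpow_inv_rpow (by positivity) hα.ne'⟩
  have hmajorant : Summable fun k : ℕ => Real.exp M * M ^ (-b) *
      (α * ((k : ℝ) ^ 1 * (1 / 2) ^ k) + b * (1 / 2) ^ k) :=
    (((summable_pow_mul_geometric_of_norm_lt_one 1 (by norm_num)).mul_left α).add
      (summable_geometric_two.mul_left b)).mul_left _
  refine hmajorant.of_norm_bounded fun k => ?_
  have hpos : 0 < α * k + b := by positivity
  have hΓ := Real.Gamma_pos_of_pos hpos
  have hM_rpow : M ^ (α * k + b) = (2 * (|r| + 1)) ^ k * M ^ b := by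
    rw [Real.rpow_add hM, Real.rpow_mul hM.le, hMα, Real.rpow_natCast]
  rw [norm_div, norm_pow, Real.norm_eq_abs, Real.norm_of_nonneg hΓ.le, div_le_iff₀ hΓ]
  calc |r| ^ k ≤ (|r| + 1) ^ k := by gcongr; linarith
    _ = Real.exp M * M ^ (-b) * (1 / 2) ^ k * (M ^ (α * k + b) * Real.exp (-M)) := by
        rw [hM_rpow, Real.rpow_neg hM.le, Real.exp_neg, mul_pow, one_div, inv_pow]
        field_simp
    _ ≤ Real.exp M * M ^ (-b) * (1 / 2) ^ k * ((α * k + b) * Real.Gamma (α * k + b)) := by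
        rw [← Real.Gamma_add_one hpos.ne']
        gcongr
        exact rpow_mul_exp_neg_le_Gamma_add_one hM hpos.le
    _ = _ := by ring

theorem summable_fracKernel_mul_pow {α b : ℝ} (hα : 0 < α) (hb : 0 < b) (r : ℝ) {t : ℝ}
    (ht : 0 < t) : Summable fun k : ℕ => fracKernel (α * k + b) t * r ^ k := by
  refine ((summable_pow_div_Gamma hα hb (t ^ α * r)).mul_left (t ^ (b - 1))).congr fun k => ?_
  rw [fracKernel, add_sub_assoc, Real.rpow_add ht, Real.rpow_mul ht.le, Real.rpow_natCast, mul_pow]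
  ring

theorem integrable_tsum_of_summable_integral_norm {γ E : Type*} [MeasurableSpace γ]
    {μ : Measure γ} [NormedAddCommGroup E] [NormedSpace ℝ E] {F : ℕ → γ → E}
    (hF : ∀ i, Integrable (F i) μ) (hsum : Summable fun i => ∫ a, ‖F i a‖ ∂μ)
    (hs : ∀ᵐ a ∂μ, Summable fun i => F i a) :
    Integrable (fun a => ∑' i, F i a) μ := by
  refine ⟨aestronglyMeasurable_of_tendsto_ae atTop (f := fun n a => ∑ i ∈ Finset.range n, F i a)
    (fun n => Finset.aestronglyMeasurable_fun_sum _ fun i _ => (hF i).1)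
    (hs.mono fun a ha => ha.hasSum.tendsto_sum_nat), ?_⟩
  calc ∫⁻ a, ‖∑' i, F i a‖ₑ ∂μ ≤ ∫⁻ a, ∑' i, ‖F i a‖ₑ ∂μ :=
        lintegral_mono fun a => enorm_tsum_le_tsum_enorm
    _ = ∑' i, ENNReal.ofReal (∫ a, ‖F i a‖ ∂μ) := by
        rw [lintegral_tsum fun i => (hF i).1.enorm]
        exact tsum_congr fun i => (ofReal_integral_norm_eq_lintegral_enorm (hF i)).symm
    _ < ⊤ := hsum.tsum_ofReal_lt_top

variable {X : Type*} [NormedAddCommGroup X] [NormedSpace ℝ X]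

theorem norm_iterate_apply_le (B : X →L[ℝ] X) (x : X) (k : ℕ) : ‖B^[k] x‖ ≤ ‖B‖ ^ k * ‖x‖ := by
  induction k with
  | zero => simp
  | succ k ih =>
    rw [Function.iterate_succ_apply', pow_succ', mul_assoc]
    exact B.le_opNorm_of_le ih

/-- The series `∑ₖ t^(αk+b-1)/Γ(αk+b) Bᵏ x`, that is `t^(b-1) E_{α,b}(t^α B) x` with the
two-parameter Mittag-Leffler function `E_{α,b}`. -/
noncomputable def fracSeries (α b : ℝ) (B : X →L[ℝ] X) (x : X) (t : ℝ) : X :=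
  ∑' k : ℕ, fracKernel (α * k + b) t • B^[k] x

theorem fracSeries_one_zero {α : ℝ} (hα : 0 < α) (B : X →L[ℝ] X) (x : X) :
    fracSeries α 1 B x 0 = x := by
  rw [fracSeries, tsum_eq_single 0]
  · simp [fracKernel_one]
  · intro k hk
    have : 0 < α * k := by positivity
    rw [fracKernel_zero_right (by linarith), zero_smul]

variable {α a b t : ℝ}

theorem summable_fracKernel_mul_norm_iterate (hα : 0 < α) (hb : 0 < b) (ht : 0 < t)
    (B : X →L[ℝ] X) (x : X) : Summable fun k : ℕ => fracKernel (α * k + b) t * ‖B^[k] x‖ := by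
  have hK (k : ℕ) : 0 ≤ fracKernel (α * k + b) t := fracKernel_nonneg (by positivity) ht.le
  refine ((summable_fracKernel_mul_pow hα hb ‖B‖ ht).mul_right ‖x‖).of_nonneg_of_le
    (fun k => mul_nonneg (hK k) (norm_nonneg _)) fun k => ?_
  rw [mul_assoc]
  exact mul_le_mul_of_nonneg_left (norm_iterate_apply_le B x k) (hK k)

theorem integrableOn_fracKernel_mul_fracKernel (ha : 0 < a) (hb : 0 < b) (ht : 0 < t) :
    IntegrableOn (fun s => fracKernel a (t - s) * fracKernel b s) (Ioc 0 t) :=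
  (intervalIntegrable_iff_integrableOn_Ioc_of_le ht.le).1
    (intervalIntegrable_fracKernel_mul_fracKernel ha hb ht)

theorem setIntegral_fracKernel_mul_fracKernel (hα : 0 < α) (ha : 0 < a) (hb : 0 < b) (ht : 0 < t)
    (k : ℕ) : ∫ s in Ioc 0 t, fracKernel a (t - s) * fracKernel (α * k + b) s =
      fracKernel (α * k + (a + b)) t := by
  rw [← intervalIntegral.integral_of_le ht.le,
    integral_fracKernel_mul_fracKernel ha (by positivity) ht, add_left_comm]

theorem summable_integral_norm_fracKernel_smul (hα : 0 < α) (ha : 0 < a) (hb : 0 < b) (ht : 0 < t)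
    (B : X →L[ℝ] X) (x : X) :
    Summable fun k : ℕ =>
      ∫ s in Ioc 0 t, ‖(fracKernel a (t - s) * fracKernel (α * k + b) s) • B^[k] x‖ := by
  refine (summable_fracKernel_mul_norm_iterate hα (add_pos ha hb) ht B x).congr fun k => ?_
  rw [← setIntegral_fracKernel_mul_fracKernel hα ha hb ht, ← integral_mul_const]
  refine setIntegral_congr_fun measurableSet_Ioc fun s hs => ?_
  rw [norm_smul, Real.norm_of_nonneg (mul_nonneg (fracKernel_nonneg ha (sub_nonneg.2 hs.2))
    (fracKernel_nonneg (by positivity) hs.1.le))]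

section CompleteSpace

variable [CompleteSpace X]

theorem summable_fracSeries (hα : 0 < α) (hb : 0 < b) (B : X →L[ℝ] X) (x : X) (ht : 0 < t) :
    Summable fun k : ℕ => fracKernel (α * k + b) t • B^[k] x := by
  refine (summable_fracKernel_mul_norm_iterate hα hb ht B x).of_norm_bounded fun k => ?_
  rw [norm_smul, Real.norm_of_nonneg (fracKernel_nonneg (by positivity) ht.le)]

theorem fracSeries_one_eq_add (hα : 0 < α) (B : X →L[ℝ] X) (x : X) (ht : 0 < t) :
    fracSeries α 1 B x t = x + fracSeries α (α + 1) B (B x) t := by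
  rw [fracSeries, (summable_fracSeries hα one_pos B x ht).tsum_eq_zero_add, fracSeries]
  congr 1
  · simp [fracKernel_one]
  · refine tsum_congr fun k => ?_
    rw [Function.iterate_succ_apply, Nat.cast_succ, mul_add_one, add_assoc]

theorem map_fracSeries (hα : 0 < α) (hb : 0 < b) (B : X →L[ℝ] X) (x : X) (ht : 0 < t) :
    B (fracSeries α b B x t) = fracSeries α b B (B x) t := by
  rw [fracSeries, B.map_tsum (summable_fracSeries hα hb B x ht), fracSeries]
  refine tsum_congr fun k => ?_
  rw [map_smul, ← Function.iterate_succ_apply, Function.iterate_succ_apply']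

theorem hasSum_fracKernel_smul_fracSeries (a t : ℝ) {s : ℝ} (hα : 0 < α) (hb : 0 < b) (hs : 0 < s)
    (B : X →L[ℝ] X) (x : X) :
    HasSum (fun k : ℕ => (fracKernel a (t - s) * fracKernel (α * k + b) s) • B^[k] x)
      (fracKernel a (t - s) • fracSeries α b B x s) := by
  simpa only [mul_smul, fracSeries] using
    (summable_fracSeries hα hb B x hs).hasSum.const_smul (fracKernel a (t - s))

theorem integrableOn_fracKernel_smul_fracSeries (hα : 0 < α) (ha : 0 < a) (hb : 0 < b)
    (ht : 0 < t) (B : X →L[ℝ] X) (x : X) :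
    IntegrableOn (fun s => fracKernel a (t - s) • fracSeries α b B x s) (Ioc 0 t) := by
  have hsum (s : ℝ) (hs : s ∈ Ioc 0 t) := hasSum_fracKernel_smul_fracSeries a t hα hb hs.1 B x
  refine IntegrableOn.congr_fun (integrable_tsum_of_summable_integral_norm (fun k =>
    (integrableOn_fracKernel_mul_fracKernel ha (by positivity) ht).smul_const _)
    (summable_integral_norm_fracKernel_smul hα ha hb ht B x) ?_)
    (fun s hs => (hsum s hs).tsum_eq) measurableSet_Ioc
  filter_upwards [ae_restrict_mem measurableSet_Ioc] with s hs using (hsum s hs).summable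

theorem fracIntegral_fracSeries (hα : 0 < α) (ha : 0 < a) (hb : 0 < b) (ht : 0 < t)
    (B : X →L[ℝ] X) (x : X) :
    fracIntegral a (fracSeries α b B x) t = fracSeries α (a + b) B x t := by
  calc fracIntegral a (fracSeries α b B x) t
      = ∫ s in Ioc 0 t, ∑' k : ℕ, (fracKernel a (t - s) * fracKernel (α * k + b) s) • B^[k] x := by
        rw [fracIntegral, intervalIntegral.integral_of_le ht.le]
        exact setIntegral_congr_fun measurableSet_Ioc fun s hs =>
          (hasSum_fracKernel_smul_fracSeries a t hα hb hs.1 B x).tsum_eq.symm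
    _ = ∑' k : ℕ, ∫ s in Ioc 0 t, (fracKernel a (t - s) * fracKernel (α * k + b) s) • B^[k] x :=
        (integral_tsum_of_summable_integral_norm (fun k =>
          (integrableOn_fracKernel_mul_fracKernel ha (by positivity) ht).smul_const _)
          (summable_integral_norm_fracKernel_smul hα ha hb ht B x)).symm
    _ = fracSeries α (a + b) B x t := tsum_congr fun k => by
        rw [integral_smul_const, setIntegral_fracKernel_mul_fracKernel hα ha hb ht]

theorem integrableOn_fracSeries (hα : 0 < α) (hb : 0 < b) (B : X →L[ℝ] X) (x : X) (ht : 0 < t) :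
    IntegrableOn (fracSeries α b B x) (Ioc 0 t) := by
  simpa only [fracKernel_one, one_smul] using
    integrableOn_fracKernel_smul_fracSeries hα one_pos hb ht B x

theorem integral_fracSeries (hα : 0 < α) (hb : 0 < b) (B : X →L[ℝ] X) (x : X) (ht : 0 < t) :
    ∫ s in (0 : ℝ)..t, fracSeries α b B x s = fracSeries α (b + 1) B x t := by
  rw [← fracIntegral_one, fracIntegral_fracSeries hα one_pos hb ht, add_comm]

end CompleteSpace

/-! ### Uniqueness for linear fractional integral equations -/

theorem norm_le_of_eq_fracIntegral (hα : 0 < α) (B : X →L[ℝ] X) {z : ℝ → X} {T M : ℝ}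
    (hM : ∀ t ∈ Ioc 0 T, ‖z t‖ ≤ M)
    (hz : ∀ t ∈ Ioc 0 T, z t = fracIntegral α (fun τ => B (z τ)) t) (n : ℕ) :
    ∀ t ∈ Ioc 0 T, ‖z t‖ ≤ ‖B‖ ^ n * M * fracKernel (α * n + 1) t := by
  induction n with
  | zero => simpa [fracKernel_one] using hM
  | succ n ih =>
    intro t ht
    have hb : 0 < α * n + 1 := by positivity
    have hbound (τ : ℝ) (hτ : τ ∈ Ioc 0 t) : ‖fracKernel α (t - τ) • B (z τ)‖ ≤
        ‖B‖ ^ (n + 1) * M * (fracKernel α (t - τ) * fracKernel (α * n + 1) τ) := by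
      have hK := fracKernel_nonneg hα (sub_nonneg.2 hτ.2)
      rw [norm_smul, Real.norm_of_nonneg hK]
      calc fracKernel α (t - τ) * ‖B (z τ)‖
          ≤ fracKernel α (t - τ) * (‖B‖ * (‖B‖ ^ n * M * fracKernel (α * n + 1) τ)) :=
            mul_le_mul_of_nonneg_left (B.le_opNorm_of_le (ih τ ⟨hτ.1, hτ.2.trans ht.2⟩)) hK
        _ = _ := by ring
    calc ‖z t‖ ≤ ∫ τ in (0 : ℝ)..t,
          ‖B‖ ^ (n + 1) * M * (fracKernel α (t - τ) * fracKernel (α * n + 1) τ) := by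
          rw [hz t ht]
          exact intervalIntegral.norm_integral_le_of_norm_le ht.1.le (ae_of_all _ hbound)
            ((intervalIntegrable_fracKernel_mul_fracKernel hα hb ht.1).const_mul _)
      _ = ‖B‖ ^ (n + 1) * M * fracKernel (α * (n + 1 : ℕ) + 1) t := by
          rw [intervalIntegral.integral_const_mul,
            integral_fracKernel_mul_fracKernel hα hb ht.1, Nat.cast_succ, mul_add_one,
            add_right_comm, add_comm α]

theorem eq_zero_of_eq_fracIntegral (hα : 0 < α) (B : X →L[ℝ] X) {z : ℝ → X} {T M : ℝ}
    (hM : ∀ t ∈ Ioc 0 T, ‖z t‖ ≤ M)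
    (hz : ∀ t ∈ Ioc 0 T, z t = fracIntegral α (fun τ => B (z τ)) t) :
    ∀ t ∈ Ioc 0 T, z t = 0 := fun t ht => by
  have hlim := ((summable_fracKernel_mul_pow hα one_pos ‖B‖ ht.1).mul_right M).tendsto_atTop_zero
  refine norm_le_zero_iff.1 (ge_of_tendsto' hlim fun n => ?_)
  exact (norm_le_of_eq_fracIntegral hα B hM hz n t ht).trans_eq (by ring)

end FractionalSeries

section LaplaceTransform

open Set

/-! ### Laplace transforms -/

/-- `f` has an absolutely convergent Laplace integral at `s`, with value `v`. -/
def HasLaplaceAt (f : ℝ → ℂ) (s v : ℂ) : Prop :=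
  IntegrableOn (fun t : ℝ => Complex.exp (-(s * t)) * f t) (Ioi 0) ∧
    ∫ t in Ioi (0 : ℝ), Complex.exp (-(s * t)) * f t = v

namespace HasLaplaceAt

variable {f g : ℝ → ℂ} {s v w : ℂ}

theorem congr_fun (hf : HasLaplaceAt f s v) (h : EqOn f g (Ioi 0)) : HasLaplaceAt g s v := by
  have h' : EqOn (fun t : ℝ => Complex.exp (-(s * t)) * f t)
      (fun t : ℝ => Complex.exp (-(s * t)) * g t) (Ioi 0) := fun t ht => by
    simp only [h ht]
  exact ⟨hf.1.congr_fun h' measurableSet_Ioi,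
    (setIntegral_congr_fun measurableSet_Ioi h').symm.trans hf.2⟩

theorem sub (hf : HasLaplaceAt f s v) (hg : HasLaplaceAt g s w) :
    HasLaplaceAt (fun t => f t - g t) s (v - w) := by
  simp only [HasLaplaceAt, mul_sub]
  exact ⟨hf.1.sub hg.1, by rw [integral_sub hf.1 hg.1, hf.2, hg.2]⟩

theorem const_mul (hf : HasLaplaceAt f s v) (c : ℂ) :
    HasLaplaceAt (fun t => c * f t) s (c * v) := by
  simp only [HasLaplaceAt, mul_left_comm _ c]
  exact ⟨hf.1.const_mul c, by rw [integral_const_mul, hf.2]⟩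

theorem cexp_mul {a : ℂ} (hf : HasLaplaceAt f (s - a) v) :
    HasLaplaceAt (fun t : ℝ => Complex.exp (a * t) * f t) s v := by
  have h (t : ℝ) : Complex.exp (-(s * t)) * (Complex.exp (a * t) * f t) =
      Complex.exp (-((s - a) * t)) * f t := by
    rw [← mul_assoc, ← Complex.exp_add]
    ring_nf
  simpa only [HasLaplaceAt, h] using hf

theorem tsum {F : ℕ → ℝ → ℂ} {v : ℕ → ℂ} (hF : ∀ k, HasLaplaceAt (F k) s (v k))
    (hsum : Summable fun k => ∫ t in Ioi (0 : ℝ), ‖Complex.exp (-(s * t)) * F k t‖)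
    (hf : ∀ t : ℝ, 0 < t → HasSum (fun k => F k t) (f t)) : HasLaplaceAt f s (∑' k, v k) := by
  have hpt (t : ℝ) (ht : t ∈ Ioi (0 : ℝ)) := (hf t ht).mul_left (Complex.exp (-(s * t)))
  have hcongr : EqOn (fun t : ℝ => ∑' k, Complex.exp (-(s * t)) * F k t)
      (fun t : ℝ => Complex.exp (-(s * t)) * f t) (Ioi 0) := fun t ht => (hpt t ht).tsum_eq
  refine ⟨IntegrableOn.congr_fun (integrable_tsum_of_summable_integral_norm (fun k => (hF k).1)
    hsum ?_) hcongr measurableSet_Ioi, ?_⟩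
  · filter_upwards [ae_restrict_mem measurableSet_Ioi] with t ht using (hpt t ht).summable
  · rw [← setIntegral_congr_fun measurableSet_Ioi hcongr,
      ← integral_tsum_of_summable_integral_norm (fun k => (hF k).1) hsum]
    exact tsum_congr fun k => (hF k).2

end HasLaplaceAt

variable {b : ℝ} {s : ℂ}

theorem norm_cexp_mul_rpow (b : ℝ) (s : ℂ) {t : ℝ} (ht : 0 < t) :
    ‖Complex.exp (-(s * t)) * ((t ^ b : ℝ) : ℂ)‖ = t ^ b * Real.exp (-(s.re * t)) := by
  rw [norm_mul, Complex.norm_real, Complex.norm_exp, Real.norm_of_nonneg (Real.rpow_nonneg ht.le _),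
    mul_comm]
  simp

theorem measurable_cexp_mul_rpow (b : ℝ) (s : ℂ) :
    Measurable fun t : ℝ => Complex.exp (-(s * t)) * ((t ^ b : ℝ) : ℂ) :=
  (Continuous.measurable (by fun_prop)).mul (Complex.measurable_ofReal.comp (by fun_prop))

theorem integrableOn_rpow_mul_exp_neg_mul {r : ℝ} (hb : -1 < b) (hr : 0 < r) :
    IntegrableOn (fun t : ℝ => t ^ b * Real.exp (-(r * t))) (Ioi 0) := by
  simpa using integrableOn_rpow_mul_exp_neg_mul_rpow (p := 1) hb one_pos hr

theorem integrableOn_cexp_mul_rpow (hb : -1 < b) (hs : 0 < s.re) :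
    IntegrableOn (fun t : ℝ => Complex.exp (-(s * t)) * ((t ^ b : ℝ) : ℂ)) (Ioi 0) := by
  refine (integrableOn_rpow_mul_exp_neg_mul hb hs).mono'
    (measurable_cexp_mul_rpow b s).aestronglyMeasurable ?_
  filter_upwards [ae_restrict_mem measurableSet_Ioi] with t ht using (norm_cexp_mul_rpow b s ht).le

theorem integral_norm_cexp_mul_rpow (hb : -1 < b) (hs : 0 < s.re) :
    ∫ t in Ioi (0 : ℝ), ‖Complex.exp (-(s * t)) * ((t ^ b : ℝ) : ℂ)‖ =
      Real.Gamma (b + 1) * s.re ^ (-(b + 1)) := by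
  rw [setIntegral_congr_fun measurableSet_Ioi fun t ht => norm_cexp_mul_rpow b s ht]
  have h := Real.integral_rpow_mul_exp_neg_mul_Ioi (a := b + 1) (by linarith) hs
  rw [add_sub_cancel_right, one_div, Real.inv_rpow hs.le, ← Real.rpow_neg hs.le] at h
  rw [h, mul_comm]

theorem isOpen_rightHalfPlane : IsOpen {s : ℂ | 0 < s.re} :=
  isOpen_lt continuous_const Complex.continuous_re

theorem differentiableOn_integral_cexp_mul_rpow (hb : -1 < b) :
    DifferentiableOn ℂ (fun s : ℂ =>
      ∫ t in Ioi (0 : ℝ), Complex.exp (-(s * t)) * ((t ^ b : ℝ) : ℂ)) {s | 0 < s.re} := by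
  intro s (hs : 0 < s.re)
  have hU : {w : ℂ | s.re / 2 < w.re} ∈ 𝓝 s :=
    (isOpen_lt continuous_const Complex.continuous_re).mem_nhds (half_lt_self hs)
  refine (hasDerivAt_integral_of_dominated_loc_of_deriv_le hU
    (F' := fun w t => Complex.exp (-(w * t)) * (-t) * ((t ^ b : ℝ) : ℂ))
    (bound := fun t : ℝ => t ^ (b + 1) * Real.exp (-(s.re / 2 * t)))
    (Eventually.of_forall fun w => (measurable_cexp_mul_rpow b w).aestronglyMeasurable)
    (integrableOn_cexp_mul_rpow hb hs) ?_ ?_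
    (integrableOn_rpow_mul_exp_neg_mul (by linarith) (half_pos hs))
    ?_).2.differentiableAt.differentiableWithinAt
  · exact ((Continuous.measurable (by fun_prop)).mul
      (Complex.measurable_ofReal.comp (by fun_prop))).aestronglyMeasurable
  · filter_upwards [ae_restrict_mem measurableSet_Ioi] with t (ht : 0 < t) w (hw : s.re / 2 < w.re)
    rw [mul_right_comm, norm_mul, norm_cexp_mul_rpow b w ht, norm_neg, Complex.norm_real,
      Real.norm_of_nonneg ht.le, Real.rpow_add_one ht.ne', mul_right_comm]
    gcongr
  · refine ae_of_all _ fun t w _ => HasDerivAt.mul_const ?_ _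
    exact (((hasDerivAt_id w).mul_const (t : ℂ)).neg.congr_deriv (by simp)).cexp

theorem integral_exp_mul_rpow_of_pos (hb : -1 < b) {r : ℝ} (hr : 0 < r) :
    ∫ t in Ioi (0 : ℝ), Complex.exp (-((r : ℂ) * t)) * ((t ^ b : ℝ) : ℂ) =
      Real.Gamma (b + 1) * (r : ℂ) ^ (-((b : ℂ) + 1)) := by
  have h := Complex.integral_cpow_mul_exp_neg_mul_Ioi (a := (b + 1 : ℝ)) (r := r)
    (by rw [Complex.ofReal_re]; linarith) hr
  have harg : (r : ℂ).arg ≠ Real.pi := by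
    rw [Complex.arg_ofReal_of_nonneg hr.le]
    exact Real.pi_ne_zero.symm
  rw [Complex.Gamma_ofReal, one_div, Complex.inv_cpow _ _ harg, ← Complex.cpow_neg] at h
  rw [mul_comm]
  push_cast at h
  rw [← h]
  refine setIntegral_congr_fun measurableSet_Ioi fun t ht => ?_
  simp only [Complex.ofReal_cpow (le_of_lt (mem_Ioi.1 ht)), add_sub_cancel_right, mul_comm]

/-- Both sides are analytic in the right half plane and agree on the positive reals. -/
theorem integral_cexp_mul_rpow (hb : -1 < b) (hs : 0 < s.re) :
    ∫ t in Ioi (0 : ℝ), Complex.exp (-(s * t)) * ((t ^ b : ℝ) : ℂ) =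
      Real.Gamma (b + 1) * s ^ (-((b : ℂ) + 1)) := by
  have hrhs : AnalyticOnNhd ℂ (fun s : ℂ => (Real.Gamma (b + 1) : ℂ) * s ^ (-((b : ℂ) + 1)))
      {s : ℂ | 0 < s.re} :=
    DifferentiableOn.analyticOnNhd (fun w hw => ((differentiableAt_id.cpow_const
      (Or.inl hw)).const_mul _).differentiableWithinAt) isOpen_rightHalfPlane
  refine ((differentiableOn_integral_cexp_mul_rpow hb).analyticOnNhd
    isOpen_rightHalfPlane).eqOn_of_preconnected_of_frequently_eq hrhs
    (convex_halfSpace_re_gt 0).isPreconnected (z₀ := 1) (by simp) ?_ hs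
  have hreal : Tendsto (fun r : ℝ => (r : ℂ)) (𝓝[≠] 1) (𝓝[≠] (1 : ℂ)) := by
    refine tendsto_nhdsWithin_iff.2 ⟨?_, ?_⟩
    · exact (Complex.continuous_ofReal.tendsto' 1 1 Complex.ofReal_one).mono_left nhdsWithin_le_nhds
    · filter_upwards [self_mem_nhdsWithin] with r hr using by simpa using hr
  refine hreal.frequently (Eventually.frequently ?_)
  filter_upwards [nhdsWithin_le_nhds (lt_mem_nhds one_pos)] with r hr
    using integral_exp_mul_rpow_of_pos hb hr

theorem hasLaplaceAt_rpow (hb : -1 < b) (hs : 0 < s.re) :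
    HasLaplaceAt (fun t => (t ^ b : ℝ)) s (Real.Gamma (b + 1) * s ^ (-((b : ℂ) + 1))) :=
  ⟨integrableOn_cexp_mul_rpow hb hs, integral_cexp_mul_rpow hb hs⟩

theorem hasLaplaceAt_one (hs : 0 < s.re) : HasLaplaceAt (fun _ => 1) s s⁻¹ := by
  simpa [Complex.cpow_neg_one] using hasLaplaceAt_rpow (b := 0) (by norm_num) hs

theorem hasLaplaceAt_id (hs : 0 < s.re) : HasLaplaceAt (fun t => t) s (s ^ 2)⁻¹ := by
  simpa [Complex.cpow_neg, one_add_one_eq_two] using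
    hasLaplaceAt_rpow (b := 1) (by norm_num) hs

theorem hasLaplaceAt_cexp {a : ℂ} (hs : a.re < s.re) :
    HasLaplaceAt (fun t => Complex.exp (a * t)) s (s - a)⁻¹ := by
  simpa using (hasLaplaceAt_one (s := s - a) (by simpa using hs)).cexp_mul

theorem hasLaplaceAt_mul_cexp {a : ℂ} (hs : a.re < s.re) :
    HasLaplaceAt (fun t => t * Complex.exp (a * t)) s ((s - a) ^ 2)⁻¹ := by
  simpa only [mul_comm] using (hasLaplaceAt_id (s := s - a) (by simpa using hs)).cexp_mul

end LaplaceTransform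

section MittagLeffler

open Set

/-! ### Mittag-Leffler functions along rays -/

variable {α : ℝ} {ω s : ℂ}

/-- The Mittag-Leffler function `E_α`. -/
noncomputable def mittagLeffler (α : ℝ) (z : ℂ) : ℂ :=
  ∑' k : ℕ, (((Real.Gamma (α * k + 1))⁻¹ : ℝ) : ℂ) * z ^ k

/-- The logarithmic derivative `t ∂ₜ E_α(ω t^α)` of the Mittag-Leffler function along a ray. -/
noncomputable def mittagLefflerRay (α : ℝ) (ω : ℂ) (t : ℝ) : ℂ :=
  α * (ω * (t ^ α : ℝ)) * deriv (mittagLeffler α) (ω * (t ^ α : ℝ))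

/-- The Laplace transform of `mittagLefflerRay α ω`. -/
noncomputable def raySymbol (α : ℝ) (ω s : ℂ) : ℂ :=
  α * ω * s ^ ((α : ℂ) - 1) / (s ^ (α : ℂ) - ω) ^ 2

theorem norm_inv_Gamma_mul_pow (hα : 0 < α) (k : ℕ) (z : ℂ) :
    ‖(((Real.Gamma (α * k + 1))⁻¹ : ℝ) : ℂ) * z ^ k‖ = ‖z‖ ^ k / Real.Gamma (α * k + 1) := by
  have := (Real.Gamma_pos_of_pos (show 0 < α * k + 1 by positivity)).le
  rw [norm_mul, Complex.norm_real, norm_pow, Real.norm_of_nonneg (inv_nonneg.2 this)]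
  ring

theorem norm_inv_Gamma_mul_pow_le (hα : 0 < α) {R : ℝ} (k : ℕ) (w : ℂ)
    (hw : w ∈ Metric.ball (0 : ℂ) R) :
    ‖(((Real.Gamma (α * k + 1))⁻¹ : ℝ) : ℂ) * w ^ k‖ ≤ R ^ k / Real.Gamma (α * k + 1) := by
  have := (Real.Gamma_pos_of_pos (show 0 < α * k + 1 by positivity)).le
  rw [norm_inv_Gamma_mul_pow hα]
  have hw' : ‖w‖ ≤ R := (mem_ball_zero_iff.1 hw).le
  gcongr

theorem hasSum_mittagLeffler (hα : 0 < α) (z : ℂ) :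
    HasSum (fun k : ℕ => (((Real.Gamma (α * k + 1))⁻¹ : ℝ) : ℂ) * z ^ k) (mittagLeffler α z) :=
  ((summable_pow_div_Gamma hα one_pos ‖z‖).of_norm_bounded fun k =>
    (norm_inv_Gamma_mul_pow hα k z).le).hasSum

theorem differentiable_mittagLeffler (hα : 0 < α) : Differentiable ℂ (mittagLeffler α) := by
  intro z
  have h := Complex.differentiableOn_tsum_of_summable_norm
    (summable_pow_div_Gamma hα one_pos (‖z‖ + 1))
    (F := fun (k : ℕ) w => (((Real.Gamma (α * k + 1))⁻¹ : ℝ) : ℂ) * w ^ k)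
    (fun k => (by fun_prop)) Metric.isOpen_ball (norm_inv_Gamma_mul_pow_le hα)
  exact h.differentiableAt (Metric.isOpen_ball.mem_nhds (by simp))

theorem hasSum_mul_deriv_mittagLeffler (hα : 0 < α) (z : ℂ) :
    HasSum (fun k : ℕ => ((k * (Real.Gamma (α * k + 1))⁻¹ : ℝ) : ℂ) * z ^ k)
      (z * deriv (mittagLeffler α) z) := by
  have h := Complex.hasSum_deriv_of_summable_norm
    (summable_pow_div_Gamma hα one_pos (‖z‖ + 1))
    (F := fun (k : ℕ) w => (((Real.Gamma (α * k + 1))⁻¹ : ℝ) : ℂ) * w ^ k)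
    (fun k => (by fun_prop)) Metric.isOpen_ball (norm_inv_Gamma_mul_pow_le hα)
    (z := z) (by simp)
  refine (h.mul_left z).congr_fun fun k => ?_
  rw [((hasDerivAt_pow k z).const_mul _).deriv]
  rcases k with _ | k
  · simp
  · push_cast
    rw [pow_succ]
    ring

theorem continuous_mittagLefflerRay (hα : 0 < α) (ω : ℂ) :
    Continuous (mittagLefflerRay α ω) := by
  have hz : Continuous fun t : ℝ => ω * ((t ^ α : ℝ) : ℂ) :=
    continuous_const.mul (Complex.continuous_ofReal.comp
      (Real.continuous_rpow_const hα.le))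
  exact (continuous_const.mul hz).mul
    ((differentiable_mittagLeffler hα).deriv.continuous.comp hz)

theorem hasDerivAt_mittagLeffler_ray (hα : 0 < α) (ω : ℂ) {t : ℝ} (ht : 0 < t) :
    HasDerivAt (fun t : ℝ => mittagLeffler α (ω * (t ^ α : ℝ)))
      (mittagLefflerRay α ω t / t) t := by
  have hinner : HasDerivAt (fun t : ℝ => ω * ((t ^ α : ℝ) : ℂ))
      (ω * ((α * t ^ (α - 1) : ℝ) : ℂ)) t :=
    ((Real.hasDerivAt_rpow_const (Or.inl ht.ne')).ofReal_comp).const_mul ω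
  refine ((differentiable_mittagLeffler hα _).hasDerivAt.comp t hinner).congr_deriv ?_
  have ht' : (t : ℂ) ≠ 0 := by exact_mod_cast ht.ne'
  rw [mittagLefflerRay, Real.rpow_sub_one ht.ne']
  push_cast
  field_simp

theorem hasSum_mittagLefflerRay (hα : 0 < α) (ω : ℂ) {t : ℝ} (ht : 0 < t) :
    HasSum (fun k : ℕ => ((α * k / Real.Gamma (α * k + 1) : ℝ) : ℂ) * ω ^ k *
      ((t ^ (α * k) : ℝ) : ℂ)) (mittagLefflerRay α ω t) := by
  rw [mittagLefflerRay, mul_assoc]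
  refine ((hasSum_mul_deriv_mittagLeffler hα (ω * (t ^ α : ℝ))).mul_left (α : ℂ)).congr_fun
    fun k => ?_
  rw [Real.rpow_mul ht.le, Real.rpow_natCast, mul_pow]
  push_cast
  ring

theorem hasLaplaceAt_mittagLefflerRay_term (hα : 0 < α) (ω : ℂ) (hs : 0 < s.re) (k : ℕ) :
    HasLaplaceAt
      (fun t => ((α * k / Real.Gamma (α * k + 1) : ℝ) : ℂ) * ω ^ k * ((t ^ (α * k) : ℝ) : ℂ))
      s (α * s⁻¹ * (k * (ω * s ^ (-(α : ℂ))) ^ k)) := by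
  have hsne : s ≠ 0 := fun h => by simp [h] at hs
  have hΓ : ((Real.Gamma (α * k + 1) : ℝ) : ℂ) ≠ 0 := by
    exact_mod_cast (Real.Gamma_pos_of_pos (by positivity)).ne'
  have hb : -1 < α * k := by linarith [show 0 ≤ α * k by positivity]
  convert (hasLaplaceAt_rpow hb hs).const_mul _ using 1
  rw [neg_add, Complex.cpow_add _ _ hsne, Complex.cpow_neg_one, mul_pow, ← Complex.cpow_mul_nat]
  push_cast
  rw [neg_mul]
  field_simp

theorem integral_norm_mittagLefflerRay_term (hα : 0 < α) (ω : ℂ) (hs : 0 < s.re) (k : ℕ) :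
    ∫ t in Ioi (0 : ℝ), ‖Complex.exp (-(s * t)) *
      (((α * k / Real.Gamma (α * k + 1) : ℝ) : ℂ) * ω ^ k * ((t ^ (α * k) : ℝ) : ℂ))‖ =
      α * s.re⁻¹ * (k * (‖ω‖ * s.re ^ (-α)) ^ k) := by
  have hΓ : 0 < Real.Gamma (α * k + 1) := Real.Gamma_pos_of_pos (by positivity)
  have hb : -1 < α * k := by linarith [show 0 ≤ α * k by positivity]
  simp_rw [mul_left_comm (Complex.exp _), norm_mul (_ * ω ^ k)]
  rw [integral_const_mul, integral_norm_cexp_mul_rpow hb hs, norm_mul, norm_pow,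
    Complex.norm_real, Real.norm_of_nonneg (by positivity), neg_add, Real.rpow_add hs,
    Real.rpow_neg_one, ← neg_mul, Real.rpow_mul hs.le, Real.rpow_natCast, mul_pow]
  field_simp [hΓ.ne']

theorem hasLaplaceAt_mittagLefflerRay (hα : 0 < α) (hs : 0 < s.re) (hω : ‖ω‖ < s.re ^ α) :
    HasLaplaceAt (mittagLefflerRay α ω) s (raySymbol α ω s) := by
  have hsne : s ≠ 0 := fun h => by simp [h] at hs
  have hsα : s ^ (α : ℂ) ≠ 0 := by simp [Complex.cpow_eq_zero_iff, hsne]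
  have hωs : ‖ω‖ < ‖s ^ (α : ℂ)‖ := by
    rw [Complex.norm_cpow_real]
    exact hω.trans_le (Real.rpow_le_rpow hs.le (Complex.re_le_norm s) hα.le)
  have hratio : ‖‖ω‖ * s.re ^ (-α)‖ < 1 := by
    rwa [Real.norm_of_nonneg (by positivity), Real.rpow_neg hs.le, ← div_eq_mul_inv,
      div_lt_one (by positivity)]
  have hratio' : ‖ω * s ^ (-(α : ℂ))‖ < 1 := by
    rwa [norm_mul, Complex.cpow_neg, norm_inv, ← div_eq_mul_inv,
      div_lt_one ((norm_nonneg ω).trans_lt hωs)]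
  convert HasLaplaceAt.tsum (hasLaplaceAt_mittagLefflerRay_term hα ω hs) ?_
    (fun t ht => hasSum_mittagLefflerRay hα ω ht) using 1
  · have hsub : s ^ (α : ℂ) - ω ≠ 0 := fun h => by
      rw [sub_eq_zero.1 h] at hωs
      exact lt_irrefl _ hωs
    have hone_sub : 1 - ω * (s ^ (α : ℂ))⁻¹ = (s ^ (α : ℂ) - ω) / s ^ (α : ℂ) := by field_simp
    rw [tsum_mul_left, tsum_coe_mul_geometric_of_norm_lt_one hratio', Complex.cpow_neg, hone_sub,
      raySymbol, Complex.cpow_sub _ _ hsne, Complex.cpow_one]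
    field_simp
  · simp_rw [integral_norm_mittagLefflerRay_term hα ω hs]
    exact (hasSum_coe_mul_geometric_of_norm_lt_one hratio).summable.mul_left _

end MittagLeffler

section LaplaceInversion

open Set

/-! ### Laplace inversion and shifting the line of integration -/

open FourierTransform in
theorem eq_integral_of_hasLaplaceAt {f : ℝ → ℂ} {c : ℝ} {H : ℂ → ℂ} (hf : Continuous f)
    (hf0 : ∀ t ≤ 0, f t = 0)
    (hL : ∀ y : ℝ, HasLaplaceAt f (c + y * Complex.I) (H (c + y * Complex.I)))
    (hH : Integrable fun y : ℝ => H (c + y * Complex.I)) (t : ℝ) :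
    f t = (2 * Real.pi : ℂ)⁻¹ *
      ∫ y : ℝ, Complex.exp ((c + y * Complex.I) * t) * H (c + y * Complex.I) := by
  set F : ℝ → ℂ := fun t => Complex.exp (-((c : ℂ) * t)) * f t with hF
  have hFc : Continuous F := by fun_prop
  have hsupp : Function.support F ⊆ Ioi 0 := fun τ hτ => by
    by_contra h
    exact hτ (by simp only [hF, hf0 τ (not_lt.1 h), mul_zero])
  have hFint : Integrable F := by
    rw [← integrableOn_iff_integrable_of_support_subset hsupp]
    simpa using (hL 0).1
  have hpi : 2 * Real.pi ≠ 0 := by positivity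
  have hFT : 𝓕 F = fun v : ℝ => H (c + ((2 * Real.pi * v : ℝ) : ℂ) * Complex.I) := by
    funext v
    rw [← (hL _).2, Real.fourier_real_eq_integral_exp_smul,
      ← setIntegral_eq_integral_of_forall_compl_eq_zero (s := Ioi 0) fun τ hτ => by
        rw [Function.notMem_support.1 fun h => hτ (hsupp h), smul_zero]]
    refine setIntegral_congr_fun measurableSet_Ioi fun τ _ => ?_
    simp only [hF, smul_eq_mul]
    rw [← mul_assoc, ← Complex.exp_add]
    congr 2
    push_cast
    ring
  have hFTint : Integrable (𝓕 F) := hFT ▸ hH.comp_mul_left' hpi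
  have hinv := congrFun (hFc.fourierInv_fourier_eq hFint hFTint) t
  rw [hFT, Real.fourierInv_eq'] at hinv
  set g : ℝ → ℂ := fun y => Complex.exp ((c + y * Complex.I) * t) * H (c + y * Complex.I) with hg
  have hintegrand (v : ℝ) : Complex.exp (((2 * Real.pi * inner ℝ v t : ℝ) : ℂ) * Complex.I) •
      H (c + ((2 * Real.pi * v : ℝ) : ℂ) * Complex.I) =
      Complex.exp (-((c : ℂ) * t)) * g (2 * Real.pi * v) := by
    simp only [hg, smul_eq_mul]
    rw [← mul_assoc, ← Complex.exp_add, show (inner ℝ v t : ℝ) = t * v by simp]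
    congr 2
    push_cast
    ring
  simp_rw [hintegrand] at hinv
  rw [integral_const_mul, Measure.integral_comp_mul_left g] at hinv
  rw [← mul_left_cancel₀ (Complex.exp_ne_zero _) hinv, abs_of_pos (by positivity),
    Complex.real_smul]
  push_cast
  rfl

theorem integrable_mul_one_add_abs_rpow_neg (M : ℝ) {r : ℝ} (hr : 1 < r) :
    Integrable fun y : ℝ => M * (1 + |y|) ^ (-r) := by
  simpa using (integrable_one_add_norm (E := ℝ) (μ := volume) (by simpa using hr)).const_mul M

theorem continuous_verticalLine {F : ℂ → ℂ} {S : Set ℝ} (hF : ContinuousOn F (Complex.re ⁻¹' S))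
    {x : ℝ} (hx : x ∈ S) : Continuous fun y : ℝ => F (x + y * Complex.I) :=
  hF.comp_continuous (by fun_prop) fun y => by simpa using hx

theorem integrable_verticalLine {F : ℂ → ℂ} {S : Set ℝ} (hF : ContinuousOn F (Complex.re ⁻¹' S))
    {x : ℝ} (hx : x ∈ S) {M r : ℝ} (hr : 1 < r)
    (hb : ∀ s : ℂ, s.re ∈ S → ‖F s‖ ≤ M * (1 + |s.im|) ^ (-r)) :
    Integrable fun y : ℝ => F (x + y * Complex.I) :=
  (integrable_mul_one_add_abs_rpow_neg M hr).mono'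
    (continuous_verticalLine hF hx).aestronglyMeasurable
    (ae_of_all _ fun y => by simpa using hb (x + y * Complex.I) (by simpa using hx))

theorem tendsto_integral_horizontalSegment {F : ℂ → ℂ} {a c : ℝ} (hac : a ≤ c) {M r : ℝ}
    (hr : 0 < r) (hb : ∀ s : ℂ, s.re ∈ Icc a c → ‖F s‖ ≤ M * (1 + |s.im|) ^ (-r))
    {l : Filter ℝ} {h : ℝ → ℝ} (hh : Tendsto (fun T => |h T|) l atTop) :
    Tendsto (fun T : ℝ => ∫ x in a..c, F (x + h T * Complex.I)) l (𝓝 0) := by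
  have hdecay : Tendsto (fun T : ℝ => M * (1 + |h T|) ^ (-r) * |c - a|) l (𝓝 0) := by
    have := (tendsto_rpow_neg_atTop hr).comp (tendsto_atTop_add_const_left l 1 hh)
    simpa using (this.const_mul M).mul_const |c - a|
  refine squeeze_zero_norm (fun T => ?_) hdecay
  refine intervalIntegral.norm_integral_le_of_norm_le_const fun x hx => ?_
  rw [uIoc_of_le hac] at hx
  simpa using hb (x + h T * Complex.I) (by simpa using Ioc_subset_Icc_self hx)

theorem integral_verticalLine_eq {F : ℂ → ℂ} {a c : ℝ} (hac : a ≤ c)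
    (hF : DifferentiableOn ℂ F (Complex.re ⁻¹' Icc a c)) {M r : ℝ} (hr : 1 < r)
    (hb : ∀ s : ℂ, s.re ∈ Icc a c → ‖F s‖ ≤ M * (1 + |s.im|) ^ (-r)) :
    ∫ y : ℝ, F (c + y * Complex.I) = ∫ y : ℝ, F (a + y * Complex.I) := by
  have hvert (x : ℝ) (hx : x ∈ Icc a c) :
      Tendsto (fun T : ℝ => ∫ y in (-T)..T, F (x + y * Complex.I)) atTop
        (𝓝 (∫ y : ℝ, F (x + y * Complex.I))) :=
    intervalIntegral_tendsto_integral (integrable_verticalLine hF.continuousOn hx hr hb)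
      tendsto_neg_atTop_atBot tendsto_id
  have hbot := tendsto_integral_horizontalSegment hac (zero_lt_one.trans hr) hb
    (h := fun T => -T) (by simpa only [abs_neg] using tendsto_abs_atTop_atTop)
  have htop := tendsto_integral_horizontalSegment hac (zero_lt_one.trans hr) hb
    (h := fun T => T) tendsto_abs_atTop_atTop
  have hrect (T : ℝ) : (∫ x in a..c, F (x + ((-T : ℝ) : ℂ) * Complex.I)) -
      (∫ x in a..c, F (x + T * Complex.I)) +
      Complex.I * (∫ y in (-T)..T, F (c + y * Complex.I)) -
      Complex.I * (∫ y in (-T)..T, F (a + y * Complex.I)) = 0 := by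
    have := Complex.integral_boundary_rect_eq_zero_of_differentiableOn F
      (a + ((-T : ℝ) : ℂ) * Complex.I) (c + (T : ℂ) * Complex.I) (hF.mono fun s hs => ?_)
    · simpa using this
    · simpa [uIcc_of_le hac] using (Complex.mem_reProdIm.1 hs).1
  have hlim := ((hbot.sub htop).add ((hvert c ⟨hac, le_rfl⟩).const_mul Complex.I)).sub
    ((hvert a ⟨le_rfl, hac⟩).const_mul Complex.I)
  simp_rw [hrect] at hlim
  have heq := tendsto_nhds_unique hlim tendsto_const_nhds
  rw [sub_zero, zero_add, ← mul_sub] at heq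
  exact sub_eq_zero.1 ((mul_eq_zero.1 heq).resolve_left Complex.I_ne_zero)

theorem norm_cexp_mul_ofReal (z : ℂ) (t : ℝ) : ‖Complex.exp (z * t)‖ = Real.exp (z.re * t) := by
  rw [Complex.norm_exp, Complex.re_mul_ofReal]

theorem exists_norm_le_of_hasLaplaceAt {f : ℝ → ℂ} {a c : ℝ} {H : ℂ → ℂ} (hf : Continuous f)
    (hf0 : ∀ t ≤ 0, f t = 0) (hac : a ≤ c)
    (hL : ∀ s : ℂ, s.re = c → HasLaplaceAt f s (H s))
    (hH : DifferentiableOn ℂ H (Complex.re ⁻¹' Icc a c)) {M r : ℝ} (hr : 1 < r)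
    (hb : ∀ s : ℂ, s.re ∈ Icc a c → ‖H s‖ ≤ M * (1 + |s.im|) ^ (-r)) :
    ∃ K : ℝ, ∀ t : ℝ, 0 ≤ t → ‖f t‖ ≤ K * Real.exp (a * t) := by
  refine ⟨‖(2 * Real.pi : ℂ)⁻¹‖ * ∫ y : ℝ, M * (1 + |y|) ^ (-r), fun t ht => ?_⟩
  have hshift := integral_verticalLine_eq (F := fun s => Complex.exp (s * t) * H s)
    (M := Real.exp (c * t) * M) hac (DifferentiableOn.mul (by fun_prop) hH) hr fun s hs => by
      rw [norm_mul, norm_cexp_mul_ofReal, mul_assoc]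
      have hs' := hs.2
      gcongr
      exact hb s hs
  rw [eq_integral_of_hasLaplaceAt hf hf0 (fun y => hL _ (by simp))
    (integrable_verticalLine hH.continuousOn ⟨hac, le_rfl⟩ hr hb) t, hshift, norm_mul, mul_assoc,
    ← integral_mul_const]
  gcongr
  refine norm_integral_le_of_norm_le ((integrable_mul_one_add_abs_rpow_neg M hr).mul_const _)
    (ae_of_all _ fun y => ?_)
  rw [norm_mul, norm_cexp_mul_ofReal, mul_comm]
  have := hb (a + y * Complex.I) (by simpa using hac)
  simp only [Complex.add_re, Complex.add_im, Complex.ofReal_re, Complex.ofReal_im,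
    Complex.re_ofReal_mul, Complex.im_ofReal_mul, Complex.I_re, Complex.I_im, mul_zero, mul_one,
    add_zero, zero_add] at this ⊢
  gcongr

end LaplaceInversion

section RaySymbol

open Set Bornology

theorem cpow_injOn_rightHalfPlane {α : ℝ} (hα : 0 < α) (hα1 : α ≤ 1) :
    InjOn (fun s : ℂ => s ^ (α : ℂ)) {s | 0 < s.re} := by
  intro s hs w hw h
  have hne (z : ℂ) (hz : 0 < z.re) : z ≠ 0 := fun h => by simp [h] at hz
  have him (z : ℂ) (hz : 0 < z.re) : -Real.pi < (Complex.log z * α).im ∧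
      (Complex.log z * α).im ≤ Real.pi := by
    have harg := abs_lt.1 (Complex.abs_arg_lt_pi_div_two_iff.2 (Or.inl hz))
    rw [Complex.im_mul_ofReal, Complex.log_im]
    constructor <;> nlinarith [Real.pi_pos]
  simp only [Complex.cpow_def_of_ne_zero (hne s hs), Complex.cpow_def_of_ne_zero (hne w hw)] at h
  have hlog := mul_right_cancel₀ (by exact_mod_cast hα.ne') <|
    Complex.exp_inj_of_neg_pi_lt_of_le_pi (him s hs).1 (him s hs).2 (him w hw).1 (him w hw).2 h
  rw [← Complex.exp_log (hne s hs), hlog, Complex.exp_log (hne w hw)]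

theorem div_sub_sq_eq_add_dslope (f : ℂ → ℂ) {s₀ s : ℂ} (hs : s ≠ s₀) :
    f s / (s - s₀) ^ 2 = f s₀ / (s - s₀) ^ 2 + deriv f s₀ / (s - s₀) +
      dslope (dslope f s₀) s₀ s := by
  have := sub_ne_zero.2 hs
  rw [dslope_of_ne _ hs, slope_def_field, dslope_of_ne _ hs, slope_def_field, dslope_same]
  field_simp
  ring

/-- The product of `raySymbol α (s₀ ^ α)` with `(s - s₀) ^ 2`, extended analytically to `s₀`. -/
noncomputable def rayQuotient (α : ℝ) (s₀ s : ℂ) : ℂ :=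
  α * s₀ ^ (α : ℂ) * s ^ ((α : ℂ) - 1) / dslope (fun s => s ^ (α : ℂ)) s₀ s ^ 2

/-- The part of `raySymbol α (s₀ ^ α)` left after subtracting its poles in the right half plane.
The simple pole at `s₀` is compensated by one at `-1`, so that the difference decays quadratically
at infinity. -/
noncomputable def rayRemainder (α : ℝ) (s₀ s : ℂ) : ℂ :=
  dslope (dslope (rayQuotient α s₀) s₀) s₀ s + deriv (rayQuotient α s₀) s₀ / (s + 1)

variable {α : ℝ} {s₀ s : ℂ}

theorem rightHalfPlane_mem_nhds (hs₀ : 0 < s₀.re) : {s : ℂ | 0 < s.re} ∈ 𝓝 s₀ :=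
  isOpen_rightHalfPlane.mem_nhds hs₀

theorem differentiableOn_cpow_rightHalfPlane (a : ℂ) :
    DifferentiableOn ℂ (fun s : ℂ => s ^ a) {s | 0 < s.re} := fun _ hs =>
  (differentiableAt_id.cpow_const (Or.inl hs)).differentiableWithinAt

theorem dslope_cpow_self (hs₀ : 0 < s₀.re) :
    dslope (fun s => s ^ (α : ℂ)) s₀ s₀ = α * s₀ ^ ((α : ℂ) - 1) := by
  rw [dslope_same]
  simpa using ((hasDerivAt_id s₀).cpow_const (c := (α : ℂ)) (Or.inl hs₀)).deriv

theorem dslope_cpow_ne_zero (hα : 0 < α) (hα1 : α ≤ 1) (hs₀ : 0 < s₀.re) (hs : 0 < s.re) :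
    dslope (fun s => s ^ (α : ℂ)) s₀ s ≠ 0 := by
  rcases eq_or_ne s s₀ with rfl | h
  · rw [dslope_cpow_self hs₀]
    have hs0 : s ≠ 0 := fun h => by simp [h] at hs
    exact mul_ne_zero (by exact_mod_cast hα.ne') (by simp [Complex.cpow_eq_zero_iff, hs0])
  · rw [dslope_of_ne _ h, slope_def_field]
    exact div_ne_zero
      (sub_ne_zero.2 fun h' => h (cpow_injOn_rightHalfPlane hα hα1 hs hs₀ h')) (sub_ne_zero.2 h)

theorem differentiableOn_rayQuotient (hα : 0 < α) (hα1 : α ≤ 1) (hs₀ : 0 < s₀.re) :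
    DifferentiableOn ℂ (rayQuotient α s₀) {s | 0 < s.re} :=
  ((differentiableOn_cpow_rightHalfPlane _).const_mul _).div
    (((Complex.differentiableOn_dslope (rightHalfPlane_mem_nhds hs₀)).2
      (differentiableOn_cpow_rightHalfPlane _)).pow 2)
    fun _ hs => pow_ne_zero 2 (dslope_cpow_ne_zero hα hα1 hs₀ hs)

theorem rayQuotient_self (hα : 0 < α) (hs₀ : 0 < s₀.re) : rayQuotient α s₀ s₀ = s₀ / α := by
  have hα' : (α : ℂ) ≠ 0 := by exact_mod_cast hα.ne'
  have hs₀' : s₀ ≠ 0 := fun h => by simp [h] at hs₀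
  have hpow : s₀ ^ ((α : ℂ) - 1) ≠ 0 := by simp [Complex.cpow_eq_zero_iff, hs₀']
  have hmul : s₀ ^ (α : ℂ) = s₀ ^ ((α : ℂ) - 1) * s₀ := by
    rw [Complex.cpow_sub _ _ hs₀', Complex.cpow_one, div_mul_cancel₀ _ hs₀']
  rw [rayQuotient, dslope_cpow_self hs₀, hmul]
  field_simp

theorem rayQuotient_div_sub_sq (hs : s ≠ s₀) :
    rayQuotient α s₀ s / (s - s₀) ^ 2 = raySymbol α (s₀ ^ (α : ℂ)) s := by
  have := sub_ne_zero.2 hs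
  rw [rayQuotient, raySymbol, dslope_of_ne _ hs, slope_def_field]
  field_simp

theorem differentiableOn_rayRemainder (hα : 0 < α) (hα1 : α ≤ 1) (hs₀ : 0 < s₀.re) :
    DifferentiableOn ℂ (rayRemainder α s₀) {s | 0 < s.re} := by
  have hmem := rightHalfPlane_mem_nhds hs₀
  refine ((Complex.differentiableOn_dslope hmem).2 ((Complex.differentiableOn_dslope hmem).2
    (differentiableOn_rayQuotient hα hα1 hs₀))).add
    (DifferentiableOn.div (by fun_prop) (by fun_prop) fun s hs h => ?_)
  have hre := congrArg Complex.re h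
  simp only [Complex.add_re, Complex.one_re, Complex.zero_re] at hre
  linarith [show 0 < s.re from hs]

theorem rayRemainder_eq (hα : 0 < α) (hs₀ : 0 < s₀.re) (hs : s ≠ s₀) :
    rayRemainder α s₀ s = raySymbol α (s₀ ^ (α : ℂ)) s - s₀ / α * ((s - s₀) ^ 2)⁻¹ -
      deriv (rayQuotient α s₀) s₀ * ((s - s₀)⁻¹ - (s + 1)⁻¹) := by
  rw [← rayQuotient_div_sub_sq hs, div_sub_sq_eq_add_dslope _ hs, rayQuotient_self hα hs₀,
    rayRemainder]
  ring

theorem isBigO_inv_sub_cobounded (z : ℂ) :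
    (fun s : ℂ => (s - z)⁻¹) =O[cobounded ℂ] fun s => s⁻¹ := by
  have hequiv : (fun s : ℂ => s - z) ~[cobounded ℂ] fun s => s :=
    IsEquivalent.refl.sub_isLittleO (isLittleO_const_id_cobounded z)
  exact hequiv.inv.isBigO

theorem isBigO_inv_sub_mul_inv_sub_cobounded (hα1 : α ≤ 1) (z w : ℂ) :
    (fun s : ℂ => (s - z)⁻¹ * (s - w)⁻¹) =O[cobounded ℂ] fun s => ‖s‖ ^ (-(1 + α)) := by
  refine ((isBigO_inv_sub_cobounded z).mul (isBigO_inv_sub_cobounded w)).trans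
    (IsBigO.of_bound 1 ?_)
  filter_upwards [tendsto_norm_cobounded_atTop.eventually_ge_atTop 1] with s hs
  have hs0 : 0 < ‖s‖ := one_pos.trans_le hs
  rw [norm_mul, norm_inv, one_mul, Real.norm_of_nonneg (by positivity), ← Real.rpow_neg_one,
    ← Real.rpow_add hs0]
  exact Real.rpow_le_rpow_of_exponent_le hs (by linarith)

theorem isBigO_raySymbol_cobounded (hα : 0 < α) (ω : ℂ) :
    raySymbol α ω =O[cobounded ℂ] fun s => ‖s‖ ^ (-(1 + α)) := by
  have hlittle : (fun _ : ℂ => ω) =o[cobounded ℂ] fun s : ℂ => s ^ (α : ℂ) := by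
    refine isLittleO_const_left.2 (Or.inr ?_)
    simpa only [Function.comp_def, Complex.norm_cpow_real] using
      (tendsto_rpow_atTop hα).comp tendsto_norm_cobounded_atTop
  have hequiv : (fun s : ℂ => s ^ (α : ℂ) - ω) ~[cobounded ℂ] fun s => s ^ (α : ℂ) :=
    IsEquivalent.refl.sub_isLittleO hlittle
  refine ((isBigO_refl (fun s : ℂ => α * ω * s ^ ((α : ℂ) - 1)) _).mul
    (hequiv.inv.isBigO.pow 2)).congr_left (fun s => by simp [raySymbol, div_eq_mul_inv])
    |>.trans (IsBigO.of_bound ‖α * ω‖ ?_)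
  filter_upwards [tendsto_norm_cobounded_atTop.eventually_gt_atTop 0] with s hs
  have hpow : ‖s ^ ((α : ℂ) - 1)‖ = ‖s‖ ^ (α - 1) := by
    rw [← Complex.norm_cpow_real]
    push_cast
    rfl
  rw [norm_mul, norm_mul, hpow, norm_pow, Pi.inv_apply, norm_inv, Complex.norm_cpow_real,
    Real.norm_of_nonneg (by positivity : 0 ≤ ‖s‖ ^ (-(1 + α))), ← Real.rpow_neg hs.le,
    ← Real.rpow_natCast, ← Real.rpow_mul hs.le, mul_assoc, ← Real.rpow_add hs]
  refine le_of_eq ?_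
  congr 2
  push_cast
  ring

theorem isBigO_rayRemainder_cobounded (hα : 0 < α) (hα1 : α ≤ 1) (hs₀ : 0 < s₀.re) :
    rayRemainder α s₀ =O[cobounded ℂ] fun s => ‖s‖ ^ (-(1 + α)) := by
  have hne (z : ℂ) : ∀ᶠ s in cobounded ℂ, s ≠ z :=
    (tendsto_norm_cobounded_atTop.eventually_gt_atTop ‖z‖).mono fun s hs h => by simp [h] at hs
  have hdouble := (isBigO_inv_sub_mul_inv_sub_cobounded hα1 s₀ s₀).const_mul_left (s₀ / α)
  have hsimple := (isBigO_inv_sub_mul_inv_sub_cobounded hα1 s₀ (-1)).const_mul_left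
    (deriv (rayQuotient α s₀) s₀ * (1 + s₀))
  refine (((isBigO_raySymbol_cobounded hα (s₀ ^ (α : ℂ))).sub hdouble).sub hsimple).congr' ?_ .rfl
  filter_upwards [hne s₀, hne (-1)] with s hs hs1
  have hs' := sub_ne_zero.2 hs
  have hs1' := sub_ne_zero.2 hs1
  rw [rayRemainder_eq hα hs₀ hs]
  rw [sub_neg_eq_add] at hs1' ⊢
  field_simp
  ring

theorem exists_forall_norm_le_mul_of_isBigO_cobounded {F : ℂ → ℂ} {g : ℂ → ℝ} {S : Set ℂ}
    (hS : IsClosed S) (hF : ContinuousOn F S) (hg : Continuous g) (hg0 : ∀ s, 0 < g s)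
    (h : F =O[cobounded ℂ] g) : ∃ M : ℝ, ∀ s ∈ S, ‖F s‖ ≤ M * g s := by
  obtain ⟨C, hC⟩ := h.bound
  obtain ⟨R, -, hR⟩ := (hasBasis_cobounded_norm (E := ℂ)).eventually_iff.1 hC
  obtain ⟨K, hK⟩ := ((isCompact_closedBall (0 : ℂ) R).inter_right hS).exists_bound_of_continuousOn
    ((hF.mono inter_subset_right).norm.div hg.continuousOn fun s _ => (hg0 s).ne')
  refine ⟨max C K, fun s hs => ?_⟩
  rcases le_total R ‖s‖ with hle | hle
  · refine (hR hle).trans ?_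
    rw [Real.norm_of_nonneg (hg0 s).le]
    exact mul_le_mul_of_nonneg_right (le_max_left _ _) (hg0 s).le
  · have := hK s ⟨mem_closedBall_zero_iff.2 hle, hs⟩
    rw [Pi.div_apply, norm_div, norm_norm, Real.norm_of_nonneg (hg0 s).le,
      div_le_iff₀ (hg0 s)] at this
    exact this.trans (mul_le_mul_of_nonneg_right (le_max_right _ _) (hg0 s).le)

theorem isBigO_norm_rpow_neg_one_add_abs_im {r : ℝ} (hr : 0 ≤ r) :
    (fun s : ℂ => ‖s‖ ^ (-r)) =O[cobounded ℂ] fun s => (1 + |s.im|) ^ (-r) := by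
  refine IsBigO.of_bound (2 ^ r) ?_
  filter_upwards [tendsto_norm_cobounded_atTop.eventually_ge_atTop 1] with s hs
  have hs0 : 0 < ‖s‖ := one_pos.trans_le hs
  rw [Real.norm_of_nonneg (by positivity), Real.norm_of_nonneg (by positivity),
    Real.rpow_neg (by positivity), Real.rpow_neg (by positivity), ← div_eq_mul_inv,
    le_div_iff₀ (by positivity), ← div_eq_inv_mul, div_le_iff₀ (by positivity),
    ← Real.mul_rpow zero_le_two hs0.le]
  have := Complex.abs_im_le_norm s
  gcongr
  linarith

theorem exists_norm_rayRemainder_le (hα : 0 < α) (hα1 : α ≤ 1) (hs₀ : 0 < s₀.re) {a : ℝ}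
    (ha : 0 < a) (c : ℝ) : ∃ M : ℝ, ∀ s : ℂ, s.re ∈ Icc a c →
      ‖rayRemainder α s₀ s‖ ≤ M * (1 + |s.im|) ^ (-(1 + α)) :=
  exists_forall_norm_le_mul_of_isBigO_cobounded (S := Complex.re ⁻¹' Icc a c)
    (isClosed_Icc.preimage Complex.continuous_re)
    ((differentiableOn_rayRemainder hα hα1 hs₀).continuousOn.mono fun _ hs => ha.trans_le hs.1)
    ((continuous_const.add Complex.continuous_im.abs).rpow_const
      fun s => Or.inl (by positivity : 1 + |s.im| ≠ 0))
    (fun _ => by positivity)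
    ((isBigO_rayRemainder_cobounded hα hα1 hs₀).trans
      (isBigO_norm_rpow_neg_one_add_abs_im (by linarith)))

end RaySymbol

section MittagLefflerAsymptotics

open Set

variable {α : ℝ} {s₀ s : ℂ}

theorem mittagLefflerRay_zero (hα : 0 < α) (ω : ℂ) : mittagLefflerRay α ω 0 = 0 := by
  simp [mittagLefflerRay, Real.zero_rpow hα.ne']

theorem hasLaplaceAt_mittagLefflerRay_sub_poles (hα : 0 < α) (hs₀ : 0 < s₀.re)
    (hs : ‖s₀‖ < s.re) :
    HasLaplaceAt (fun t => mittagLefflerRay α (s₀ ^ (α : ℂ)) t -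
      s₀ / α * (t * Complex.exp (s₀ * t)) -
      deriv (rayQuotient α s₀) s₀ * (Complex.exp (s₀ * t) - Complex.exp (-1 * t)))
      s (rayRemainder α s₀ s) := by
  have hs₀s : s₀.re < s.re := (Complex.re_le_norm s₀).trans_lt hs
  have hss₀ : s ≠ s₀ := fun h => hs₀s.ne' (congrArg Complex.re h)
  have hneg : (-1 : ℂ).re < s.re := by
    rw [Complex.neg_re, Complex.one_re]
    linarith
  have hω : ‖s₀ ^ (α : ℂ)‖ < s.re ^ α := by
    rw [Complex.norm_cpow_real]
    exact Real.rpow_lt_rpow (norm_nonneg _) hs hα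
  have h := ((hasLaplaceAt_mittagLefflerRay hα (hs₀.trans hs₀s) hω).sub
    ((hasLaplaceAt_mul_cexp hs₀s).const_mul (s₀ / α))).sub
    (((hasLaplaceAt_cexp hs₀s).sub (hasLaplaceAt_cexp hneg)).const_mul
      (deriv (rayQuotient α s₀) s₀))
  rwa [sub_neg_eq_add, ← rayRemainder_eq hα hs₀ hss₀] at h

theorem exists_norm_mittagLefflerRay_sub_poles_le (hα : 0 < α) (hα1 : α ≤ 1) (hs₀ : 0 < s₀.re) :
    ∃ K : ℝ, ∀ t : ℝ, 0 ≤ t → ‖mittagLefflerRay α (s₀ ^ (α : ℂ)) t -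
      s₀ / α * (t * Complex.exp (s₀ * t)) -
      deriv (rayQuotient α s₀) s₀ * (Complex.exp (s₀ * t) - Complex.exp (-1 * t))‖ ≤
      K * Real.exp (s₀.re / 2 * t) := by
  set G : ℝ → ℂ := fun t => mittagLefflerRay α (s₀ ^ (α : ℂ)) t -
    s₀ / α * (t * Complex.exp (s₀ * t)) -
    deriv (rayQuotient α s₀) s₀ * (Complex.exp (s₀ * t) - Complex.exp (-1 * t)) with hG
  have hGcont : Continuous G := by
    have := continuous_mittagLefflerRay hα (s₀ ^ (α : ℂ))
    fun_prop
  have hG0 : G 0 = 0 := by simp [hG, mittagLefflerRay_zero hα]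
  have hac : s₀.re / 2 ≤ ‖s₀‖ + 1 := by linarith [Complex.re_le_norm s₀]
  obtain ⟨M, hM⟩ := exists_norm_rayRemainder_le hα hα1 hs₀ (half_pos hs₀) (‖s₀‖ + 1)
  obtain ⟨K, hK⟩ := exists_norm_le_of_hasLaplaceAt (f := fun t => G (max t 0))
    (hGcont.comp (by fun_prop)) (fun t ht => by rw [max_eq_right ht, hG0]) hac
    (fun s hs => (hasLaplaceAt_mittagLefflerRay_sub_poles hα hs₀ (by linarith)).congr_fun
      fun t ht => by rw [max_eq_left (le_of_lt (mem_Ioi.1 ht))])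
    ((differentiableOn_rayRemainder hα hα1 hs₀).mono fun _ hs => (half_pos hs₀).trans_le hs.1)
    (by linarith) hM
  exact ⟨K, fun t ht => by simpa only [max_eq_left ht] using hK t ht⟩

theorem exists_norm_mittagLefflerRay_sub_le (hα : 0 < α) (hα1 : α ≤ 1) (hs₀ : 0 < s₀.re) :
    ∃ C : ℝ, 0 < C ∧ ∀ t : ℝ, 0 ≤ t → ‖mittagLefflerRay α (s₀ ^ (α : ℂ)) t -
      s₀ / α * (t * Complex.exp (s₀ * t))‖ ≤ C * Real.exp (s₀.re * t) := by
  obtain ⟨K, hK⟩ := exists_norm_mittagLefflerRay_sub_poles_le hα hα1 hs₀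
  set B := deriv (rayQuotient α s₀) s₀
  refine ⟨|K| + ‖B‖ * 2 + 1, by positivity, fun t ht => ?_⟩
  have hmono {x : ℝ} (hx : x ≤ s₀.re) : Real.exp (x * t) ≤ Real.exp (s₀.re * t) := by gcongr
  have hpoles : ‖B * (Complex.exp (s₀ * t) - Complex.exp (-1 * t))‖ ≤
      ‖B‖ * 2 * Real.exp (s₀.re * t) := by
    rw [norm_mul, mul_assoc, two_mul]
    gcongr
    refine (norm_sub_le _ _).trans (add_le_add (norm_cexp_mul_ofReal _ _).le ?_)
    rw [norm_cexp_mul_ofReal]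
    exact hmono (by rw [Complex.neg_re, Complex.one_re]; linarith)
  have hrest : K * Real.exp (s₀.re / 2 * t) ≤ |K| * Real.exp (s₀.re * t) :=
    mul_le_mul (le_abs_self K) (hmono (half_le_self hs₀.le)) (Real.exp_pos _).le (abs_nonneg _)
  have := (norm_le_norm_sub_add _ _).trans (add_le_add (hK t ht) hpoles)
  linarith [Real.exp_pos (s₀.re * t)]

theorem norm_div_mul_mul_cexp (hα : 0 < α) (s₀ : ℂ) {t : ℝ} (ht : 0 ≤ t) :
    ‖s₀ / α * (t * Complex.exp (s₀ * t))‖ = ‖s₀‖ / α * (t * Real.exp (s₀.re * t)) := by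
  rw [norm_mul, norm_mul, norm_div, norm_cexp_mul_ofReal, Complex.norm_real, Complex.norm_real,
    Real.norm_of_nonneg hα.le, Real.norm_of_nonneg ht]

theorem exists_norm_mittagLefflerRay_le_of_one_le (hα : 0 < α) (hα1 : α ≤ 1) (hs₀ : 0 < s₀.re) :
    ∃ C : ℝ, 0 < C ∧ ∀ t : ℝ, 1 ≤ t →
      ‖mittagLefflerRay α (s₀ ^ (α : ℂ)) t‖ ≤ C * t * Real.exp (s₀.re * t) := by
  obtain ⟨C, hC, h⟩ := exists_norm_mittagLefflerRay_sub_le hα hα1 hs₀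
  refine ⟨C + ‖s₀‖ / α, by positivity, fun t ht => ?_⟩
  have ht0 : 0 ≤ t := zero_le_one.trans ht
  have hCt : C * Real.exp (s₀.re * t) ≤ C * t * Real.exp (s₀.re * t) := by
    gcongr
    exact le_mul_of_one_le_right hC.le ht
  have := (norm_le_norm_sub_add _ _).trans
    (add_le_add (h t ht0) (norm_div_mul_mul_cexp hα s₀ ht0).le)
  linarith

theorem exists_norm_mittagLefflerRay_le_rpow (hα : 0 < α) (ω : ℂ) :
    ∃ C : ℝ, 0 < C ∧ ∀ t ∈ Icc (0 : ℝ) 1, ‖mittagLefflerRay α ω t‖ ≤ C * t ^ α := by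
  have hcont : Continuous fun t : ℝ => α * ω * deriv (mittagLeffler α) (ω * (t ^ α : ℝ)) :=
    continuous_const.mul ((differentiable_mittagLeffler hα).deriv.continuous.comp
      (continuous_const.mul (Complex.continuous_ofReal.comp (Real.continuous_rpow_const hα.le))))
  obtain ⟨C, hC⟩ := isCompact_Icc.exists_bound_of_continuousOn (s := Icc (0 : ℝ) 1)
    hcont.continuousOn
  refine ⟨|C| + 1, by positivity, fun t ht => ?_⟩
  have htα : 0 ≤ t ^ α := Real.rpow_nonneg ht.1 α
  have hray : mittagLefflerRay α ω t =
      α * ω * deriv (mittagLeffler α) (ω * (t ^ α : ℝ)) * (t ^ α : ℝ) := by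
    rw [mittagLefflerRay]
    ring
  rw [hray, norm_mul, Complex.norm_real, Real.norm_of_nonneg htα]
  gcongr
  linarith [hC t ht, le_abs_self C]

theorem exists_norm_mittagLefflerRay_le (hα : 0 < α) (hα1 : α ≤ 1) (hs₀ : 0 < s₀.re) :
    ∃ C : ℝ, 0 < C ∧ ∀ t : ℝ, 0 ≤ t → ‖mittagLefflerRay α (s₀ ^ (α : ℂ)) t‖ ≤
      C * (t ^ α + t) * Real.exp (s₀.re * t) := by
  obtain ⟨C₁, hC₁, hsmall⟩ := exists_norm_mittagLefflerRay_le_rpow hα (s₀ ^ (α : ℂ))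
  obtain ⟨C₂, hC₂, hlarge⟩ := exists_norm_mittagLefflerRay_le_of_one_le hα hα1 hs₀
  refine ⟨C₁ + C₂, by positivity, fun t ht => ?_⟩
  have htα : 0 ≤ t ^ α := Real.rpow_nonneg ht α
  rcases le_total t 1 with h1 | h1
  · calc _ ≤ C₁ * t ^ α := hsmall t ⟨ht, h1⟩
      _ ≤ (C₁ + C₂) * (t ^ α + t) := by gcongr <;> linarith
      _ ≤ _ := le_mul_of_one_le_right (by positivity) (Real.one_le_exp (by positivity))
  · refine (hlarge t h1).trans ?_
    gcongr <;> linarith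

theorem exists_le_norm_mittagLefflerRay (hα : 0 < α) (hα1 : α ≤ 1) (hs₀ : 0 < s₀.re) :
    ∃ c T : ℝ, 0 < c ∧ 0 < T ∧ ∀ t : ℝ, T ≤ t →
      c * t * Real.exp (s₀.re * t) ≤ ‖mittagLefflerRay α (s₀ ^ (α : ℂ)) t‖ := by
  obtain ⟨C, hC, h⟩ := exists_norm_mittagLefflerRay_sub_le hα hα1 hs₀
  have hc : 0 < ‖s₀‖ / α / 2 :=
    half_pos (div_pos (hs₀.trans_le (Complex.re_le_norm s₀)) hα)
  refine ⟨‖s₀‖ / α / 2, C / (‖s₀‖ / α / 2), hc, by positivity, fun t ht => ?_⟩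
  have ht0 : 0 ≤ t := le_trans (by positivity) ht
  have hCt : C * Real.exp (s₀.re * t) ≤ ‖s₀‖ / α / 2 * t * Real.exp (s₀.re * t) := by
    gcongr
    rwa [div_le_iff₀' hc] at ht
  have hlead := norm_le_norm_add_norm_sub (mittagLefflerRay α (s₀ ^ (α : ℂ)) t)
    (s₀ / α * (t * Complex.exp (s₀ * t)))
  rw [norm_div_mul_mul_cexp hα s₀ ht0] at hlead
  linarith [h t ht0]

theorem continuous_mittagLeffler_ray (hα : 0 < α) (ω : ℂ) :
    Continuous fun t : ℝ => mittagLeffler α (ω * (t ^ α : ℝ)) :=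
  (differentiable_mittagLeffler hα).continuous.comp
    (continuous_const.mul (Complex.continuous_ofReal.comp (Real.continuous_rpow_const hα.le)))

theorem exists_norm_mittagLeffler_ray_le (hα : 0 < α) (hα1 : α ≤ 1) (hs₀ : 0 < s₀.re) :
    ∃ C : ℝ, 0 < C ∧ ∀ t : ℝ, 0 ≤ t →
      ‖mittagLeffler α (s₀ ^ (α : ℂ) * (t ^ α : ℝ))‖ ≤ C * Real.exp (s₀.re * t) := by
  set y : ℝ → ℂ := fun t => mittagLeffler α (s₀ ^ (α : ℂ) * (t ^ α : ℝ))
  have hy : Continuous y := continuous_mittagLeffler_ray hα _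
  obtain ⟨C₁, hC₁, hray⟩ := exists_norm_mittagLefflerRay_le_of_one_le hα hα1 hs₀
  obtain ⟨C₂, hC₂⟩ := isCompact_Icc.exists_bound_of_continuousOn (s := Icc (0 : ℝ) 1)
    hy.continuousOn
  set K : ℝ := |C₂| + C₁ / s₀.re with hK
  have hKpos : 0 < K := by positivity
  have hsmall (t : ℝ) (ht : t ∈ Icc (0 : ℝ) 1) : ‖y t‖ ≤ K * Real.exp (s₀.re * t) := by
    have hquot : 0 < C₁ / s₀.re := by positivity
    have hKle : ‖y t‖ ≤ K := by linarith [hC₂ t ht, le_abs_self C₂]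
    exact hKle.trans
      (le_mul_of_one_le_right hKpos.le (Real.one_le_exp (mul_nonneg hs₀.le ht.1)))
  refine ⟨K, hKpos, fun t ht => ?_⟩
  rcases le_total t 1 with h1 | h1
  · exact hsmall t ⟨ht, h1⟩
  refine image_norm_le_of_norm_deriv_right_le_deriv_boundary (f := y) (a := 1) (b := t)
    (f' := fun x => mittagLefflerRay α (s₀ ^ (α : ℂ)) x / x) hy.continuousOn
    (fun x hx => (hasDerivAt_mittagLeffler_ray hα _ (by linarith [hx.1])).hasDerivWithinAt)
    (hsmall 1 ⟨zero_le_one, le_rfl⟩)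
    (fun x => (((hasDerivAt_id x).const_mul s₀.re).exp).const_mul K)
    (fun x hx => ?_) ⟨h1, le_rfl⟩
  have hx0 : 0 < x := by linarith [hx.1]
  have hC₁K : C₁ ≤ K * s₀.re := by
    rw [hK, add_mul, div_mul_cancel₀ _ hs₀.ne']
    exact le_add_of_nonneg_left (by positivity)
  rw [norm_div, Complex.norm_real, Real.norm_of_nonneg hx0.le, div_le_iff₀ hx0]
  calc _ ≤ C₁ * x * Real.exp (s₀.re * x) := hray x hx.1
    _ ≤ K * s₀.re * x * Real.exp (s₀.re * x) := by gcongr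
    _ = _ := by
      rw [id, mul_one]
      ring

end MittagLefflerAsymptotics

section EvolvedSymbol

/-! ### The gradient of the evolved Fourier transform -/

variable {E : Type*} [NormedAddCommGroup E] {α t : ℝ} {ω s₀ : ℂ} {G : E → ℂ} {L : NNReal}

/-- The Fourier transform `E_α(ω t^α (2π‖η‖)²) G(η)` of the evolved state, where `G` is that of the
initial state; frequencies are normalized as in `𝓕`, so that `-Δ` has symbol `(2π‖η‖)²`. -/
noncomputable def evolvedSymbol (α : ℝ) (ω : ℂ) (G : E → ℂ) (t : ℝ) (η : E) : ℂ :=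
  mittagLeffler α (ω * ((t ^ α * (2 * Real.pi * ‖η‖) ^ 2 : ℝ) : ℂ)) * G η

/-- The time `τ = (2π‖η‖)^(2/α) t`, for which `τ^α = t^α (2π‖η‖)²`. -/
noncomputable def rescaledTime (α t : ℝ) (η : E) : ℝ :=
  (2 * Real.pi * ‖η‖) ^ (2 / α) * t

theorem rescaledTime_nonneg (ht : 0 ≤ t) (η : E) : 0 ≤ rescaledTime α t η := by
  unfold rescaledTime
  positivity

theorem rescaledTime_rpow (hα : 0 < α) (ht : 0 ≤ t) (η : E) :
    rescaledTime α t η ^ α = t ^ α * (2 * Real.pi * ‖η‖) ^ 2 := by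
  rw [rescaledTime, Real.mul_rpow (by positivity) ht, ← Real.rpow_mul (by positivity),
    div_mul_cancel₀ _ hα.ne', mul_comm, Real.rpow_two]

theorem rescaledTime_le (hα : 0 < α) (ht : 0 ≤ t) {η : E} {R : ℝ} (hη : ‖η‖ ≤ R) :
    rescaledTime α t η ≤ (2 * Real.pi * R) ^ (2 / α) * t := by
  unfold rescaledTime
  gcongr

theorem le_rescaledTime (hα : 0 < α) (ht : 0 ≤ t) {η : E} {ρ : ℝ} (hρ : 0 ≤ ρ)
    (hη : ρ ≤ 2 * Real.pi * ‖η‖) : ρ ^ (2 / α) * t ≤ rescaledTime α t η := by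
  unfold rescaledTime
  gcongr

theorem rescaledTime_le_sub (hα : 0 < α) (hα1 : α ≤ 1) (ht : 0 ≤ t) {η : E} (hη₀ : η ≠ 0) {R : ℝ}
    (hη : ‖η‖ ≤ R) :
    rescaledTime α t η ≤ (2 * Real.pi * R) ^ (2 / α) * t -
      (2 * Real.pi * R) ^ (2 / α - 1) * (2 * Real.pi) * ((R - ‖η‖) * t) := by
  have hη_pos : 0 < ‖η‖ := norm_pos_iff.2 hη₀
  have hR : 0 < R := hη_pos.trans_le hη
  have hα2 : 1 ≤ 2 / α := by rw [le_div_iff₀ hα]; linarith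
  have hpow (r : ℝ) (hr : 0 < r) :
      (2 * Real.pi * r) ^ (2 / α) = (2 * Real.pi * r) ^ (2 / α - 1) * (2 * Real.pi * r) := by
    rw [Real.rpow_sub_one (by positivity), div_mul_cancel₀ _ (by positivity)]
  have hmono : (2 * Real.pi * ‖η‖) ^ (2 / α - 1) ≤ (2 * Real.pi * R) ^ (2 / α - 1) := by
    gcongr
  have hmul := mul_le_mul_of_nonneg_right hmono (show 0 ≤ 2 * Real.pi * ‖η‖ * t by positivity)
  rw [rescaledTime, hpow _ hη_pos, hpow _ hR]
  linarith

theorem inv_norm_mul_rescaledTime_le (hα : 0 < α) (hα1 : α ≤ 1) (ht : 1 ≤ t) {η : E} (hη₀ : η ≠ 0)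
    {R : ℝ} (hη : ‖η‖ ≤ R) :
    ‖η‖⁻¹ * (rescaledTime α t η ^ α + rescaledTime α t η) ≤
      ((2 * Real.pi) ^ 2 * R + 2 * Real.pi * (2 * Real.pi * R) ^ (2 / α - 1)) * t := by
  have hη_pos : 0 < ‖η‖ := norm_pos_iff.2 hη₀
  have hα2 : 1 ≤ 2 / α := by rw [le_div_iff₀ hα]; linarith
  have hpow : rescaledTime α t η =
      (2 * Real.pi * ‖η‖) ^ (2 / α - 1) * (2 * Real.pi * ‖η‖) * t := by
    rw [rescaledTime, Real.rpow_sub_one (by positivity), div_mul_cancel₀ _ (by positivity)]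
  have htα : t ^ α ≤ t := by simpa using Real.rpow_le_rpow_of_exponent_le ht hα1
  have hmono : (2 * Real.pi * ‖η‖) ^ (2 / α - 1) ≤ (2 * Real.pi * R) ^ (2 / α - 1) := by
    gcongr
  have hR : 0 ≤ R := hη_pos.le.trans hη
  calc ‖η‖⁻¹ * (rescaledTime α t η ^ α + rescaledTime α t η) =
        (2 * Real.pi) ^ 2 * ‖η‖ * t ^ α +
          2 * Real.pi * (2 * Real.pi * ‖η‖) ^ (2 / α - 1) * t := by
        rw [rescaledTime_rpow hα (by positivity), hpow]
        field_simp
    _ ≤ (2 * Real.pi) ^ 2 * R * t + 2 * Real.pi * (2 * Real.pi * R) ^ (2 / α - 1) * t := by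
        gcongr
    _ = _ := by ring

theorem hasCompactSupport_evolvedSymbol (hG : HasCompactSupport G) (t : ℝ) :
    HasCompactSupport (evolvedSymbol α ω G t) := hG.mul_left

theorem mul_exp_neg_mul_le_inv {a : ℝ} (ha : 0 < a) (x : ℝ) :
    x * Real.exp (-(a * x)) ≤ a⁻¹ := by
  rw [Real.exp_neg, ← div_eq_mul_inv, div_le_iff₀ (Real.exp_pos _)]
  calc x = a⁻¹ * (a * x) := by field_simp
    _ ≤ a⁻¹ * Real.exp (a * x) := by
      gcongr
      linarith [Real.add_one_le_exp (a * x)]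

theorem sub_norm_mul_exp_rescaledTime_le (hα : 0 < α) (hα1 : α ≤ 1) (ht : 0 ≤ t) {η : E}
    (hη₀ : η ≠ 0) {R : ℝ} (hη : ‖η‖ ≤ R) {κ : ℝ} (hκ : 0 < κ) :
    (R - ‖η‖) * t * Real.exp (κ * rescaledTime α t η) ≤
      (κ * ((2 * Real.pi * R) ^ (2 / α - 1) * (2 * Real.pi)))⁻¹ *
        Real.exp (κ * ((2 * Real.pi * R) ^ (2 / α) * t)) := by
  set δ := (2 * Real.pi * R) ^ (2 / α - 1) * (2 * Real.pi)
  set x := (R - ‖η‖) * t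
  have hR : 0 < R := (norm_pos_iff.2 hη₀).trans_le hη
  have : 0 ≤ x := mul_nonneg (sub_nonneg.2 hη) ht
  have hgap := mul_le_mul_of_nonneg_left (rescaledTime_le_sub hα hα1 ht hη₀ hη) hκ.le
  calc x * Real.exp (κ * rescaledTime α t η)
      ≤ x * Real.exp (-(κ * δ * x) + κ * ((2 * Real.pi * R) ^ (2 / α) * t)) := by
        gcongr
        linarith
    _ = x * Real.exp (-(κ * δ * x)) * Real.exp (κ * ((2 * Real.pi * R) ^ (2 / α) * t)) := by
        rw [Real.exp_add, ← mul_assoc]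
    _ ≤ _ := by
        gcongr
        exact mul_exp_neg_mul_le_inv (by positivity) x

variable [InnerProductSpace ℝ E]

theorem contDiff_evolvedSymbol (hα : 0 < α) (hG : ContDiff ℝ 1 G) (t : ℝ) :
    ContDiff ℝ 1 (evolvedSymbol α ω G t) := by
  have hE : ContDiff ℝ 1 (mittagLeffler α) :=
    ((differentiable_mittagLeffler hα).contDiff (n := 1)).restrict_scalars ℝ
  have hnorm : ContDiff ℝ 1 fun η : E => (t ^ α * (2 * Real.pi * ‖η‖) ^ 2 : ℝ) := by
    simp only [mul_pow]
    exact contDiff_const.mul (contDiff_const.mul (contDiff_norm_sq ℝ))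
  exact (hE.comp (contDiff_const.mul (Complex.ofRealCLM.contDiff.comp hnorm))).mul hG

theorem fderiv_evolvedSymbol (hα : 0 < α) (hG : Differentiable ℝ G) (ht : 0 ≤ t) (η e : E) :
    fderiv ℝ (evolvedSymbol α ω G t) η e =
      ((2 / α * (inner ℝ η e / ‖η‖ ^ 2) : ℝ) : ℂ) *
        mittagLefflerRay α ω (rescaledTime α t η) * G η +
      mittagLeffler α (ω * ((rescaledTime α t η ^ α : ℝ) : ℂ)) * fderiv ℝ G η e := by
  have hnorm : HasFDerivAt (fun η : E => ((t ^ α * (2 * Real.pi * ‖η‖) ^ 2 : ℝ) : ℂ))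
      (Complex.ofRealCLM.comp ((t ^ α * (2 * Real.pi) ^ 2) • (2 • innerSL ℝ η))) η := by
    simp only [mul_pow (2 * Real.pi), ← mul_assoc]
    exact Complex.ofRealCLM.hasFDerivAt.comp η
      ((hasStrictFDerivAt_norm_sq η).hasFDerivAt.const_mul _)
  have hE := ((differentiable_mittagLeffler hα _).hasDerivAt).comp_hasFDerivAt η
    (hnorm.const_mul ω)
  have hU : HasFDerivAt (evolvedSymbol α ω G t) _ η := hE.mul (hG η).hasFDerivAt
  rw [hU.fderiv, mittagLefflerRay, rescaledTime_rpow hα ht]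
  simp only [Function.comp_apply, add_apply, smul_apply, smul_eq_mul,
    ContinuousLinearMap.comp_apply, Complex.ofRealCLM_apply, nsmul_eq_mul, innerSL_apply_apply]
  rcases eq_or_ne η 0 with rfl | hη
  · simp
  · have : (‖η‖ : ℂ) ≠ 0 := by exact_mod_cast norm_ne_zero_iff.2 hη
    have : (α : ℂ) ≠ 0 := by exact_mod_cast hα.ne'
    push_cast
    field_simp
    ring

theorem fderiv_evolvedSymbol_eq_zero {R : ℝ} (hGR : ∀ η, R ≤ ‖η‖ → G η = 0) {η : E}
    (hη : R < ‖η‖) : fderiv ℝ (evolvedSymbol α ω G t) η = 0 := by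
  have h : evolvedSymbol α ω G t =ᶠ[𝓝 η] fun _ => 0 := by
    filter_upwards [continuous_norm.continuousAt.eventually (lt_mem_nhds hη)] with w hw
    rw [evolvedSymbol, hGR w hw.le, mul_zero]
  rw [h.fderiv_eq, fderiv_const_apply]

theorem norm_le_mul_sub_norm_of_lipschitzWith (hL : LipschitzWith L G) {R : ℝ}
    (hGR : ∀ η, R ≤ ‖η‖ → G η = 0) {η : E} (hη : η ≠ 0) (hηR : ‖η‖ ≤ R) :
    ‖G η‖ ≤ L * (R - ‖η‖) := by
  have hη_pos : 0 < ‖η‖ := norm_pos_iff.2 hη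
  have hnorm : ‖(R / ‖η‖) • η‖ = R := by
    rw [norm_smul, Real.norm_of_nonneg (div_nonneg (hη_pos.le.trans hηR) hη_pos.le),
      div_mul_cancel₀ _ hη_pos.ne']
  have hsub : ‖η - (R / ‖η‖) • η‖ = R - ‖η‖ := by
    have hle : 1 ≤ R / ‖η‖ := (one_le_div hη_pos).2 hηR
    rw [show η - (R / ‖η‖) • η = (1 - R / ‖η‖) • η by rw [sub_smul, one_smul], norm_smul,
      Real.norm_of_nonpos (sub_nonpos.2 hle)]
    field_simp
    ring
  simpa only [hGR _ hnorm.ge, sub_zero, hsub] using hL.norm_sub_le η ((R / ‖η‖) • η)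

theorem norm_mul_fderiv_le_of_lipschitzWith (hL : LipschitzWith L G) {e : E} (he : ‖e‖ ≤ 1)
    {z : ℂ} {M : ℝ} (hz : ‖z‖ ≤ M) (η : E) : ‖z * fderiv ℝ G η e‖ ≤ M * L := by
  rw [norm_mul]
  have hG : ‖fderiv ℝ G η e‖ ≤ L := by
    simpa using (fderiv ℝ G η).le_of_opNorm_le_of_le (norm_fderiv_le_of_lipschitz ℝ hL) he
  gcongr
  exact (norm_nonneg z).trans hz

theorem abs_inner_div_norm_sq_le {η e : E} (he : ‖e‖ ≤ 1) :
    |inner ℝ η e / ‖η‖ ^ 2| ≤ ‖η‖⁻¹ := by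
  rcases eq_or_ne η 0 with rfl | hη
  · simp
  have : 0 < ‖η‖ := norm_pos_iff.2 hη
  rw [abs_div, abs_of_nonneg (by positivity : 0 ≤ ‖η‖ ^ 2), div_le_iff₀ (by positivity)]
  calc |inner ℝ η e| ≤ ‖η‖ * ‖e‖ := abs_real_inner_le_norm _ _
    _ ≤ ‖η‖ * 1 := by gcongr
    _ = ‖η‖⁻¹ * ‖η‖ ^ 2 := by field_simp

/- The factor `t` coming from the derivative of the Mittag-Leffler function is absorbed by the
vanishing of `G` on the sphere of radius `R`: `(R - ‖η‖) t` is bounded by the exponential gap. -/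
theorem exists_norm_mul_mittagLefflerRay_mul_le (hα : 0 < α) (hα1 : α ≤ 1) (hs₀ : 0 < s₀.re)
    (hL : LipschitzWith L G) {R : ℝ} (hR : 0 < R) (hGR : ∀ η, R ≤ ‖η‖ → G η = 0) :
    ∃ K : ℝ, 0 ≤ K ∧ ∀ t : ℝ, 1 ≤ t → ∀ η e : E, ‖e‖ ≤ 1 → ‖η‖ ≤ R →
      ‖((2 / α * (inner ℝ η e / ‖η‖ ^ 2) : ℝ) : ℂ) *
          mittagLefflerRay α (s₀ ^ (α : ℂ)) (rescaledTime α t η) * G η‖ ≤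
        K * Real.exp (s₀.re * ((2 * Real.pi * R) ^ (2 / α) * t)) := by
  obtain ⟨C, hC, hray⟩ := exists_norm_mittagLefflerRay_le hα hα1 hs₀
  set D : ℝ := (2 * Real.pi) ^ 2 * R + 2 * Real.pi * (2 * Real.pi * R) ^ (2 / α - 1)
  set δ : ℝ := (2 * Real.pi * R) ^ (2 / α - 1) * (2 * Real.pi)
  refine ⟨2 / α * C * L * D * (s₀.re * δ)⁻¹, by positivity, fun t ht η e he hηR => ?_⟩
  rcases eq_or_ne η 0 with rfl | hη
  · simp only [inner_zero_left, zero_div, mul_zero, Complex.ofReal_zero, zero_mul, norm_zero]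
    positivity
  have ht₀ : 0 ≤ t := zero_le_one.trans ht
  set τ := rescaledTime α t η
  set T := (2 * Real.pi * R) ^ (2 / α) * t
  have hGη := norm_le_mul_sub_norm_of_lipschitzWith hL hGR hη hηR
  have := sub_nonneg.2 hηR
  have hτ : 0 ≤ τ := rescaledTime_nonneg ht₀ η
  rw [norm_mul, norm_mul, Complex.norm_real, Real.norm_eq_abs, abs_mul,
    abs_of_pos (by positivity : 0 < 2 / α)]
  calc _ ≤ 2 / α * ‖η‖⁻¹ * (C * (τ ^ α + τ) * Real.exp (s₀.re * τ)) * (L * (R - ‖η‖)) := by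
        gcongr
        · exact abs_inner_div_norm_sq_le he
        · exact hray τ hτ
    _ = 2 / α * C * L * (‖η‖⁻¹ * (τ ^ α + τ)) * ((R - ‖η‖) * Real.exp (s₀.re * τ)) := by ring
    _ ≤ 2 / α * C * L * (D * t) * ((R - ‖η‖) * Real.exp (s₀.re * τ)) :=
        mul_le_mul_of_nonneg_right (mul_le_mul_of_nonneg_left
          (inv_norm_mul_rescaledTime_le hα hα1 ht hη hηR) (by positivity)) (by positivity)
    _ = 2 / α * C * L * D * ((R - ‖η‖) * t * Real.exp (s₀.re * τ)) := by ring
    _ ≤ 2 / α * C * L * D * ((s₀.re * δ)⁻¹ * Real.exp (s₀.re * T)) :=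
        mul_le_mul_of_nonneg_left (sub_norm_mul_exp_rescaledTime_le hα hα1 ht₀ hη hηR hs₀)
          (by positivity)
    _ = _ := by ring

theorem exists_norm_fderiv_evolvedSymbol_le (hα : 0 < α) (hα1 : α ≤ 1) (hs₀ : 0 < s₀.re)
    (hG : Differentiable ℝ G) (hL : LipschitzWith L G) {R : ℝ} (hR : 0 < R)
    (hGR : ∀ η, R ≤ ‖η‖ → G η = 0) :
    ∃ K : ℝ, 0 ≤ K ∧ ∀ t : ℝ, 1 ≤ t → ∀ η e : E, ‖e‖ ≤ 1 →
      ‖fderiv ℝ (evolvedSymbol α (s₀ ^ (α : ℂ)) G t) η e‖ ≤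
        (Metric.closedBall (0 : E) R).indicator
          (fun _ => K * Real.exp (s₀.re * ((2 * Real.pi * R) ^ (2 / α) * t))) η := by
  obtain ⟨C, hC, hE⟩ := exists_norm_mittagLeffler_ray_le hα hα1 hs₀
  obtain ⟨K, hK, hray⟩ := exists_norm_mul_mittagLefflerRay_mul_le hα hα1 hs₀ hL hR hGR
  refine ⟨K + C * L, by positivity, fun t ht η e he => ?_⟩
  have ht₀ : 0 ≤ t := zero_le_one.trans ht
  by_cases hηR : ‖η‖ ≤ R
  · rw [Set.indicator_of_mem (by simpa using hηR), fderiv_evolvedSymbol hα hG ht₀]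
    have hET := norm_mul_fderiv_le_of_lipschitzWith hL he
      (hE _ (rescaledTime_nonneg (α := α) ht₀ η)) η
    calc _ ≤ K * Real.exp (s₀.re * ((2 * Real.pi * R) ^ (2 / α) * t)) +
          C * Real.exp (s₀.re * rescaledTime α t η) * L :=
        norm_add_le_of_le (hray t ht η e he hηR) hET
      _ ≤ K * Real.exp (s₀.re * ((2 * Real.pi * R) ^ (2 / α) * t)) +
          C * Real.exp (s₀.re * ((2 * Real.pi * R) ^ (2 / α) * t)) * L := by
        gcongr
        exact rescaledTime_le hα ht₀ hηR
      _ = _ := by ring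
  · rw [Set.indicator_of_notMem (by simpa using hηR),
      fderiv_evolvedSymbol_eq_zero hGR (not_le.1 hηR)]
    simp

theorem exists_le_norm_fderiv_evolvedSymbol (hα : 0 < α) (hα1 : α ≤ 1) (hs₀ : 0 < s₀.re)
    (hG : Differentiable ℝ G) (hL : LipschitzWith L G) {S : Set E} {e : E} (he : ‖e‖ ≤ 1)
    {R ρ b c : ℝ} (hR : 0 < R) (hρ : 0 < ρ) (hb : 0 < b) (hc : 0 < c)
    (hSR : ∀ η ∈ S, ‖η‖ ≤ R) (hSρ : ∀ η ∈ S, ρ ≤ 2 * Real.pi * ‖η‖)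
    (hSb : ∀ η ∈ S, b ≤ |inner ℝ η e|) (hSc : ∀ η ∈ S, c ≤ ‖G η‖) :
    ∃ T : ℝ, 0 ≤ T ∧ ∀ t : ℝ, T ≤ t → ∀ η ∈ S, Real.exp (s₀.re * (ρ ^ (2 / α) * t)) ≤
      ‖fderiv ℝ (evolvedSymbol α (s₀ ^ (α : ℂ)) G t) η e‖ := by
  obtain ⟨C, -, hE⟩ := exists_norm_mittagLeffler_ray_le hα hα1 hs₀
  obtain ⟨c', T₀, hc', -, hray⟩ := exists_le_norm_mittagLefflerRay hα hα1 hs₀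
  set c₁ : ℝ := 2 / α * (b / R ^ 2) * c' * c with hc₁
  have hc₁_pos : 0 < c₁ := by positivity
  have hρα : 0 < ρ ^ (2 / α) := Real.rpow_pos_of_pos hρ _
  refine ⟨max 0 (max T₀ ((1 + C * L) / c₁) / ρ ^ (2 / α)), le_max_left _ _, fun t ht η hη => ?_⟩
  have ht₀ : 0 ≤ t := (le_max_left _ _).trans ht
  set τ := rescaledTime α t η
  have hτρ : ρ ^ (2 / α) * t ≤ τ := le_rescaledTime hα ht₀ hρ.le (hSρ η hη)
  obtain ⟨hτT₀, hτ⟩ : T₀ ≤ τ ∧ 1 + C * L ≤ c₁ * τ := by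
    rw [← div_le_iff₀' hc₁_pos, ← max_le_iff]
    exact ((div_le_iff₀' hρα).1 ((le_max_right _ _).trans ht)).trans hτρ
  have hη_pos : 0 < ‖η‖ := pos_of_mul_pos_right (hρ.trans_le (hSρ η hη)) (by positivity)
  have hET := norm_mul_fderiv_le_of_lipschitzWith hL he
    (hE τ (rescaledTime_nonneg ht₀ η)) η
  have hmain : c₁ * τ * Real.exp (s₀.re * τ) ≤ ‖((2 / α * (inner ℝ η e / ‖η‖ ^ 2) : ℝ) : ℂ) *
      mittagLefflerRay α (s₀ ^ (α : ℂ)) τ * G η‖ := by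
    rw [norm_mul, norm_mul, Complex.norm_real, Real.norm_eq_abs, abs_mul,
      abs_of_pos (by positivity : 0 < 2 / α), abs_div, abs_of_nonneg (by positivity : 0 ≤ ‖η‖ ^ 2)]
    calc c₁ * τ * Real.exp (s₀.re * τ) =
        2 / α * (b / R ^ 2) * (c' * τ * Real.exp (s₀.re * τ)) * c := by rw [hc₁]; ring
      _ ≤ _ := by
        have hτ_pos : 0 ≤ τ := rescaledTime_nonneg ht₀ η
        gcongr
        exacts [hSb η hη, hSR η hη, hray τ hτT₀, hSc η hη]
  rw [fderiv_evolvedSymbol hα hG ht₀]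
  calc Real.exp (s₀.re * (ρ ^ (2 / α) * t)) ≤ 1 * Real.exp (s₀.re * τ) := by
        rw [one_mul]
        gcongr
    _ ≤ (c₁ * τ - C * L) * Real.exp (s₀.re * τ) := by
        gcongr
        linarith
    _ = c₁ * τ * Real.exp (s₀.re * τ) - C * Real.exp (s₀.re * τ) * L := by ring
    _ ≤ _ := (sub_le_sub hmain hET).trans (norm_sub_le_norm_add _ _)

end EvolvedSymbol

section FourierL2

/-! ### The Fourier transform on `L²` and the free Hamiltonian -/

open FourierTransform TemperedDistribution
open scoped ContDiff

variable {E : Type*} [NormedAddCommGroup E] [InnerProductSpace ℝ E] {U : E → ℂ}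

/-- The symbol of `-Δ` for the normalization of `𝓕`. -/
noncomputable def freeSymbol (E : Type*) [NormedAddCommGroup E] [InnerProductSpace ℝ E] :
    C(E, ℂ) :=
  ⟨fun η => (((2 * Real.pi * ‖η‖) ^ 2 : ℝ) : ℂ), by fun_prop⟩

theorem freeSymbol_apply (η : E) : freeSymbol E η = (((2 * Real.pi * ‖η‖) ^ 2 : ℝ) : ℂ) := rfl

theorem freeSymbol_eq_smul :
    ⇑(freeSymbol E) = ((2 * Real.pi) ^ 2 : ℂ) • fun η : E => Complex.ofReal (‖η‖ ^ 2) := by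
  funext η
  simp [freeSymbol_apply, mul_pow]

theorem hasTemperateGrowth_freeSymbol : (freeSymbol E : E → ℂ).HasTemperateGrowth := by
  rw [freeSymbol_eq_smul]
  fun_prop

theorem continuous_fderiv_apply (hU : ContDiff ℝ 1 U) (e : E) :
    Continuous fun η => fderiv ℝ U η e :=
  (hU.continuous_fderiv one_ne_zero).clm_apply continuous_const

theorem hasCompactSupport_fderiv_apply (hUc : HasCompactSupport U) (e : E) :
    HasCompactSupport fun η => fderiv ℝ U η e :=
  (hUc.fderiv ℝ).comp_left (g := fun T : E →L[ℝ] ℂ => T e) rfl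

variable [FiniteDimensional ℝ E] [MeasurableSpace E] [BorelSpace E]
  {φ f h : Lp ℂ 2 (volume : Measure E)}

theorem ae_eq_of_toTemperedDistribution_apply_eq {ψ : E → ℂ} (hψ : LocallyIntegrable ψ volume)
    (hφ : ∀ u : 𝓢(E, ℂ), (φ : 𝓢'(E, ℂ)) u = ∫ x, u x • ψ x) : φ =ᵐ[volume] ψ := by
  refine ae_eq_of_integral_contDiff_smul_eq ((Lp.memLp φ).locallyIntegrable (by norm_num)) hψ
    fun g hg hgc => ?_
  have hgc' : HasCompactSupport (Complex.ofRealCLM ∘ g) := hgc.comp_left rfl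
  have hg' : ContDiff ℝ ∞ (Complex.ofRealCLM ∘ g) := by fun_prop
  simpa [Lp.toTemperedDistribution_apply] using hφ (hgc'.toSchwartzMap hg')

theorem smulLeftCLM_toTemperedDistribution_eq_iff {m : E → ℂ} (hm : m.HasTemperateGrowth) :
    smulLeftCLM ℂ m (f : 𝓢'(E, ℂ)) = (h : 𝓢'(E, ℂ)) ↔ h =ᵐ[volume] fun x => m x * f x := by
  have happ (u : 𝓢(E, ℂ)) : smulLeftCLM ℂ m (f : 𝓢'(E, ℂ)) u = ∫ x, u x • (m x * f x) := by
    rw [smulLeftCLM_apply_apply, Lp.toTemperedDistribution_apply]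
    simp only [SchwartzMap.smulLeftCLM_apply_apply hm, smul_eq_mul, mul_assoc, mul_left_comm]
  constructor
  · intro heq
    refine ae_eq_of_toTemperedDistribution_apply_eq ?_ fun u => by rw [← heq, happ]
    have hf : LocallyIntegrable f volume := (Lp.memLp f).locallyIntegrable (by norm_num)
    exact locallyIntegrableOn_univ.1 ((locallyIntegrableOn_univ.2 hf).continuousOn_smul
      isOpen_univ.isLocallyClosed hm.1.continuous.continuousOn)
  · intro hae
    ext u
    rw [happ, Lp.toTemperedDistribution_apply]
    refine integral_congr_ae ?_
    filter_upwards [hae] with x hx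
    rw [hx]

theorem fourier_neg_laplacian (T : 𝓢'(E, ℂ)) :
    𝓕 (-(Δ T)) = smulLeftCLM ℂ (freeSymbol E) (𝓕 T) := by
  have hsmul (S : 𝓢'(E, ℂ)) :
      𝓕 (((2 * Real.pi) ^ 2 : ℝ) • 𝓕⁻ S) = ((2 * Real.pi) ^ 2 : ℂ) • S := by
    ext u
    simp
  rw [laplacian_eq_fourierMultiplierCLM, neg_smul, neg_neg, fourierMultiplierCLM_apply, hsmul,
    freeSymbol_eq_smul, smulLeftCLM_smul (by fun_prop)]
  rfl

theorem neg_laplacian_eq_iff :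
    -(Δ (f : 𝓢'(E, ℂ))) = (h : 𝓢'(E, ℂ)) ↔
      (𝓕 h : Lp ℂ 2 volume) =ᵐ[volume] fun η => freeSymbol E η * (𝓕 f : Lp ℂ 2 volume) η := by
  rw [← smulLeftCLM_toTemperedDistribution_eq_iff hasTemperateGrowth_freeSymbol,
    ← Lp.fourier_toTemperedDistribution_eq, ← Lp.fourier_toTemperedDistribution_eq,
    ← fourier_neg_laplacian]
  exact (FourierTransform.fourierEquiv ℂ 𝓢'(E, ℂ)).injective.eq_iff.symm

theorem isFreeHamiltonian_iff {d : ℕ} {f h : L2Space d} :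
    IsFreeHamiltonian f h ↔ (𝓕 h : L2Space d) =ᵐ[volume]
      fun η => freeSymbol (RSpace d) η * (𝓕 f : L2Space d) η := by
  rw [IsFreeHamiltonian, neg_laplacian_eq_iff]
  refine ⟨And.right, fun H => ⟨?_, H⟩⟩
  rw [memSobolev_iff_exists_smulLeftCLM_fourier]
  refine ⟨𝓕 f + (((2 * Real.pi) ^ 2)⁻¹ : ℂ) • 𝓕 h, ?_⟩
  rw [Lp.fourier_toTemperedDistribution_eq,
    smulLeftCLM_toTemperedDistribution_eq_iff (by fun_prop)]
  filter_upwards [H, Lp.coeFn_add (𝓕 f) ((((2 * Real.pi) ^ 2)⁻¹ : ℂ) • 𝓕 h),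
    Lp.coeFn_smul (((2 * Real.pi) ^ 2)⁻¹ : ℂ) (𝓕 h)] with x hx hadd hsmul
  have : (Real.pi : ℂ) ≠ 0 := by exact_mod_cast Real.pi_ne_zero
  rw [hadd, Pi.add_apply, hsmul, Pi.smul_apply, hx, freeSymbol_apply]
  simp only [Complex.ofReal_pow, Complex.ofReal_mul, Complex.ofReal_ofNat, smul_eq_mul, ne_eq,
    OfNat.ofNat_ne_zero, not_false_eq_true, div_self, Real.rpow_one, Complex.ofReal_add,
    Complex.ofReal_one]
  field_simp

theorem eq_of_fourier_ae_eq (hfh : (𝓕 f : Lp ℂ 2 volume) =ᵐ[volume] (𝓕 h : Lp ℂ 2 volume)) :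
    f = h :=
  (Lp.fourierTransformₗᵢ E ℂ).injective (Lp.ext hfh)

theorem continuous_fourierInv (hU : Integrable U) : Continuous (𝓕⁻ U) :=
  VectorFourier.fourierIntegral_continuous Real.continuous_fourierChar
    (by exact (continuous_inner (𝕜 := ℝ)).neg) hU

theorem integral_fourierInv_smul {u : E → ℂ} (hu : Integrable u) (hU : Integrable U) :
    ∫ x, 𝓕⁻ u x • U x = ∫ x, u x • 𝓕⁻ U x := by
  have hflip : (-innerₗ E).flip = -innerₗ E := by
    ext x y
    simp [real_inner_comm]
  have key := VectorFourier.integral_fourierIntegral_smul_eq_flip (L := -innerₗ E)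
    Real.continuous_fourierChar (by exact (continuous_inner (𝕜 := ℝ)).neg) hu hU
  rwa [hflip] at key

theorem fourierInv_toLp_ae_eq (hU : Integrable U) (hU2 : MemLp U 2) :
    (𝓕⁻ (hU2.toLp U) : Lp ℂ 2 (volume : Measure E)) =ᵐ[volume] 𝓕⁻ U := by
  refine ae_eq_of_toTemperedDistribution_apply_eq (continuous_fourierInv hU).locallyIntegrable
    fun u => ?_
  rw [← Lp.fourierInv_toTemperedDistribution_eq, TemperedDistribution.fourierInv_apply,
    Lp.toTemperedDistribution_apply, ← integral_fourierInv_smul u.integrable hU]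
  refine integral_congr_ae ?_
  filter_upwards [hU2.coeFn_toLp] with x hx
  rw [hx, SchwartzMap.fourierInv_coe]

theorem fourier_ae_eq_of_ae_eq_fourierInv (hU : Integrable U) (hU2 : MemLp U 2)
    (hφ : φ =ᵐ[volume] 𝓕⁻ U) : (𝓕 φ : Lp ℂ 2 volume) =ᵐ[volume] U := by
  have heq : φ = 𝓕⁻ (hU2.toLp U) := Lp.ext (hφ.trans (fourierInv_toLp_ae_eq hU hU2).symm)
  rw [heq, fourier_fourierInv_eq]
  exact hU2.coeFn_toLp

theorem ae_eq_fourierInv_of_fourier_ae_eq (hU : Integrable U)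
    (hφ : (𝓕 φ : Lp ℂ 2 volume) =ᵐ[volume] U) : φ =ᵐ[volume] 𝓕⁻ U := by
  have hU2 : MemLp U 2 := (memLp_congr_ae hφ).1 (Lp.memLp _)
  have heq : 𝓕 φ = hU2.toLp U := Lp.ext (hφ.trans hU2.coeFn_toLp.symm)
  have hφ' : φ = 𝓕⁻ (hU2.toLp U) := by
    rw [← heq]
    exact ((Lp.fourierTransformₗᵢ E ℂ).symm_apply_apply φ).symm
  rw [hφ']
  exact fourierInv_toLp_ae_eq hU hU2

theorem norm_toLp_sq_eq_integral (hU2 : MemLp U 2) : ‖hU2.toLp U‖ ^ 2 = ∫ x, ‖U x‖ ^ 2 := by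
  rw [Lp.norm_toLp, hU2.eLpNorm_eq_integral_rpow_norm two_ne_zero ENNReal.ofNat_ne_top]
  have hnonneg : 0 ≤ ∫ x, ‖U x‖ ^ 2 := integral_nonneg fun x => by positivity
  simp only [ENNReal.toReal_ofNat, Real.rpow_two]
  rw [ENNReal.toReal_ofReal (by positivity), ← Real.rpow_natCast, ← Real.rpow_mul hnonneg]
  norm_num

theorem memLp_fourierInv (hU : Integrable U) (hU2 : MemLp U 2) : MemLp (𝓕⁻ U) 2 volume :=
  (memLp_congr_ae (fourierInv_toLp_ae_eq hU hU2)).1 (Lp.memLp _)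

theorem integral_norm_sq_fourierInv (hU : Integrable U) (hU2 : MemLp U 2) :
    ∫ x, ‖𝓕⁻ U x‖ ^ 2 = ∫ η, ‖U η‖ ^ 2 := by
  have heq : (memLp_fourierInv hU hU2).toLp _ = 𝓕⁻ (hU2.toLp U) :=
    Lp.ext ((MemLp.coeFn_toLp _).trans (fourierInv_toLp_ae_eq hU hU2).symm)
  rw [← norm_toLp_sq_eq_integral hU2, ← norm_toLp_sq_eq_integral (memLp_fourierInv hU hU2), heq,
    ← Lp.norm_fourier_eq, fourier_fourierInv_eq]

theorem fourierInv_fderiv_apply (hU : Differentiable ℝ U) (hUint : Integrable U)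
    (hU' : Integrable (fderiv ℝ U)) (e x : E) :
    𝓕⁻ (fun η => fderiv ℝ U η e) x =
      -(2 * Real.pi * Complex.I * (inner ℝ x e : ℝ)) * 𝓕⁻ U x := by
  have hcomm : 𝓕 (fun η => fderiv ℝ U η e) (-x) = 𝓕 (fderiv ℝ U) (-x) e :=
    (Real.fourierIntegral_continuousLinearMap_apply' (L := innerSL ℝ) hU').symm
  rw [Real.fourierInv_eq_fourier_neg, Real.fourierInv_eq_fourier_neg, hcomm,
    Real.fourier_fderiv hUint hU hU']
  have hinner : innerSL ℝ x e = inner ℝ x e := rfl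
  simp only [VectorFourier.fourierSMulRight_apply, neg_apply, map_neg, neg_neg, hinner,
    smul_eq_mul, Complex.real_smul]
  ring

/-! ### The mean square displacement on the Fourier side -/

theorem norm_sq_fourierInv_fderiv_apply (hU : ContDiff ℝ 1 U) (hUc : HasCompactSupport U)
    (e x : E) :
    ‖𝓕⁻ (fun η => fderiv ℝ U η e) x‖ ^ 2 =
      (2 * Real.pi) ^ 2 * (inner ℝ x e ^ 2 * ‖𝓕⁻ U x‖ ^ 2) := by
  rw [fourierInv_fderiv_apply (hU.differentiable one_ne_zero)
    (hU.continuous.integrable_of_hasCompactSupport hUc)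
    ((hU.continuous_fderiv one_ne_zero).integrable_of_hasCompactSupport (hUc.fderiv ℝ))]
  simp only [neg_mul, norm_neg, Complex.norm_mul, Complex.norm_ofNat, Complex.norm_real,
    Real.norm_eq_abs, abs_of_pos Real.pi_pos, Complex.norm_I, mul_one, mul_pow, sq_abs]
  ring

theorem integrable_inner_sq_mul_norm_sq_fourierInv (hU : ContDiff ℝ 1 U)
    (hUc : HasCompactSupport U) (e : E) :
    Integrable fun x => inner ℝ x e ^ 2 * ‖𝓕⁻ U x‖ ^ 2 := by
  have hD := continuous_fderiv_apply hU e
  have hDc := hasCompactSupport_fderiv_apply hUc e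
  have hint := (memLp_fourierInv (hD.integrable_of_hasCompactSupport hDc)
    (hD.memLp_of_hasCompactSupport hDc)).integrable_norm_pow two_ne_zero
  simp only [norm_sq_fourierInv_fderiv_apply hU hUc] at hint
  exact (integrable_const_mul_iff (by simp [Real.pi_ne_zero]) _).1 hint

theorem integral_inner_sq_mul_norm_sq_fourierInv (hU : ContDiff ℝ 1 U)
    (hUc : HasCompactSupport U) (e : E) :
    ∫ x, inner ℝ x e ^ 2 * ‖𝓕⁻ U x‖ ^ 2 =
      ((2 * Real.pi) ^ 2)⁻¹ * ∫ η, ‖fderiv ℝ U η e‖ ^ 2 := by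
  have hD := continuous_fderiv_apply hU e
  have hDc := hasCompactSupport_fderiv_apply hUc e
  rw [← integral_norm_sq_fourierInv (hD.integrable_of_hasCompactSupport hDc)
    (hD.memLp_of_hasCompactSupport hDc)]
  simp only [norm_sq_fourierInv_fderiv_apply hU hUc]
  rw [integral_const_mul, inv_mul_cancel_left₀ (by positivity)]

theorem norm_sq_eq_sum_inner_single {d : ℕ} (x : RSpace d) :
    ‖x‖ ^ 2 = ∑ j, inner ℝ x (EuclideanSpace.single j (1 : ℝ)) ^ 2 := by
  simp [EuclideanSpace.norm_sq_eq, EuclideanSpace.inner_single_right]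

theorem memWeightedL2_of_fourier_ae_eq {d : ℕ} {U : RSpace d → ℂ} (hU : ContDiff ℝ 1 U)
    (hUc : HasCompactSupport U) {φ : L2Space d} (hφ : (𝓕 φ : L2Space d) =ᵐ[volume] U) :
    MemWeightedL2 φ := by
  have hφU := ae_eq_fourierInv_of_fourier_ae_eq
    (hU.continuous.integrable_of_hasCompactSupport hUc) hφ
  have hsum := integrable_finsetSum Finset.univ fun (j : Fin d) _ =>
    integrable_inner_sq_mul_norm_sq_fourierInv hU hUc (EuclideanSpace.single j 1)
  refine (((Lp.memLp φ).integrable_norm_pow two_ne_zero).add hsum).congr ?_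
  filter_upwards [hφU] with x hx
  rw [Pi.add_apply, ← Finset.sum_mul, ← norm_sq_eq_sum_inner_single, hx]
  ring

theorem meanSquareDisplacement_of_fourier_ae_eq {d : ℕ} {U : RSpace d → ℂ} (hU : ContDiff ℝ 1 U)
    (hUc : HasCompactSupport U) {φ : L2Space d} (hφ : (𝓕 φ : L2Space d) =ᵐ[volume] U) :
    meanSquareDisplacement φ = ((2 * Real.pi) ^ 2)⁻¹ *
      ∑ j, ∫ η, ‖fderiv ℝ U η (EuclideanSpace.single j 1)‖ ^ 2 := by
  have hφU := ae_eq_fourierInv_of_fourier_ae_eq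
    (hU.continuous.integrable_of_hasCompactSupport hUc) hφ
  calc meanSquareDisplacement φ = ∫ x, ∑ j, inner ℝ x (EuclideanSpace.single j (1 : ℝ)) ^ 2 *
        ‖𝓕⁻ U x‖ ^ 2 := by
        refine integral_congr_ae ?_
        filter_upwards [hφU] with x hx
        rw [← Finset.sum_mul, ← norm_sq_eq_sum_inner_single, hx]
    _ = _ := by
        rw [integral_finsetSum _ fun j _ => integrable_inner_sq_mul_norm_sq_fourierInv hU hUc _,
          Finset.mul_sum]
        simp only [integral_inner_sq_mul_norm_sq_fourierInv hU hUc]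

end FourierL2

section SymbolSeries

variable {E : Type*} [NormedAddCommGroup E] {α t : ℝ}

theorem evolvedSymbol_zero (hα : 0 < α) (ω : ℂ) (G : E → ℂ) (η : E) :
    evolvedSymbol α ω G 0 η = G η := by
  have hzero : HasSum (fun k : ℕ => (((Real.Gamma (α * k + 1))⁻¹ : ℝ) : ℂ) * 0 ^ k) 1 := by
    convert hasSum_single 0 fun k hk => ?_
    · simp
    · simp [hk]
  rw [evolvedSymbol, Real.zero_rpow hα.ne', zero_mul, Complex.ofReal_zero, mul_zero,
    (hasSum_mittagLeffler hα 0).unique hzero, one_mul]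

theorem hasSum_evolvedSymbol [InnerProductSpace ℝ E] (hα : 0 < α) (ω : ℂ) (G : E → ℂ)
    (ht : 0 ≤ t) (η : E) :
    HasSum (fun k : ℕ => (fracKernel (α * k + 1) t : ℂ) * ((ω * freeSymbol E η) ^ k * G η))
      (evolvedSymbol α ω G t η) := by
  have hker (k : ℕ) : fracKernel (α * k + 1) t = (t ^ α) ^ k * (Real.Gamma (α * k + 1))⁻¹ := by
    rw [fracKernel, add_sub_cancel_right, Real.rpow_mul ht, Real.rpow_natCast, div_eq_mul_inv]
  refine ((hasSum_mittagLeffler hα (ω * ((t ^ α * (2 * Real.pi * ‖η‖) ^ 2 : ℝ) : ℂ))).mul_right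
    (G η)).congr_fun fun k => ?_
  rw [hker, freeSymbol_apply]
  push_cast
  ring

end SymbolSeries

section FourierMultiplier

/-! ### Bounded Fourier multipliers -/

open FourierTransform

variable {E : Type*} [NormedAddCommGroup E] [InnerProductSpace ℝ E] [FiniteDimensional ℝ E]
  [MeasurableSpace E] [BorelSpace E]

/-- The operator on `L²` acting on Fourier transforms as multiplication by the bounded symbol
`m`. -/
noncomputable def boundedFourierMultiplier (m : Lp ℂ ⊤ (volume : Measure E)) :
    Lp ℂ 2 (volume : Measure E) →L[ℂ] Lp ℂ 2 (volume : Measure E) :=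
  (Lp.fourierTransformₗᵢ E ℂ).symm.toContinuousLinearEquiv.toContinuousLinearMap ∘L
    ((ContinuousLinearMap.lsmul ℂ ℂ (E := ℂ)).holderL volume ⊤ 2 2 m) ∘L
    (Lp.fourierTransformₗᵢ E ℂ).toContinuousLinearEquiv.toContinuousLinearMap

theorem fourier_boundedFourierMultiplier (m : Lp ℂ ⊤ (volume : Measure E))
    (f : Lp ℂ 2 (volume : Measure E)) :
    (𝓕 (boundedFourierMultiplier m f) : Lp ℂ 2 volume) =ᵐ[volume]
      fun η => m η * (𝓕 f : Lp ℂ 2 volume) η := by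
  have h : 𝓕 (boundedFourierMultiplier m f) =
      (ContinuousLinearMap.lsmul ℂ ℂ (E := ℂ)).holder 2 m (𝓕 f) :=
    (Lp.fourierTransformₗᵢ E ℂ).apply_symm_apply _
  rw [h]
  exact (ContinuousLinearMap.lsmul ℂ ℂ (E := ℂ)).coeFn_holder (r := 2) m (𝓕 f)

theorem memLp_top_indicator_closedBall (m : C(E, ℂ)) (R : ℝ) :
    MemLp ((Metric.closedBall (0 : E) R).indicator m) ⊤ volume := by
  obtain ⟨M, hM⟩ := (isCompact_closedBall (0 : E) R).exists_bound_of_continuousOn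
    m.continuous.continuousOn
  refine memLp_top_of_bound
    (m.continuous.measurable.indicator measurableSet_closedBall).aestronglyMeasurable (max M 0)
    (ae_of_all _ fun η => ?_)
  rw [norm_indicator_eq_indicator_norm]
  exact Set.indicator_le' (fun η hη => (hM η hη).trans (le_max_left _ _))
    (fun _ _ => le_max_right _ _) η

/-- The Fourier multiplier whose symbol is `m` on the closed ball of radius `R` and `0` off it. -/
noncomputable def truncatedMultiplier (m : C(E, ℂ)) (R : ℝ) :
    Lp ℂ 2 (volume : Measure E) →L[ℂ] Lp ℂ 2 (volume : Measure E) :=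
  boundedFourierMultiplier ((memLp_top_indicator_closedBall m R).toLp _)

theorem fourier_truncatedMultiplier (m : C(E, ℂ)) (R : ℝ) (f : Lp ℂ 2 (volume : Measure E)) :
    (𝓕 (truncatedMultiplier m R f) : Lp ℂ 2 volume) =ᵐ[volume]
      (Metric.closedBall (0 : E) R).indicator fun η => m η * (𝓕 f : Lp ℂ 2 volume) η := by
  filter_upwards [fourier_boundedFourierMultiplier _ f,
    (memLp_top_indicator_closedBall m R).coeFn_toLp] with η hη hm
  rw [truncatedMultiplier, hη, hm, Set.indicator_mul_left]

/-- The generator `ω(-Δ)` of the evolution, cut off to frequencies `‖η‖ ≤ R` so as to be bounded. -/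
noncomputable def truncatedGenerator (ω : ℂ) (R : ℝ) :
    Lp ℂ 2 (volume : Measure E) →L[ℝ] Lp ℂ 2 (volume : Measure E) :=
  (ω • truncatedMultiplier (freeSymbol E) R).restrictScalars ℝ

theorem truncatedGenerator_apply (ω : ℂ) (R : ℝ) (f : Lp ℂ 2 (volume : Measure E)) :
    truncatedGenerator ω R f = ω • truncatedMultiplier (freeSymbol E) R f := rfl

variable {G : E → ℂ} {R : ℝ} {φ : Lp ℂ 2 (volume : Measure E)}

theorem fourier_truncatedGenerator_iterate (ω : ℂ) (hGR : ∀ η, R < ‖η‖ → G η = 0)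
    (hφ : (𝓕 φ : Lp ℂ 2 volume) =ᵐ[volume] G) (k : ℕ) :
    (𝓕 ((truncatedGenerator ω R)^[k] φ) : Lp ℂ 2 volume) =ᵐ[volume]
      fun η => (ω * freeSymbol E η) ^ k * G η := by
  induction k with
  | zero => simpa using hφ
  | succ k ih =>
    rw [Function.iterate_succ_apply', truncatedGenerator_apply, FourierTransform.fourier_smul]
    filter_upwards [ih, fourier_truncatedMultiplier (freeSymbol E) R
      ((truncatedGenerator ω R)^[k] φ), Lp.coeFn_smul ω (𝓕 (truncatedMultiplier (freeSymbol E) R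
        ((truncatedGenerator ω R)^[k] φ)))] with η hk hmul hsmul
    rw [hsmul, Pi.smul_apply, hmul, smul_eq_mul]
    by_cases hη : η ∈ Metric.closedBall (0 : E) R
    · rw [Set.indicator_of_mem hη, hk]
      ring
    · rw [Set.indicator_of_notMem hη, hGR η (by simpa using hη), mul_zero, mul_zero]

theorem ae_eq_of_hasSum {X F : Type*} [MeasurableSpace X] {μ : Measure X} [NormedAddCommGroup F]
    {p : ENNReal} [Fact (1 ≤ p)] {f : ℕ → Lp F p μ} {S : Lp F p μ} (hf : HasSum f S)
    {g : ℕ → X → F} (hg : ∀ k, f k =ᵐ[μ] g k) {s : X → F}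
    (hs : ∀ x, HasSum (fun k => g k x) (s x)) : S =ᵐ[μ] s := by
  have hsum (n : ℕ) : (∑ k ∈ Finset.range n, f k : Lp F p μ) =ᵐ[μ]
      fun x => ∑ k ∈ Finset.range n, g k x := by
    filter_upwards [Lp.coeFn_fun_finsetSum (Finset.range n) f, ae_all_iff.2 hg] with x hx hgx
    simp only [hx, hgx]
  obtain ⟨ns, hns, hlim⟩ :=
    (tendstoInMeasure_of_tendsto_Lp hf.tendsto_sum_nat).exists_seq_tendsto_ae
  filter_upwards [hlim, ae_all_iff.2 hsum] with x hx hsumx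
  refine tendsto_nhds_unique hx ?_
  simp only [hsumx]
  exact (hs x).tendsto_sum_nat.comp hns.tendsto_atTop

theorem fourier_fracSeries {α t : ℝ} (hα : 0 < α) (ω : ℂ) (hGR : ∀ η, R < ‖η‖ → G η = 0)
    (hφ : (𝓕 φ : Lp ℂ 2 volume) =ᵐ[volume] G) (ht : 0 ≤ t) :
    (𝓕 (fracSeries α 1 (truncatedGenerator ω R) φ t) : Lp ℂ 2 volume) =ᵐ[volume]
      evolvedSymbol α ω G t := by
  rcases ht.eq_or_lt with rfl | ht
  · rw [fracSeries_one_zero hα, funext (evolvedSymbol_zero hα ω G)]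
    exact hφ
  · have hsum := (summable_fracSeries hα one_pos (truncatedGenerator ω R) φ ht).hasSum.map
      (Lp.fourierTransformₗᵢ E ℂ) (Lp.fourierTransformₗᵢ E ℂ).continuous
    refine ae_eq_of_hasSum hsum (fun k => ?_) (hasSum_evolvedSymbol hα ω G ht.le)
    have hsmul : Lp.fourierTransformₗᵢ E ℂ
        (fracKernel (α * k + 1) t • (truncatedGenerator ω R)^[k] φ) =
        fracKernel (α * k + 1) t • 𝓕 ((truncatedGenerator ω R)^[k] φ) :=
      map_real_smul (Lp.fourierTransformₗᵢ E ℂ) (Lp.fourierTransformₗᵢ E ℂ).continuous _ _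
    rw [Function.comp_apply, hsmul]
    filter_upwards [Lp.coeFn_smul (fracKernel (α * k + 1) t)
      (𝓕 ((truncatedGenerator ω R)^[k] φ)),
      fourier_truncatedGenerator_iterate ω hGR hφ k] with η hη hiter
    rw [hη, Pi.smul_apply, hiter, Complex.real_smul]

end FourierMultiplier

section Profile

open FourierTransform

variable {d : ℕ}

/-- The Fourier transform, in the normalization of `𝓕`, of a state whose unitary Fourier transform
in angular frequency is `g`. -/
noncomputable def rescaledProfile (g : RSpace d → ℂ) (η : RSpace d) : ℂ :=
  (((2 * Real.pi) ^ ((d : ℝ) / 2) : ℝ) : ℂ) * g ((2 * Real.pi) • η)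

theorem adjointFourier_eq_fourierInv (g : RSpace d → ℂ) :
    adjointFourier g = 𝓕⁻ (rescaledProfile g) := by
  funext x
  have hcov := Measure.integral_comp_smul (volume : Measure (RSpace d))
    (fun ξ => Complex.exp (Complex.I * ((inner ℝ x ξ : ℝ) : ℂ)) * g ξ) (2 * Real.pi)
  rw [finrank_euclideanSpace_fin, abs_of_pos (by positivity)] at hcov
  have hcov' : ∫ ξ, Complex.exp (Complex.I * ((inner ℝ x ξ : ℝ) : ℂ)) * g ξ =
      (((2 * Real.pi) ^ d : ℝ) : ℂ) * ∫ η : RSpace d, Complex.exp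
        (Complex.I * ((inner ℝ x ((2 * Real.pi) • η) : ℝ) : ℂ)) * g ((2 * Real.pi) • η) := by
    rw [hcov, Complex.real_smul, ← mul_assoc, ← Complex.ofReal_mul,
      mul_inv_cancel₀ (by positivity), Complex.ofReal_one, one_mul]
  have hconst : (2 * Real.pi) ^ (-(d : ℝ) / 2) * (2 * Real.pi) ^ d =
      (2 * Real.pi) ^ ((d : ℝ) / 2) := by
    rw [← Real.rpow_natCast, ← Real.rpow_add (by positivity)]
    ring_nf
  rw [adjointFourier, hcov', ← mul_assoc, ← Complex.ofReal_mul, Real.fourierInv_eq',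
    ← integral_const_mul, hconst]
  refine integral_congr_ae (ae_of_all _ fun η => ?_)
  simp only [rescaledProfile, inner_smul_right, real_inner_comm, smul_eq_mul,
    mul_comm Complex.I]
  ring

theorem rescaledProfile_ne_zero_iff {g : RSpace d → ℂ} {η : RSpace d} :
    rescaledProfile g η ≠ 0 ↔ g ((2 * Real.pi) • η) ≠ 0 := by
  have h : (((2 * Real.pi) ^ ((d : ℝ) / 2) : ℝ) : ℂ) ≠ 0 :=
    Complex.ofReal_ne_zero.2 (by positivity)
  simp only [rescaledProfile, ne_eq, mul_eq_zero, h, false_or]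

theorem contDiff_rescaledProfile {g : RSpace d → ℂ} {n : WithTop ℕ∞} (hg : ContDiff ℝ n g) :
    ContDiff ℝ n (rescaledProfile g) := by
  unfold rescaledProfile
  fun_prop

theorem hasCompactSupport_rescaledProfile {g : RSpace d → ℂ} (hgc : HasCompactSupport g) :
    HasCompactSupport (rescaledProfile g) :=
  (hgc.comp_smul (by positivity : 2 * Real.pi ≠ 0)).mul_left

theorem fourier_ae_eq_rescaledProfile {g : RSpace d → ℂ} (hg : Continuous g)
    (hgc : HasCompactSupport g) {φ : L2Space d} (hφ : φ =ᵐ[volume] adjointFourier g) :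
    (𝓕 φ : L2Space d) =ᵐ[volume] rescaledProfile g := by
  have hG := contDiff_zero.1 (contDiff_rescaledProfile (contDiff_zero.2 hg))
  have hGc := hasCompactSupport_rescaledProfile hgc
  rw [adjointFourier_eq_fourierInv] at hφ
  exact fourier_ae_eq_of_ae_eq_fourierInv (hG.integrable_of_hasCompactSupport hGc)
    (hG.memLp_of_hasCompactSupport hGc) hφ

end Profile

section TimeFractionalSchrodinger

/-! ### Existence and uniqueness for the time-fractional Schrödinger equation -/

open FourierTransform

variable {d : ℕ} {α β t : ℝ} {φ : L2Space d} {u v w : ℝ → L2Space d}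

theorem caputo_one : caputo 1 v = v := by
  funext t
  simp [caputo]

theorem caputo_eq_fracIntegral (hα : α < 1) : caputo α v = fracIntegral (1 - α) v := by
  funext t
  rw [caputo, if_neg hα.ne, fracIntegral, ← intervalIntegral.integral_smul]
  refine intervalIntegral.integral_congr fun s _ => ?_
  simp only [fracKernel, smul_smul, sub_sub_cancel_left]
  rw [div_eq_inv_mul]

theorem integrableOn_fracKernel_smul_caputo (hα : 0 < α) (hα1 : α ≤ 1)
    (hv : IntegrableOn v (Set.Ioc 0 t)) :
    IntegrableOn (fun τ => fracKernel α (t - τ) • caputo α v τ) (Set.Ioc 0 t) := by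
  rcases hα1.eq_or_lt with rfl | hα1
  · simpa only [caputo_one, fracKernel_one, one_smul] using hv
  · rw [caputo_eq_fracIntegral hα1]
    exact integrableOn_fracKernel_smul_fracIntegral hα (sub_pos.2 hα1)
      (by simpa only [add_sub_cancel, fracKernel_one, one_smul] using hv)

theorem fracIntegral_caputo (hα : 0 < α) (hα1 : α ≤ 1) (ht : 0 ≤ t)
    (hv : IntegrableOn v (Set.Ioc 0 t)) :
    fracIntegral α (caputo α v) t = ∫ s in (0 : ℝ)..t, v s := by
  rcases hα1.eq_or_lt with rfl | hα1
  · rw [caputo_one, fracIntegral_one]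
  · rw [caputo_eq_fracIntegral hα1, fracIntegral_fracIntegral hα (sub_pos.2 hα1) ht
      (by simpa only [add_sub_cancel, fracKernel_one, one_smul] using hv), add_sub_cancel,
      fracIntegral_one]

theorem IsW11WithDeriv.continuousOn (hu : IsW11WithDeriv u v) {T : ℝ} (hT : 0 < T) :
    ContinuousOn u (Set.Icc 0 T) := by
  have hv : IntegrableOn v (Set.uIcc 0 T) := by
    rw [Set.uIcc_of_le hT.le, integrableOn_Icc_iff_integrableOn_Ioc]
    exact hu.1 T hT
  have hprim := intervalIntegral.continuousOn_primitive_interval hv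
  rw [Set.uIcc_of_le hT.le] at hprim
  exact (continuousOn_const.add hprim).congr fun t ht => hu.2 t ht.1

theorem IsW11WithDeriv.tendsto_zero (hu : IsW11WithDeriv u v) :
    Tendsto u (𝓝[>] 0) (𝓝 (u 0)) := by
  refine (hu.continuousOn one_pos 0 ⟨le_rfl, zero_le_one⟩).tendsto.mono_left ?_
  rw [← nhdsWithin_Ioc_eq_nhdsGT (zero_lt_one' ℝ)]
  exact nhdsWithin_mono 0 Set.Ioc_subset_Icc_self

theorem I_cpow_ne_zero (z : ℂ) : Complex.I ^ z ≠ 0 := by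
  simp [Complex.cpow_eq_zero_iff]

theorem caputo_fracSeries (hα : 0 < α) (hα1 : α ≤ 1) (B : L2Space d →L[ℝ] L2Space d)
    (φ : L2Space d) (ht : 0 < t) :
    caputo α (fracSeries α α B (B φ)) t = B (fracSeries α 1 B φ t) := by
  rw [map_fracSeries hα one_pos B φ ht]
  rcases hα1.eq_or_lt with rfl | hα1
  · rw [caputo_one]
  · rw [caputo_eq_fracIntegral hα1, fracIntegral_fracSeries hα (sub_pos.2 hα1) hα ht,
      sub_add_cancel]

theorem isW11WithDeriv_fracSeries (hα : 0 < α) (B : L2Space d →L[ℝ] L2Space d) (φ : L2Space d) :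
    IsW11WithDeriv (fracSeries α 1 B φ) (fracSeries α α B (B φ)) := by
  refine ⟨fun T hT => integrableOn_fracSeries hα hα B (B φ) hT, fun t ht => ?_⟩
  rw [fracSeries_one_zero hα]
  rcases ht.eq_or_lt with rfl | ht
  · rw [fracSeries_one_zero hα, intervalIntegral.integral_same, add_zero]
  · rw [integral_fracSeries hα hα B (B φ) ht, fracSeries_one_eq_add hα B φ ht]

theorem isFreeHamiltonian_truncatedMultiplier {f : L2Space d} {G : RSpace d → ℂ} {R : ℝ}
    (hGR : ∀ η, R < ‖η‖ → G η = 0) (hf : (𝓕 f : L2Space d) =ᵐ[volume] G) :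
    IsFreeHamiltonian f (truncatedMultiplier (freeSymbol (RSpace d)) R f) := by
  rw [isFreeHamiltonian_iff]
  filter_upwards [fourier_truncatedMultiplier (freeSymbol (RSpace d)) R f, hf] with η hη hfη
  rw [hη]
  by_cases hηR : η ∈ Metric.closedBall (0 : RSpace d) R
  · rw [Set.indicator_of_mem hηR]
  · rw [Set.indicator_of_notMem hηR, hfη, hGR η (by simpa using hηR), mul_zero]

theorem locallyIntegrableOn_Ioi_of_integrableOn_Ioc {X : Type*} [NormedAddCommGroup X] {f : ℝ → X}
    (hf : ∀ T, 0 < T → IntegrableOn f (Set.Ioc 0 T)) : LocallyIntegrableOn f (Set.Ioi 0) := by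
  intro t ht
  refine ⟨Set.Ioc 0 (t + 1), mem_nhdsWithin.2 ?_, hf _ (by linarith [Set.mem_Ioi.1 ht])⟩
  exact ⟨Set.Iio (t + 1), isOpen_Iio, by simp, fun s hs => ⟨hs.2, hs.1.le⟩⟩

theorem isTFSESolution_fracSeries (hα : 0 < α) (hα1 : α ≤ 1) {G : RSpace d → ℂ} {R : ℝ}
    (hGR : ∀ η, R < ‖η‖ → G η = 0) (hφ : (𝓕 φ : L2Space d) =ᵐ[volume] G) :
    IsTFSESolution α β φ
      (fracSeries α 1 (truncatedGenerator (Complex.I ^ (β : ℂ))⁻¹ R) φ) := by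
  set B : L2Space d →L[ℝ] L2Space d := truncatedGenerator (Complex.I ^ (β : ℂ))⁻¹ R with hB
  set H : L2Space d →L[ℂ] L2Space d := truncatedMultiplier (freeSymbol (RSpace d)) R
  have hW := isW11WithDeriv_fracSeries hα B φ
  refine ⟨fracSeries α α B (B φ), fun t => H (fracSeries α 1 B φ t), hW, ?_, ?_, ?_, ?_⟩
  · exact locallyIntegrableOn_Ioi_of_integrableOn_Ioc fun T hT =>
      H.integrable_comp (integrableOn_fracSeries hα one_pos B φ hT)
  · refine (ae_restrict_mem measurableSet_Ioi).mono fun t ht => ?_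
    exact isFreeHamiltonian_truncatedMultiplier
      (fun η hη => by rw [evolvedSymbol, hGR η hη, mul_zero])
      (fourier_fracSeries hα _ hGR hφ (Set.mem_Ioi.1 ht).le)
  · refine (ae_restrict_mem measurableSet_Ioi).mono fun t ht => ?_
    rw [caputo_fracSeries hα hα1 B φ ht, hB, truncatedGenerator_apply, smul_smul,
      mul_inv_cancel₀ (I_cpow_ne_zero _), one_smul, neg_add_cancel]
  · have hlim := (hW.tendsto_zero.sub_const φ).norm
    rwa [fracSeries_one_zero hα, sub_self, norm_zero] at hlim

theorem IsTFSESolution.continuousOn (hw : IsTFSESolution α β φ w) {T : ℝ} (hT : 0 < T) :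
    ContinuousOn w (Set.Icc 0 T) := by
  obtain ⟨v, h, hW, -⟩ := hw
  exact hW.continuousOn hT

theorem IsTFSESolution.apply_zero (hw : IsTFSESolution α β φ w) : w 0 = φ := by
  obtain ⟨v, h, hW, -, -, -, hlim⟩ := hw
  have hlim' := (hW.tendsto_zero.sub_const φ).norm
  exact sub_eq_zero.1 (norm_eq_zero.1 (tendsto_nhds_unique hlim' hlim))

theorem IsTFSESolution.exists_eq_add_fracIntegral (hα : 0 < α) (hα1 : α ≤ 1)
    (hw : IsTFSESolution α β φ w) :
    ∃ h : ℝ → L2Space d,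
      (∀ᵐ τ ∂volume.restrict (Set.Ioi 0), IsFreeHamiltonian (w τ) (h τ)) ∧ ∀ t, 0 < t →
        IntegrableOn (fun τ => fracKernel α (t - τ) • (Complex.I ^ (β : ℂ))⁻¹ • h τ)
          (Set.Ioc 0 t) ∧
        w t = φ + fracIntegral α (fun τ => (Complex.I ^ (β : ℂ))⁻¹ • h τ) t := by
  have hw0 := hw.apply_zero
  obtain ⟨v, h, hW, -, hH, heq, -⟩ := hw
  refine ⟨h, hH, fun t ht => ?_⟩
  have hae : (fun τ => fracKernel α (t - τ) • caputo α v τ) =ᵐ[volume.restrict (Set.Ioc 0 t)]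
      fun τ => fracKernel α (t - τ) • (Complex.I ^ (β : ℂ))⁻¹ • h τ := by
    filter_upwards [ae_restrict_of_ae_restrict_of_subset Set.Ioc_subset_Ioi_self heq] with τ hτ
    rw [← neg_add_eq_zero.1 hτ, inv_smul_smul₀ (I_cpow_ne_zero _)]
  refine ⟨(integrableOn_fracKernel_smul_caputo hα hα1 (hW.1 t ht)).congr hae, ?_⟩
  rw [hW.2 t ht.le, hw0, ← fracIntegral_caputo hα hα1 ht.le (hW.1 t ht), fracIntegral,
    fracIntegral, intervalIntegral.integral_of_le ht.le, intervalIntegral.integral_of_le ht.le,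
    integral_congr_ae hae]

theorem truncatedMultiplier_one_of_isFreeHamiltonian (r : ℝ) {f h : L2Space d}
    (hf : IsFreeHamiltonian f h) :
    truncatedMultiplier 1 r h =
      truncatedMultiplier (freeSymbol (RSpace d)) r (truncatedMultiplier 1 r f) := by
  refine eq_of_fourier_ae_eq ?_
  filter_upwards [fourier_truncatedMultiplier 1 r h, fourier_truncatedMultiplier 1 r f,
    fourier_truncatedMultiplier (freeSymbol (RSpace d)) r (truncatedMultiplier 1 r f),
    isFreeHamiltonian_iff.1 hf] with η hh hf hsymbol hfree
  rw [hh, hsymbol]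
  by_cases hη : η ∈ Metric.closedBall (0 : RSpace d) r
  · simp only [Set.indicator_of_mem hη, hf, hfree, ContinuousMap.one_apply, one_mul]
  · rw [Set.indicator_of_notMem hη, Set.indicator_of_notMem hη]

theorem eq_zero_of_forall_truncatedMultiplier_one_eq_zero {f : L2Space d}
    (hf : ∀ n : ℕ, truncatedMultiplier 1 n f = 0) : f = 0 := by
  refine eq_of_fourier_ae_eq ?_
  have hball (n : ℕ) : ∀ᵐ η, η ∈ Metric.closedBall (0 : RSpace d) n →
      (𝓕 f : L2Space d) η = (𝓕 (0 : L2Space d) : L2Space d) η := by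
    have hn := fourier_truncatedMultiplier 1 n f
    rw [hf n] at hn
    filter_upwards [hn] with η hη hηn
    rw [hη, Set.indicator_of_mem hηn, ContinuousMap.one_apply, one_mul]
  filter_upwards [ae_all_iff.2 hball] with η hη
  obtain ⟨n, hn⟩ := exists_nat_ge ‖η‖
  exact hη n (by simpa using hn)

theorem IsTFSESolution.truncatedMultiplier_eq (hα : 0 < α) (hα1 : α ≤ 1)
    (hw : IsTFSESolution α β φ w) (r : ℝ) (ht : 0 < t) :
    IntervalIntegrable (fun τ => fracKernel α (t - τ) •
      truncatedGenerator (Complex.I ^ (β : ℂ))⁻¹ r (truncatedMultiplier 1 r (w τ))) volume 0 t ∧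
    truncatedMultiplier 1 r (w t) = truncatedMultiplier 1 r φ + fracIntegral α (fun τ =>
      truncatedGenerator (Complex.I ^ (β : ℂ))⁻¹ r (truncatedMultiplier 1 r (w τ))) t := by
  obtain ⟨h, hH, hint⟩ := hw.exists_eq_add_fracIntegral hα hα1
  obtain ⟨hI, hwt⟩ := hint t ht
  set P : L2Space d →L[ℂ] L2Space d := truncatedMultiplier 1 r with hP
  have hae : (fun τ => P (fracKernel α (t - τ) • (Complex.I ^ (β : ℂ))⁻¹ • h τ))
      =ᵐ[volume.restrict (Set.Ioc 0 t)]
      fun τ => fracKernel α (t - τ) •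
        truncatedGenerator (Complex.I ^ (β : ℂ))⁻¹ r (P (w τ)) := by
    filter_upwards [ae_restrict_of_ae_restrict_of_subset Set.Ioc_subset_Ioi_self hH] with τ hτ
    rw [map_real_smul P P.continuous, map_smul, hP,
      truncatedMultiplier_one_of_isFreeHamiltonian r hτ, truncatedGenerator_apply]
  refine ⟨(intervalIntegrable_iff_integrableOn_Ioc_of_le ht.le).2
    ((P.integrable_comp hI).congr hae), ?_⟩
  rw [hwt, map_add, fracIntegral, fracIntegral, intervalIntegral.integral_of_le ht.le,
    intervalIntegral.integral_of_le ht.le, ← integral_congr_ae hae,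
    ContinuousLinearMap.integral_comp_comm _ hI]

theorem IsTFSESolution.unique (hα : 0 < α) (hα1 : α ≤ 1) (hu : IsTFSESolution α β φ u)
    (hw : IsTFSESolution α β φ w) (ht : 0 ≤ t) : w t = u t := by
  rcases ht.eq_or_lt with rfl | ht
  · rw [hw.apply_zero, hu.apply_zero]
  rw [← sub_eq_zero]
  refine eq_zero_of_forall_truncatedMultiplier_one_eq_zero fun n => ?_
  set P : L2Space d →L[ℂ] L2Space d := truncatedMultiplier 1 (n : ℝ) with hP
  obtain ⟨M, hM⟩ := isCompact_Icc.exists_bound_of_continuousOn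
    (P.continuous.comp_continuousOn ((hw.continuousOn ht).sub (hu.continuousOn ht)))
  refine eq_zero_of_eq_fracIntegral hα (truncatedGenerator (Complex.I ^ (β : ℂ))⁻¹ n)
    (z := fun τ => P (w τ - u τ)) (fun τ hτ => hM τ ⟨hτ.1.le, hτ.2⟩) (fun τ hτ => ?_) t
    ⟨ht, le_rfl⟩
  obtain ⟨hwint, hwτ⟩ := hw.truncatedMultiplier_eq hα hα1 n hτ.1
  obtain ⟨huint, huτ⟩ := hu.truncatedMultiplier_eq hα hα1 n hτ.1
  simp only [fracIntegral, map_sub, smul_sub]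
  rw [intervalIntegral.integral_sub hwint huint, hP, hwτ, huτ, add_sub_add_left_eq_sub,
    fracIntegral, fracIntegral]

end TimeFractionalSchrodinger

section SquareIntegralBounds

/-! ### Growth of the mean square displacement -/

variable {X F : Type*} [MeasurableSpace X] [NormedAddCommGroup F] {μ : Measure X} {f : X → F}
  {S : Set X} {b : ℝ}

theorem integral_norm_sq_le_of_norm_le_indicator (hS : MeasurableSet S) (hSμ : μ S ≠ ⊤)
    (hf : ∀ x, ‖f x‖ ≤ S.indicator (fun _ => b) x) :
    ∫ x, ‖f x‖ ^ 2 ∂μ ≤ μ.real S * b ^ 2 := by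
  have hsq (x : X) : ‖f x‖ ^ 2 ≤ S.indicator (fun _ => b ^ 2) x :=
    (pow_le_pow_left₀ (norm_nonneg _) (hf x) 2).trans_eq (by by_cases hx : x ∈ S <;> simp [hx])
  calc ∫ x, ‖f x‖ ^ 2 ∂μ ≤ ∫ x, S.indicator (fun _ => b ^ 2) x ∂μ :=
        integral_mono_of_nonneg (ae_of_all _ fun x => sq_nonneg _)
          ((integrableOn_const hSμ).integrable_indicator hS) (ae_of_all _ hsq)
    _ = μ.real S * b ^ 2 := by rw [integral_indicator_const _ hS, smul_eq_mul]

theorem measureReal_mul_sq_le_integral_norm_sq (hfi : Integrable (fun x => ‖f x‖ ^ 2) μ)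
    (hS : MeasurableSet S) (hSμ : μ S ≠ ⊤) (hb : 0 ≤ b) (hf : ∀ x ∈ S, b ≤ ‖f x‖) :
    μ.real S * b ^ 2 ≤ ∫ x, ‖f x‖ ^ 2 ∂μ :=
  calc μ.real S * b ^ 2 = ∫ _ in S, b ^ 2 ∂μ := by rw [setIntegral_const, smul_eq_mul]
    _ ≤ ∫ x in S, ‖f x‖ ^ 2 ∂μ := setIntegral_mono_on (integrableOn_const hSμ) hfi.integrableOn hS
        fun x hx => pow_le_pow_left₀ hb (hf x hx) 2
    _ ≤ ∫ x, ‖f x‖ ^ 2 ∂μ := setIntegral_le_integral hfi (ae_of_all _ fun x => sq_nonneg _)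

end SquareIntegralBounds

section EvolvedSymbolGrowth

open FourierTransform

variable {d : ℕ} {α : ℝ} {s₀ : ℂ} {G : RSpace d → ℂ}

theorem exists_meanSquareDisplacement_le (hα : 0 < α) (hα1 : α ≤ 1) (hs₀ : 0 < s₀.re)
    (hG : ContDiff ℝ 1 G) (hGc : HasCompactSupport G) {R : ℝ} (hR : 0 < R)
    (hGR : ∀ η, R ≤ ‖η‖ → G η = 0) :
    ∃ K : ℝ, 0 ≤ K ∧ ∀ t : ℝ, 1 ≤ t → ∀ φ : L2Space d,
      (𝓕 φ : L2Space d) =ᵐ[volume] evolvedSymbol α (s₀ ^ (α : ℂ)) G t →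
      meanSquareDisplacement φ ≤
        K * Real.exp (s₀.re * ((2 * Real.pi * R) ^ (2 / α) * t)) ^ 2 := by
  obtain ⟨L, hL⟩ := hG.lipschitzWith_of_hasCompactSupport hGc one_ne_zero
  obtain ⟨K, -, hbound⟩ := exists_norm_fderiv_evolvedSymbol_le hα hα1 hs₀
    (hG.differentiable one_ne_zero) hL hR hGR
  set V := volume.real (Metric.closedBall (0 : RSpace d) R)
  refine ⟨((2 * Real.pi) ^ 2)⁻¹ * (d * (V * K ^ 2)), by positivity, fun t ht φ hφ => ?_⟩
  set M := Real.exp (s₀.re * ((2 * Real.pi * R) ^ (2 / α) * t))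
  rw [meanSquareDisplacement_of_fourier_ae_eq (contDiff_evolvedSymbol hα hG t)
    (hasCompactSupport_evolvedSymbol hGc t) hφ, mul_assoc]
  refine mul_le_mul_of_nonneg_left ?_ (by positivity)
  calc ∑ j, ∫ η, ‖fderiv ℝ (evolvedSymbol α (s₀ ^ (α : ℂ)) G t) η
          (EuclideanSpace.single j 1)‖ ^ 2
      ≤ ∑ _j : Fin d, V * (K * M) ^ 2 := Finset.sum_le_sum fun j _ =>
        integral_norm_sq_le_of_norm_le_indicator measurableSet_closedBall
          (isCompact_closedBall _ _).measure_ne_top fun η => hbound t ht η _ (by simp)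
    _ = d * (V * K ^ 2) * M ^ 2 := by
        rw [Finset.sum_const, Finset.card_univ, Fintype.card_fin, nsmul_eq_mul]
        ring

theorem exists_ball_le_of_ne_zero (hG : Continuous G) {η₁ : RSpace d} (hη₁ : G η₁ ≠ 0) {j : Fin d}
    (hj : η₁ j ≠ 0) {ρ : ℝ} (hρη : ρ < 2 * Real.pi * ‖η₁‖) :
    ∃ δ > 0, ∀ η ∈ Metric.ball η₁ δ, ρ < 2 * Real.pi * ‖η‖ ∧
      |η₁ j| / 2 < |inner ℝ η (EuclideanSpace.single j 1)| ∧ ‖G η₁‖ / 2 < ‖G η‖ := by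
  have hnorm : ContinuousAt (fun η : RSpace d => 2 * Real.pi * ‖η‖) η₁ := by fun_prop
  have hinner : ContinuousAt (fun η : RSpace d => |inner ℝ η (EuclideanSpace.single j 1)|) η₁ := by
    fun_prop
  refine Metric.eventually_nhds_iff_ball.1 ((hnorm.eventually_const_lt hρη).and
    ((hinner.eventually_const_lt ?_).and
      (hG.norm.continuousAt.eventually_const_lt (half_lt_self (norm_pos_iff.2 hη₁)))))
  simpa only [EuclideanSpace.inner_single_right, one_mul, conj_trivial] using
    half_lt_self (abs_pos.2 hj)

theorem exists_ball_le_norm_fderiv_evolvedSymbol (hα : 0 < α) (hα1 : α ≤ 1) (hs₀ : 0 < s₀.re)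
    (hG : ContDiff ℝ 1 G) (hGc : HasCompactSupport G) {η₁ : RSpace d} (hη₁ : G η₁ ≠ 0) {ρ : ℝ}
    (hρ : 0 < ρ) (hρη : ρ < 2 * Real.pi * ‖η₁‖) :
    ∃ (j : Fin d) (δ T : ℝ), 0 < δ ∧ ∀ t : ℝ, T ≤ t → ∀ η ∈ Metric.ball η₁ δ,
      Real.exp (s₀.re * (ρ ^ (2 / α) * t)) ≤
        ‖fderiv ℝ (evolvedSymbol α (s₀ ^ (α : ℂ)) G t) η (EuclideanSpace.single j 1)‖ := by
  obtain ⟨j, hj⟩ : ∃ j, η₁ j ≠ 0 := by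
    by_contra! h
    rw [show η₁ = 0 from PiLp.ext h, norm_zero, mul_zero] at hρη
    exact lt_asymm hρ hρη
  obtain ⟨L, hL⟩ := hG.lipschitzWith_of_hasCompactSupport hGc one_ne_zero
  obtain ⟨δ, hδ, hball⟩ := exists_ball_le_of_ne_zero hG.continuous hη₁ hj hρη
  have hnorm (η : RSpace d) (hη : η ∈ Metric.ball η₁ δ) : ‖η‖ ≤ ‖η₁‖ + δ := by
    linarith [norm_le_norm_add_norm_sub' η η₁, mem_ball_iff_norm.1 hη]
  obtain ⟨T, -, hT⟩ := exists_le_norm_fderiv_evolvedSymbol hα hα1 hs₀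
    (hG.differentiable one_ne_zero) hL (by simp : ‖EuclideanSpace.single j (1 : ℝ)‖ ≤ 1)
    (by positivity) hρ (half_pos (abs_pos.2 hj)) (half_pos (norm_pos_iff.2 hη₁)) hnorm
    (fun η hη => (hball η hη).1.le) (fun η hη => (hball η hη).2.1.le)
    fun η hη => (hball η hη).2.2.le
  exact ⟨j, δ, T, hδ, hT⟩

theorem integrable_norm_sq_fderiv_apply {U : RSpace d → ℂ} (hU : ContDiff ℝ 1 U)
    (hUc : HasCompactSupport U) (e : RSpace d) : Integrable fun η => ‖fderiv ℝ U η e‖ ^ 2 :=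
  ((continuous_fderiv_apply hU e).memLp_of_hasCompactSupport
    (hasCompactSupport_fderiv_apply hUc e)).integrable_norm_pow two_ne_zero

theorem exists_le_meanSquareDisplacement (hα : 0 < α) (hα1 : α ≤ 1) (hs₀ : 0 < s₀.re)
    (hG : ContDiff ℝ 1 G) (hGc : HasCompactSupport G) {η₁ : RSpace d} (hη₁ : G η₁ ≠ 0) {ρ : ℝ}
    (hρ : 0 < ρ) (hρη : ρ < 2 * Real.pi * ‖η₁‖) :
    ∃ c T : ℝ, 0 < c ∧ ∀ t : ℝ, T ≤ t → ∀ φ : L2Space d,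
      (𝓕 φ : L2Space d) =ᵐ[volume] evolvedSymbol α (s₀ ^ (α : ℂ)) G t →
      c * Real.exp (s₀.re * (ρ ^ (2 / α) * t)) ^ 2 ≤ meanSquareDisplacement φ := by
  obtain ⟨j, δ, T, hδ, hT⟩ :=
    exists_ball_le_norm_fderiv_evolvedSymbol hα hα1 hs₀ hG hGc hη₁ hρ hρη
  have : 0 < volume.real (Metric.ball η₁ δ) :=
    ENNReal.toReal_pos (Metric.measure_ball_pos volume η₁ hδ).ne' measure_ball_lt_top.ne
  refine ⟨((2 * Real.pi) ^ 2)⁻¹ * volume.real (Metric.ball η₁ δ), T, by positivity,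
    fun t ht φ hφ => ?_⟩
  have hU := contDiff_evolvedSymbol (ω := s₀ ^ (α : ℂ)) hα hG t
  have hUc := hasCompactSupport_evolvedSymbol (α := α) (ω := s₀ ^ (α : ℂ)) hGc t
  rw [meanSquareDisplacement_of_fourier_ae_eq hU hUc hφ, mul_assoc]
  refine mul_le_mul_of_nonneg_left ?_ (by positivity)
  refine (measureReal_mul_sq_le_integral_norm_sq
    (integrable_norm_sq_fderiv_apply hU hUc _) measurableSet_ball measure_ball_lt_top.ne
    (Real.exp_pos _).le (hT t ht)).trans ?_
  exact Finset.single_le_sum (f := fun j : Fin d => ∫ η, ‖fderiv ℝ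
    (evolvedSymbol α (s₀ ^ (α : ℂ)) G t) η (EuclideanSpace.single j 1)‖ ^ 2)
    (fun i _ => integral_nonneg fun η => sq_nonneg _) (Finset.mem_univ j)

end EvolvedSymbolGrowth

section GrowthExp

variable {α β L L' ρ c t : ℝ}

/-- The root `s₀ = exp(-iπβ/(2α))` of `s₀ ^ α = i^{-β}`, the exponential rate of the solution at
unit frequency. -/
noncomputable def growthRate (α β : ℝ) : ℂ :=
  Complex.exp (((-(Real.pi * β / (2 * α)) : ℝ) : ℂ) * Complex.I)

theorem growthRate_re : (growthRate α β).re = Real.cos (Real.pi * β / (2 * α)) := by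
  rw [growthRate, Complex.exp_ofReal_mul_I_re, Real.cos_neg]

theorem cos_pi_mul_div_pos (hβ : 0 < β) (hβα : β < α) :
    0 < Real.cos (Real.pi * β / (2 * α)) := by
  have hα : 0 < α := hβ.trans hβα
  have : 0 < Real.pi * β / (2 * α) := by positivity
  refine Real.cos_pos_of_mem_Ioo ⟨by linarith [Real.pi_pos], ?_⟩
  rw [div_lt_div_iff₀ (by positivity) two_pos]
  nlinarith [Real.pi_pos]

theorem growthRate_cpow (hβ : 0 < β) (hβα : β < α) :
    growthRate α β ^ (α : ℂ) = (Complex.I ^ (β : ℂ))⁻¹ := by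
  have hα : 0 < α := hβ.trans hβα
  have hpos : 0 < Real.pi * β / (2 * α) := by positivity
  have hlt : Real.pi * β / (2 * α) < Real.pi := by
    rw [div_lt_iff₀ (by positivity)]
    nlinarith [Real.pi_pos]
  have him : (((-(Real.pi * β / (2 * α)) : ℝ) : ℂ) * Complex.I).im = -(Real.pi * β / (2 * α)) := by
    rw [Complex.im_ofReal_mul, Complex.I_im, mul_one]
  rw [growthRate, Complex.cpow_def_of_ne_zero (Complex.exp_ne_zero _),
    Complex.log_exp (by rw [him]; linarith) (by rw [him]; linarith [Real.pi_pos]),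
    Complex.cpow_def_of_ne_zero Complex.I_ne_zero, Complex.log_I, ← Complex.exp_neg]
  have : (α : ℂ) ≠ 0 := by exact_mod_cast hα.ne'
  push_cast
  field_simp

theorem growthExp_eq_sq :
    growthExp α β L t =
      Real.exp (Real.cos (Real.pi * β / (2 * α)) * (L ^ (2 / α) * t)) ^ 2 := by
  rw [growthExp, ← Real.exp_nat_mul]
  push_cast
  ring_nf

theorem growthExp_pos : 0 < growthExp α β L t :=
  Real.exp_pos _

theorem eventually_mul_growthExp_mono (hα : 0 < α)
    (hκ : 0 ≤ Real.cos (Real.pi * β / (2 * α))) (hL : 0 ≤ L) (hLL' : L ≤ L') (hc : 0 ≤ c) :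
    ∀ᶠ t in atTop, c * growthExp α β L t ≤ c * growthExp α β L' t := by
  filter_upwards [eventually_ge_atTop 0] with t ht
  unfold growthExp
  gcongr

theorem eventually_pow_mul_exp_le {a b : ℝ} (hab : a < b) (hc : 0 < c) (A : ℝ) (n : ℕ) :
    ∀ᶠ t : ℝ in atTop, A * t ^ n * Real.exp (a * t) ≤ c * Real.exp (b * t) := by
  have hlittle : (fun t : ℝ => A * t ^ n) =o[atTop] fun t => Real.exp ((b - a) * t) :=
    (isLittleO_pow_exp_pos_mul_atTop n (sub_pos.2 hab)).const_mul_left A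
  filter_upwards [hlittle.def hc] with t ht
  rw [Real.norm_of_nonneg (Real.exp_pos _).le] at ht
  calc A * t ^ n * Real.exp (a * t)
      ≤ c * Real.exp ((b - a) * t) * Real.exp (a * t) := by
        gcongr ?_ * _
        exact (le_abs_self _).trans ht
    _ = c * Real.exp (b * t) := by rw [mul_assoc, ← Real.exp_add]; ring_nf

theorem eventually_pow_mul_growthExp_le (hα : 0 < α)
    (hκ : 0 < Real.cos (Real.pi * β / (2 * α))) (hL : 0 ≤ L) (hLρ : L < ρ) (hc : 0 < c) (A : ℝ)
    (n : ℕ) : ∀ᶠ t in atTop, A * t ^ n * growthExp α β L t ≤ c * growthExp α β ρ t :=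
  eventually_pow_mul_exp_le (mul_lt_mul_of_pos_left
    (Real.rpow_lt_rpow hL hLρ (by positivity)) (by positivity)) hc A n

theorem exists_eventually_exp_le_mul_growthExp (hκ : 0 < Real.cos (Real.pi * β / (2 * α)))
    (hρ : 0 < ρ) (hc : 0 < c) :
    ∃ a : ℝ, 0 < a ∧ ∀ᶠ t in atTop, Real.exp (a * t) ≤ c * growthExp α β ρ t := by
  refine ⟨Real.cos (Real.pi * β / (2 * α)) * ρ ^ (2 / α), by positivity, ?_⟩
  have hgap : Real.cos (Real.pi * β / (2 * α)) * ρ ^ (2 / α) <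
      2 * Real.cos (Real.pi * β / (2 * α)) * ρ ^ (2 / α) := by
    rw [mul_assoc]
    exact lt_mul_of_one_lt_left (by positivity) one_lt_two
  simpa only [pow_zero, mul_one, one_mul] using! eventually_pow_mul_exp_le hgap hc 1 0

theorem exists_isBigO_inv_and_eventually_le {D e₁ e₂ : ℝ → ℝ} {p N K : ℝ} {n : ℕ} (hn : n ≠ 0)
    (hp : 0 < p) (hN : 0 ≤ N) (hK : 0 ≤ K) (he₂ : ∀ t, 0 ≤ e₂ t)
    (hlow : ∀ᶠ t in atTop, p * N * t ^ n * e₁ t ≤ D t) (hup : ∀ᶠ t in atTop, D t ≤ K * e₂ t) :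
    ∃ r s : ℝ → ℝ, r =O[atTop] (fun t : ℝ => t⁻¹) ∧ s =O[atTop] (fun t : ℝ => t⁻¹) ∧
      ∀ᶠ t in atTop, p * e₁ t * t ^ n * (N + r t) ≤ D t ∧
        D t ≤ p * e₂ t * t ^ n * (N + s t) := by
  refine ⟨0, fun t => K / p * t⁻¹, isBigO_zero _ _, (isBigO_refl _ _).const_mul_left _, ?_⟩
  filter_upwards [hlow, hup, eventually_ge_atTop 1] with t hlow hup ht
  have : 0 < t := one_pos.trans_le ht
  have := he₂ t
  refine ⟨le_of_eq_of_le (by simp only [Pi.zero_apply]; ring) hlow, ?_⟩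
  calc D t ≤ K * e₂ t := hup
    _ ≤ K * e₂ t * t ^ (n - 1) := le_mul_of_one_le_right (by positivity) (one_le_pow₀ ht)
    _ = p * e₂ t * t ^ n * (K / p * t⁻¹) := by
        rw [← pow_sub_one_mul hn t]
        field_simp
    _ ≤ p * e₂ t * t ^ n * (N + K / p * t⁻¹) := by
        gcongr
        exact le_add_of_nonneg_left hN

end GrowthExp

section SolutionGrowth

open FourierTransform

variable {d : ℕ} {α β : ℝ} {g : RSpace d → ℂ}

theorem exists_isTFSESolution_fourier_ae_eq (hα : 0 < α) (hα1 : α ≤ 1) (hg : Continuous g)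
    (hgc : HasCompactSupport g) {u₀ : L2Space d} (hu₀ : u₀ =ᵐ[volume] adjointFourier g) :
    ∃ u : ℝ → L2Space d, IsTFSESolution α β u₀ u ∧ ∀ t : ℝ, 0 ≤ t →
      (𝓕 (u t) : L2Space d) =ᵐ[volume]
        evolvedSymbol α (Complex.I ^ (β : ℂ))⁻¹ (rescaledProfile g) t := by
  obtain ⟨R, hR⟩ := (hasCompactSupport_rescaledProfile hgc).isCompact.isBounded.exists_norm_le
  have hGR (η : RSpace d) (hη : R < ‖η‖) : rescaledProfile g η = 0 :=
    image_eq_zero_of_notMem_tsupport fun hmem => (hR η hmem).not_gt hη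
  have hF := fourier_ae_eq_rescaledProfile hg hgc hu₀
  exact ⟨_, isTFSESolution_fracSeries hα hα1 hGR hF, fun t ht =>
    fourier_fracSeries hα _ hGR hF ht⟩

theorem memWeightedL2_of_fourier_ae_eq_evolvedSymbol (hα : 0 < α) (hg : ContDiff ℝ 1 g)
    (hgc : HasCompactSupport g) {ω : ℂ} {t : ℝ} {φ : L2Space d}
    (hφ : (𝓕 φ : L2Space d) =ᵐ[volume] evolvedSymbol α ω (rescaledProfile g) t) :
    MemWeightedL2 φ :=
  memWeightedL2_of_fourier_ae_eq (contDiff_evolvedSymbol hα (contDiff_rescaledProfile hg) t)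
    (hasCompactSupport_evolvedSymbol (hasCompactSupport_rescaledProfile hgc) t) hφ

theorem eq_zero_of_le_norm_of_forall_lt_norm {E F : Type*} [NormedAddCommGroup E]
    [NormedSpace ℝ E] [TopologicalSpace F] [T2Space F] [Zero F] {f : E → F} (hf : Continuous f)
    {R : ℝ} (hR : 0 < R) (hfR : ∀ x, R < ‖x‖ → f x = 0) {x : E} (hx : R ≤ ‖x‖) : f x = 0 := by
  have hlim : Tendsto (fun s : ℝ => f (s • x)) (𝓝[>] 1) (𝓝 (f x)) := by
    have : ContinuousAt (fun s : ℝ => f (s • x)) 1 := by fun_prop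
    simpa only [one_smul] using this.tendsto.mono_left nhdsWithin_le_nhds
  refine tendsto_nhds_unique hlim (tendsto_const_nhds.congr' ?_)
  filter_upwards [self_mem_nhdsWithin] with s (hs : 1 < s)
  rw [hfR _ (hx.trans_lt ?_)]
  rw [norm_smul, Real.norm_of_nonneg (by linarith)]
  exact lt_mul_of_one_lt_left (hR.trans_le hx) hs

theorem exists_norm_lt_norm_of_isOpen {E : Type*} [NormedAddCommGroup E] [NormedSpace ℝ E]
    [Nontrivial E] {U : Set E} (hU : IsOpen U) (hne : U.Nonempty) :
    ∃ x ∈ U, ∃ y ∈ U, ‖x‖ < ‖y‖ := by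
  obtain ⟨y, hy, hy0⟩ := (dense_compl_singleton (0 : E)).inter_open_nonempty U hU hne
  have hcont : ContinuousAt (fun s : ℝ => s • y) 1 := by fun_prop
  have hmem : ∀ᶠ s in 𝓝[<] (1 : ℝ), s • y ∈ U :=
    (hcont.eventually_mem (hU.mem_nhds (by rwa [one_smul]))).filter_mono nhdsWithin_le_nhds
  obtain ⟨s, hs, hs0, hs1⟩ := (hmem.and (Ioo_mem_nhdsLT (zero_lt_one' ℝ))).exists
  refine ⟨s • y, hs, y, hy, ?_⟩
  rw [norm_smul, Real.norm_of_nonneg hs0.le]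
  exact mul_lt_of_lt_one_left (norm_pos_iff.2 hy0) hs1

theorem exists_meanSquareDisplacement_le_mul_growthExp (hβ : 0 < β) (hβα : β < α) (hα1 : α ≤ 1)
    (hg : ContDiff ℝ 1 g) (hgc : HasCompactSupport g) {Λ : ℝ} (hΛ : 0 < Λ)
    (hgΛ : ∀ ξ, Λ < ‖ξ‖ → g ξ = 0) {u : ℝ → L2Space d}
    (hu : ∀ t : ℝ, 0 ≤ t → (𝓕 (u t) : L2Space d) =ᵐ[volume]
      evolvedSymbol α (Complex.I ^ (β : ℂ))⁻¹ (rescaledProfile g) t) :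
    ∃ K : ℝ, 0 < K ∧ ∀ᶠ t in atTop, meanSquareDisplacement (u t) ≤ K * growthExp α β Λ t := by
  have h2π : 0 < 2 * Real.pi := by positivity
  have hre : 0 < (growthRate α β).re := growthRate_re ▸ cos_pi_mul_div_pos hβ hβα
  have hGR (η : RSpace d) (hη : Λ / (2 * Real.pi) ≤ ‖η‖) : rescaledProfile g η = 0 := by
    by_contra h
    refine rescaledProfile_ne_zero_iff.1 h
      (eq_zero_of_le_norm_of_forall_lt_norm hg.continuous hΛ hgΛ ?_)
    rwa [norm_smul, Real.norm_of_nonneg h2π.le, ← div_le_iff₀' h2π]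
  obtain ⟨K, hK, hbound⟩ := exists_meanSquareDisplacement_le (hβ.trans hβα) hα1 hre
    (contDiff_rescaledProfile hg) (hasCompactSupport_rescaledProfile hgc)
    (R := Λ / (2 * Real.pi)) (by positivity) hGR
  refine ⟨K + 1, by positivity, ?_⟩
  filter_upwards [eventually_ge_atTop 1] with t ht
  refine le_trans ?_ (mul_le_mul_of_nonneg_right (lt_add_one K).le growthExp_pos.le)
  rw [growthExp_eq_sq, ← growthRate_re, ← mul_div_cancel₀ Λ h2π.ne']
  exact hbound t ht _ (by rw [growthRate_cpow hβ hβα]; exact hu t (by linarith))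

theorem exists_mem_tsupport_meanSquareDisplacement_le [Nonempty (Fin d)] (hβ : 0 < β)
    (hβα : β < α) (hα1 : α ≤ 1) (hg : ContDiff ℝ 1 g) (hgc : HasCompactSupport g) (hg0 : g ≠ 0)
    {u : ℝ → L2Space d}
    (hu : ∀ t : ℝ, 0 ≤ t → (𝓕 (u t) : L2Space d) =ᵐ[volume]
      evolvedSymbol α (Complex.I ^ (β : ℂ))⁻¹ (rescaledProfile g) t) :
    ∃ ξ ∈ tsupport g, ∃ K : ℝ, 0 < K ∧
      ∀ᶠ t in atTop, meanSquareDisplacement (u t) ≤ K * growthExp α β ‖ξ‖ t := by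
  obtain ⟨x, -, y, hy, hxy⟩ := exists_norm_lt_norm_of_isOpen hg.continuous.isOpen_support
    (Function.support_nonempty_iff.2 hg0)
  obtain ⟨ξ, hξ, hmax⟩ :=
    hgc.isCompact.exists_isMaxOn ⟨y, subset_tsupport g hy⟩ continuous_norm.continuousOn
  refine ⟨ξ, hξ, exists_meanSquareDisplacement_le_mul_growthExp hβ hβα hα1 hg hgc ?_
    (fun ζ hζ => image_eq_zero_of_notMem_tsupport fun h => (hmax h).not_gt hζ) hu⟩
  exact (norm_nonneg x).trans_lt (hxy.trans_le (hmax (subset_tsupport g hy)))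

theorem exists_mul_growthExp_le_meanSquareDisplacement (hβ : 0 < β) (hβα : β < α) (hα1 : α ≤ 1)
    (hg : ContDiff ℝ 1 g) (hgc : HasCompactSupport g) {ξ : RSpace d} (hξ : g ξ ≠ 0) {ρ : ℝ}
    (hρ : 0 < ρ) (hρξ : ρ < ‖ξ‖) {u : ℝ → L2Space d}
    (hu : ∀ t : ℝ, 0 ≤ t → (𝓕 (u t) : L2Space d) =ᵐ[volume]
      evolvedSymbol α (Complex.I ^ (β : ℂ))⁻¹ (rescaledProfile g) t) :
    ∃ c : ℝ, 0 < c ∧ ∀ᶠ t in atTop, c * growthExp α β ρ t ≤ meanSquareDisplacement (u t) := by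
  have h2π : 0 < 2 * Real.pi := by positivity
  have hre : 0 < (growthRate α β).re := growthRate_re ▸ cos_pi_mul_div_pos hβ hβα
  have hnorm : 2 * Real.pi * ‖(2 * Real.pi)⁻¹ • ξ‖ = ‖ξ‖ := by
    rw [norm_smul, Real.norm_of_nonneg (by positivity), mul_inv_cancel_left₀ h2π.ne']
  obtain ⟨c, T, hc, hbound⟩ := exists_le_meanSquareDisplacement (hβ.trans hβα) hα1 hre
    (contDiff_rescaledProfile hg) (hasCompactSupport_rescaledProfile hgc)
    (η₁ := (2 * Real.pi)⁻¹ • ξ) (by rwa [rescaledProfile_ne_zero_iff, smul_inv_smul₀ h2π.ne'])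
    hρ (hnorm ▸ hρξ)
  refine ⟨c, hc, ?_⟩
  filter_upwards [eventually_ge_atTop T, eventually_ge_atTop 0] with t ht ht0
  rw [growthExp_eq_sq, ← growthRate_re]
  exact hbound t ht _ (by rw [growthRate_cpow hβ hβα]; exact hu t ht0)

theorem exists_mem_tsupport_le_meanSquareDisplacement [Nonempty (Fin d)] (hβ : 0 < β)
    (hβα : β < α) (hα1 : α ≤ 1) (hg : ContDiff ℝ 1 g) (hgc : HasCompactSupport g) (hg0 : g ≠ 0)
    {u : ℝ → L2Space d}
    (hu : ∀ t : ℝ, 0 ≤ t → (𝓕 (u t) : L2Space d) =ᵐ[volume]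
      evolvedSymbol α (Complex.I ^ (β : ℂ))⁻¹ (rescaledProfile g) t) :
    ∃ ξ ∈ tsupport g, ∃ ρ : ℝ, ‖ξ‖ < ρ ∧ ∃ c : ℝ, 0 < c ∧
      ∀ᶠ t in atTop, c * growthExp α β ρ t ≤ meanSquareDisplacement (u t) := by
  obtain ⟨ξ, hξ, ζ, hζ, hξζ⟩ := exists_norm_lt_norm_of_isOpen hg.continuous.isOpen_support
    (Function.support_nonempty_iff.2 hg0)
  obtain ⟨ρ, hξρ, hρζ⟩ := exists_between hξζ
  exact ⟨ξ, subset_tsupport g hξ, ρ, hξρ, exists_mul_growthExp_le_meanSquareDisplacement hβ hβα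
    hα1 hg hgc hζ ((norm_nonneg ξ).trans_lt hξρ) hρζ hu⟩

theorem weightedNormSq_nonneg (α : ℝ) (g : RSpace d → ℂ) : 0 ≤ weightedNormSq α g :=
  integral_nonneg fun _ => sq_nonneg _

end SolutionGrowth

theorem mainTheorem3 (d : ℕ) (hd : 1 ≤ d) (α β : ℝ) (hβ : 0 < β) (hβα : β < α) (hα : α ≤ 1)
    (g : RSpace d → ℂ) (hg : ContDiff ℝ 1 g) (hgc : HasCompactSupport g) (hg0 : g ≠ 0)
    (u₀ : L2Space d) (hu₀ : (u₀ : RSpace d → ℂ) =ᵐ[volume] adjointFourier g) :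
    ∃ u : ℝ → L2Space d,
      IsTFSESolution α β u₀ u ∧
      (∀ w : ℝ → L2Space d, IsTFSESolution α β u₀ w → ∀ t : ℝ, 0 ≤ t → w t = u t) ∧
      (∀ t : ℝ, 0 ≤ t → MemWeightedL2 (u t)) ∧
      (∃ a : ℝ, 0 < a ∧ ∀ᶠ t in atTop, Real.exp (a * t) ≤ meanSquareDisplacement (u t)) ∧
      ∃ c C : ℝ, 0 < c ∧ 0 < C ∧ ∀ Lm Lp : ℝ, 0 ≤ Lm →
        tsupport g ⊆ {ξ : RSpace d | Lm ≤ ‖ξ‖ ∧ ‖ξ‖ ≤ Lp} →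
        (∃ r s : ℝ → ℝ, r =O[atTop] (fun t : ℝ => t⁻¹) ∧ s =O[atTop] (fun t : ℝ => t⁻¹) ∧
          ∀ᶠ t in atTop,
            growthExp α β Lm t * (c + r t) ≤ meanSquareDisplacement (u t) ∧
            meanSquareDisplacement (u t) ≤ growthExp α β Lp t * (C + s t)) ∧
        (∃ r s : ℝ → ℝ, r =O[atTop] (fun t : ℝ => t⁻¹) ∧ s =O[atTop] (fun t : ℝ => t⁻¹) ∧
          ∀ᶠ t in atTop,
            4 / α ^ 2 * growthExp α β Lm t * t * (weightedNormSq α g + r t)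
              ≤ meanSquareDisplacement (u t) ∧
            meanSquareDisplacement (u t)
              ≤ 4 / α ^ 2 * growthExp α β Lp t * t * (weightedNormSq α g + s t)) ∧
        (∃ r s : ℝ → ℝ, r =O[atTop] (fun t : ℝ => t⁻¹) ∧ s =O[atTop] (fun t : ℝ => t⁻¹) ∧
          ∀ᶠ t in atTop,
            4 / α ^ 4 * growthExp α β Lm t * t ^ 2 * (weightedNormSq α g + r t)
              ≤ meanSquareDisplacement (u t) ∧
            meanSquareDisplacement (u t)
              ≤ 4 / α ^ 4 * growthExp α β Lp t * t ^ 2 * (weightedNormSq α g + s t)) := by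
  have hα0 : 0 < α := hβ.trans hβα
  have hκ := cos_pi_mul_div_pos hβ hβα
  have : Nonempty (Fin d) := ⟨⟨0, hd⟩⟩
  obtain ⟨u, hu, hFu⟩ :=
    exists_isTFSESolution_fourier_ae_eq (β := β) hα0 hα hg.continuous hgc hu₀
  obtain ⟨ξ, hξ, ρ, hξρ, c, hc, hlow⟩ :=
    exists_mem_tsupport_le_meanSquareDisplacement hβ hβα hα hg hgc hg0 hFu
  obtain ⟨η, hη, K, hK, hup⟩ :=
    exists_mem_tsupport_meanSquareDisplacement_le hβ hβα hα hg hgc hg0 hFu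
  obtain ⟨a, ha, hexp⟩ :=
    exists_eventually_exp_le_mul_growthExp hκ ((norm_nonneg ξ).trans_lt hξρ) hc
  refine ⟨u, hu, fun w hw t ht => hu.unique hα0 hα hw ht,
    fun t ht => memWeightedL2_of_fourier_ae_eq_evolvedSymbol hα0 hg hgc (hFu t ht),
    ⟨a, ha, EventuallyLE.trans hexp hlow⟩, 1, K, one_pos, hK, fun Lm Lp hLm hsupp => ?_⟩
  have hlow' (A : ℝ) (n : ℕ) :
      ∀ᶠ t in atTop, A * t ^ n * growthExp α β Lm t ≤ meanSquareDisplacement (u t) :=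
    EventuallyLE.trans (eventually_pow_mul_growthExp_le hα0 hκ hLm
      ((hsupp hξ).1.trans_lt hξρ) hc A n) hlow
  have hup' : ∀ᶠ t in atTop, meanSquareDisplacement (u t) ≤ K * growthExp α β Lp t :=
    EventuallyLE.trans hup
      (eventually_mul_growthExp_mono hα0 hκ.le (norm_nonneg η) (hsupp hη).2 hK.le)
  have hN := weightedNormSq_nonneg α g
  refine ⟨⟨0, 0, isBigO_zero _ _, isBigO_zero _ _, ?_⟩, ?_, ?_⟩
  · filter_upwards [hlow' 1 0, hup'] with t hlow hup
    simpa [mul_comm] using And.intro hlow hup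
  · simpa only [pow_one] using exists_isBigO_inv_and_eventually_le one_ne_zero (by positivity) hN
      hK.le (fun _ => growthExp_pos.le) (hlow' _ 1) hup'
  · exact exists_isBigO_inv_and_eventually_le two_ne_zero (by positivity) hN
      hK.le (fun _ => growthExp_pos.le) (hlow' _ 2) hup'
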